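/- Let $\Omega\subset\mathbb R^3$ be a bounded open set (for instance a bounded region with smooth boundary). Summation over repeated indices in $\{1,2,3\}$ is understood, $f_{,j}=\partial f/\partial x_j$, a dot is $\partial/\partial t$, and $e_{ij}=\frac12(u_{i,j}+u_{j,i})$. Let $\rho,c,A_{ijkl},B_{ijkl},C_{ijkl},\tilde C_{ijkl},K_{ij},\tilde K_{ij},a_{ij},b_{ij},d_{ij},c_{ij}$ be real coefficient functions of class $C^1(\overline\Omega)$ such that, on $\overline\Omega$: (i) $A_{ijkl}=A_{jikl}=A_{klij}$, $B_{ijkl}=B_{jikl}=B_{klij}$, $C_{ijkl}=C_{jikl}=C_{klij}$, and $a_{ij},b_{ij},d_{ij},c_{ij},K_{ij},\tilde K_{ij}$ are symmetric (no symmetry of $\tilde C$ is required); (ii) $\rho>0$, $c>0$, and $(c_{ij})$ is positive definite at every point; (iii) there is $c_0>0$ such that for all $u_i,\tau,R_i\in W^{1,2}_0(\Omega)$ $$\int_\Omega\big(A_{ijkl}e_{kl}e_{ij}+2B_{ijkl}e_{ij}R_{k,l}+K_{ij}\tau_{,i}\tau_{,j}+C_{ijkl}R_{i,j}R_{k,l}\big)\,dv\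 \ge\ c_0\int_\Omega\big(e_{ij}e_{ij}+\tau_{,i}\tau_{,i}+R_{i,j}R_{i,j}\big)\,dv;$$ (iv) the dissipation form is positive definite: at every point of $\overline\Omega$, $\tilde K_{ij}g_ig_j+\tilde C_{jikl}G_{kl}G_{ij}>0$ for all $(g,G)\in\mathbb R^3\times\mathbb R^{3\times3}$, $(g,G)\neq(0,0)$. Let $(u_i,\tau,R_i)$ be a solution on $[0,\infty)$, with arbitrary initial data, of the type III system without sources $$\rho\ddot u_i=(A_{jikl}e_{kl}-a_{ji}\dot\tau+B_{jikl}R_{l,k})_{,j},$$ $$c\,\ddot\tau=-a_{ij}\dot e_{ij}+(-d_{ij}\dot R_j+K_{ij}\tau_{,j}+\tilde K_{ij}\dot\tau_{,j})_{,i}-b_{ij}\dot R_{i,j},$$ $$c_{ij}\ddot R_j=(B_{klji}e_{kl}-b_{ji}\dot\tau+C_{jikl}R_{k,l}+\tilde C_{jikl}\dot R_{k,l})_{,j}-d_{ij}\dot\tau_{,j}$$ with $u_i=\tau=R_i=0$ on $\partial\Omega$, in the following sense: $u_i,\tau,R_i\in C^1([0,\infty),W^{1,2}_0(\Omega))\cap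 C^2([0,\infty),L^2(\Omega))$ and the equations hold at every $t\ge0$, the divergences being taken weakly in $\Omega$ (tested against $W^{1,2}_0(\Omega)$). If there is a finite time $t_0\ge0$ such that $u_i(t)=\tau(t)=R_i(t)=0$ for all $t\ge t_0$, then $u_i(t)=\tau(t)=R_i(t)=0$ for every $t\ge0$. -/

import Mathlib

namespace TypeIII

open MeasureTheory Set TopologicalSpace
open scoped Distributions ENNReal

noncomputable section

/-- Euclidean three-dimensional space. -/
abbrev Space : Type := EuclideanSpace ℝ (Fin 3)

/-- The partial derivative `φ_{,j}` of a scalar function on `ℝ³`. -/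
def partialDeriv (j : Fin 3) (φ : Space → ℝ) (x : Space) : ℝ :=
  fderiv ℝ φ x (EuclideanSpace.single j 1)

/-- The space `L²(Ω)`. -/
abbrev L2 (Ω : Opens Space) : Type := Lp ℝ 2 (volume.restrict (Ω : Set Space))

/-- All pairs `(φ, ∇φ)` with `φ ∈ C_c^∞(Ω)`, as a subspace of `L²(Ω) × L²(Ω)³`. -/
def testGraph (Ω : Opens Space) : Submodule ℝ (L2 Ω × (Fin 3 → L2 Ω)) where
  carrier := {p | ∃ φ : 𝓓(Ω, ℝ),
    (p.1 : Space → ℝ) =ᵐ[volume.restrict (Ω : Set Space)] φ ∧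
    ∀ j, (p.2 j : Space → ℝ) =ᵐ[volume.restrict (Ω : Set Space)] partialDeriv j φ}
  zero_mem' := by
    refine ⟨0, ?_, fun j => ?_⟩
    · exact (Lp.coeFn_zero ℝ 2 _).trans (by simp)
    · refine (Lp.coeFn_zero ℝ 2 _).trans (Filter.Eventually.of_forall fun x => ?_)
      simp [partialDeriv]
  add_mem' := by
    rintro p q ⟨φ, hφ, hφ'⟩ ⟨ψ, hψ, hψ'⟩
    refine ⟨φ + ψ, ?_, fun j => ?_⟩
    · filter_upwards [Lp.coeFn_add p.1 q.1, hφ, hψ] with x h1 h2 h3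
      simp only [Prod.fst_add, h1, Pi.add_apply, h2, h3, FunLike.coe_add]
    · filter_upwards [Lp.coeFn_add (p.2 j) (q.2 j), hφ' j, hψ' j] with x h1 h2 h3
      have hd : fderiv ℝ (⇑(φ + ψ)) x = fderiv ℝ φ x + fderiv ℝ ψ x := by
        rw [FunLike.coe_add]
        exact fderiv_add (φ.contDiff.differentiable (by simp) x)
          (ψ.contDiff.differentiable (by simp) x)
      simp only [Prod.snd_add, Pi.add_apply, h1, h2, h3, partialDeriv, hd,
        add_apply]
  smul_mem' := by
    rintro r p ⟨φ, hφ, hφ'⟩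
    refine ⟨r • φ, ?_, fun j => ?_⟩
    · filter_upwards [Lp.coeFn_smul r p.1, hφ] with x h1 h2
      simp [h1, h2]
    · filter_upwards [Lp.coeFn_smul r (p.2 j), hφ' j] with x h1 h2
      have hd : fderiv ℝ (⇑(r • φ)) x = r • fderiv ℝ φ x := by
        rw [FunLike.coe_smul]
        exact fderiv_const_smul (φ.contDiff.differentiable (by simp) x) r
      simp only [Prod.smul_snd, Pi.smul_apply, h1, h2, partialDeriv, hd,
        smul_apply]

/-- The Sobolev space `W₀^{1,2}(Ω)`, the closure of `C_c^∞(Ω)` in the `W^{1,2}` norm. An element is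
stored as the pair `(f, ∇f)` of a function and its weak gradient (which `f` determines), so that
the norm inherited from `L²(Ω) × L²(Ω)³` is equivalent to the `W^{1,2}` norm of `f`. -/
def W120 (Ω : Opens Space) : Submodule ℝ (L2 Ω × (Fin 3 → L2 Ω)) :=
  (testGraph Ω).topologicalClosure

/-- The inclusion `W₀^{1,2}(Ω) → L²(Ω)`. -/
def toL2 {Ω : Opens Space} (f : W120 Ω) : L2 Ω := f.1.1

/-- The weak partial derivative `f_{,j}` of `f ∈ W₀^{1,2}(Ω)`. -/
def grad {Ω : Opens Space} (f : W120 Ω) (j : Fin 3) : L2 Ω := f.1.2 j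

/-- The linear strain `e_{ij} = (u_{i,j} + u_{j,i}) / 2` of a displacement field. -/
def strain {Ω : Opens Space} (u : Fin 3 → W120 Ω) (i j : Fin 3) (x : Space) : ℝ :=
  (grad (u i) j x + grad (u j) i x) / 2

/-- Constitutive coefficients of a (possibly inhomogeneous) body: mass density `ρ`, heat capacity
`c`, and the tensor fields `A, B, C, C̃, K, K̃, a, b, d, c_{ij}`. -/
structure Coefficients where
  /-- mass density -/
  ρ : Space → ℝ
  /-- heat capacity -/
  c : Space → ℝ
  /-- elasticity tensor `A_{ijkl}` -/
  A : Space → Fin 3 → Fin 3 → Fin 3 → Fin 3 → ℝ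
  /-- microtemperature expansion tensor `B_{ijkl}` -/
  B : Space → Fin 3 → Fin 3 → Fin 3 → Fin 3 → ℝ
  /-- tensor `C_{ijkl}` -/
  C : Space → Fin 3 → Fin 3 → Fin 3 → Fin 3 → ℝ
  /-- dissipation tensor `C̃_{ijkl}` -/
  Ct : Space → Fin 3 → Fin 3 → Fin 3 → Fin 3 → ℝ
  /-- thermal conductivity tensor `K_{ij}` -/
  K : Space → Fin 3 → Fin 3 → ℝ
  /-- dissipation tensor `K̃_{ij}` -/
  Kt : Space → Fin 3 → Fin 3 → ℝ
  /-- thermal expansion tensor `a_{ij}` -/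
  a : Space → Fin 3 → Fin 3 → ℝ
  /-- tensor `b_{ij}` -/
  b : Space → Fin 3 → Fin 3 → ℝ
  /-- tensor `d_{ij}` -/
  d : Space → Fin 3 → Fin 3 → ℝ
  /-- tensor `c_{ij}` -/
  cc : Space → Fin 3 → Fin 3 → ℝ

namespace Coefficients

/-- All coefficients are of class `C¹` up to the boundary of `Ω`. -/
structure Regular (m : Coefficients) (Ω : Opens Space) : Prop where
  ρ : ContDiffOn ℝ 1 m.ρ (closure (Ω : Set Space))
  c : ContDiffOn ℝ 1 m.c (closure (Ω : Set Space))
  A : ContDiffOn ℝ 1 m.A (closure (Ω : Set Space))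
  B : ContDiffOn ℝ 1 m.B (closure (Ω : Set Space))
  C : ContDiffOn ℝ 1 m.C (closure (Ω : Set Space))
  Ct : ContDiffOn ℝ 1 m.Ct (closure (Ω : Set Space))
  K : ContDiffOn ℝ 1 m.K (closure (Ω : Set Space))
  Kt : ContDiffOn ℝ 1 m.Kt (closure (Ω : Set Space))
  a : ContDiffOn ℝ 1 m.a (closure (Ω : Set Space))
  b : ContDiffOn ℝ 1 m.b (closure (Ω : Set Space))
  d : ContDiffOn ℝ 1 m.d (closure (Ω : Set Space))
  cc : ContDiffOn ℝ 1 m.cc (closure (Ω : Set Space))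

/-- The symmetry relations of the constitutive coefficients. None is needed for `C̃`. -/
structure Symmetric (m : Coefficients) (Ω : Opens Space) : Prop where
  A : ∀ x ∈ closure (Ω : Set Space), ∀ i j k l,
    m.A x i j k l = m.A x j i k l ∧ m.A x i j k l = m.A x k l i j
  B : ∀ x ∈ closure (Ω : Set Space), ∀ i j k l,
    m.B x i j k l = m.B x j i k l ∧ m.B x i j k l = m.B x k l i j
  C : ∀ x ∈ closure (Ω : Set Space), ∀ i j k l,
    m.C x i j k l = m.C x j i k l ∧ m.C x i j k l = m.C x k l i j
  K : ∀ x ∈ closure (Ω : Set Space), ∀ i j, m.K x i j = m.K x j i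
  Kt : ∀ x ∈ closure (Ω : Set Space), ∀ i j, m.Kt x i j = m.Kt x j i
  a : ∀ x ∈ closure (Ω : Set Space), ∀ i j, m.a x i j = m.a x j i
  b : ∀ x ∈ closure (Ω : Set Space), ∀ i j, m.b x i j = m.b x j i
  d : ∀ x ∈ closure (Ω : Set Space), ∀ i j, m.d x i j = m.d x j i
  cc : ∀ x ∈ closure (Ω : Set Space), ∀ i j, m.cc x i j = m.cc x j i

/-- `ρ > 0`, `c > 0` and `c_{ij}` is positive definite: the kinetic part
`ρ v_i v_i + c θ² + c_{ij} M_i M_j` of the energy is positive definite. -/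
structure PositiveInertia (m : Coefficients) (Ω : Opens Space) : Prop where
  ρ : ∀ x ∈ closure (Ω : Set Space), 0 < m.ρ x
  c : ∀ x ∈ closure (Ω : Set Space), 0 < m.c x
  cc : ∀ x ∈ closure (Ω : Set Space), ∀ M : Fin 3 → ℝ, M ≠ 0 →
    0 < ∑ i, ∑ j, m.cc x i j * M i * M j

/-- Coercivity of the stored energy: for some `c₀ > 0` and all `u, τ, R` in `W₀^{1,2}(Ω)`,
`∫ (A_{ijkl} e_{kl} e_{ij} + 2 B_{ijkl} e_{ij} R_{k,l} + K_{ij} τ_{,i} τ_{,j}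
  + C_{ijkl} R_{i,j} R_{k,l}) ≥ c₀ ∫ (e_{ij} e_{ij} + τ_{,i} τ_{,i} + R_{i,j} R_{i,j})`. -/
def CoerciveEnergy (m : Coefficients) (Ω : Opens Space) : Prop :=
  ∃ c₀ : ℝ, 0 < c₀ ∧ ∀ (u : Fin 3 → W120 Ω) (τ : W120 Ω) (R : Fin 3 → W120 Ω),
    c₀ * (∫ x in (Ω : Set Space),
        ((∑ i, ∑ j, strain u i j x * strain u i j x)
          + (∑ i, grad τ i x * grad τ i x)
          + ∑ i, ∑ j, grad (R i) j x * grad (R i) j x))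
      ≤ ∫ x in (Ω : Set Space),
        ((∑ i, ∑ j, ∑ k, ∑ l, m.A x i j k l * strain u k l x * strain u i j x)
          + 2 * (∑ i, ∑ j, ∑ k, ∑ l, m.B x i j k l * strain u i j x * grad (R k) l x)
          + (∑ i, ∑ j, m.K x i j * grad τ i x * grad τ j x)
          + ∑ i, ∑ j, ∑ k, ∑ l, m.C x i j k l * grad (R i) j x * grad (R k) l x)

/-- Positive definiteness of the dissipation form
`K̃_{ij} θ_{,i} θ_{,j} + C̃_{jikl} M_{k,l} M_{i,j}` as a quadratic form in the thermal gradients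
`g_i = θ_{,i}` and `G_{ij} = M_{i,j}`. -/
def PosDefDissipation (m : Coefficients) (Ω : Opens Space) : Prop :=
  ∀ x ∈ closure (Ω : Set Space), ∀ (g : Fin 3 → ℝ) (G : Fin 3 → Fin 3 → ℝ),
    (g ≠ 0 ∨ G ≠ 0) →
    0 < (∑ i, ∑ j, m.Kt x i j * g i * g j)
      + ∑ i, ∑ j, ∑ k, ∑ l, m.Ct x j i k l * G k l * G i j

end Coefficients

/-- The time derivative on `[0, ∞)` (one-sided at `0`). -/
def timeDeriv {X : Type} [NormedAddCommGroup X] [NormedSpace ℝ X] (f : ℝ → X) (t : ℝ) : X :=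
  derivWithin f (Ici 0) t

/-- The second time derivative, taken in `L²(Ω)`, of a curve in `W₀^{1,2}(Ω)`. -/
def accel {Ω : Opens Space} (f : ℝ → W120 Ω) (t : ℝ) : L2 Ω :=
  timeDeriv (fun s => toL2 (timeDeriv f s)) t

/-- `f ∈ C¹([0,∞), W₀^{1,2}(Ω)) ∩ C²([0,∞), L²(Ω))`. -/
def TimeRegular {Ω : Opens Space} (f : ℝ → W120 Ω) : Prop :=
  ContDiffOn ℝ 1 f (Ici 0) ∧ ContDiffOn ℝ 1 (fun t => toL2 (timeDeriv f t)) (Ici 0)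

/-- `(u_i, τ, R_i)` is a (strong) solution on `[0, ∞)` of the source-free type III system
* `ρ ü_i = (A_{jikl} e_{kl} - a_{ji} τ̇ + B_{jikl} R_{l,k})_{,j}`,
* `c τ̈ = -a_{ij} ė_{ij} + (-d_{ij} Ṙ_j + K_{ij} τ_{,j} + K̃_{ij} τ̇_{,j})_{,i} - b_{ij} Ṙ_{i,j}`,
* `c_{ij} R̈_j = (B_{klji} e_{kl} - b_{ji} τ̇ + C_{jikl} R_{k,l} + C̃_{jikl} Ṙ_{k,l})_{,j}
    - d_{ij} τ̇_{,j}`,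
with homogeneous Dirichlet conditions. The state `(u, u̇, τ, τ̇, R, Ṙ)` is a `C¹` curve in the
energy space `W₀^{1,2} × L² × W₀^{1,2} × L² × W₀^{1,2} × L²`, with velocities in `W₀^{1,2}`, and
the equations hold at every time `t ≥ 0`, the divergences being weak ones. -/
structure IsSolution (m : Coefficients) (Ω : Opens Space)
    (u : Fin 3 → ℝ → W120 Ω) (τ : ℝ → W120 Ω) (R : Fin 3 → ℝ → W120 Ω) : Prop where
  regular_u : ∀ i, TimeRegular (u i)
  regular_τ : TimeRegular τ
  regular_R : ∀ i, TimeRegular (R i)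
  motion : ∀ t, 0 ≤ t → ∀ (i : Fin 3) (φ : W120 Ω),
    ∫ x in (Ω : Set Space), m.ρ x * accel (u i) t x * toL2 φ x
      = - ∫ x in (Ω : Set Space), ∑ j,
          ((∑ k, ∑ l, m.A x j i k l * strain (fun r => u r t) k l x)
            - m.a x j i * toL2 (timeDeriv τ t) x
            + ∑ k, ∑ l, m.B x j i k l * grad (R l t) k x) * grad φ j x
  entropy : ∀ t, 0 ≤ t → ∀ φ : W120 Ω,
    ∫ x in (Ω : Set Space), m.c x * accel τ t x * toL2 φ x
      = - (∫ x in (Ω : Set Space),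
            (∑ i, ∑ j, m.a x i j * strain (fun r => timeDeriv (u r) t) i j x) * toL2 φ x)
        - (∫ x in (Ω : Set Space), ∑ i,
            (∑ j, (- m.d x i j * toL2 (timeDeriv (R j) t) x
              + m.K x i j * grad (τ t) j x
              + m.Kt x i j * grad (timeDeriv τ t) j x)) * grad φ i x)
        - ∫ x in (Ω : Set Space),
            (∑ i, ∑ j, m.b x i j * grad (timeDeriv (R i) t) j x) * toL2 φ x
  entropyMoment : ∀ t, 0 ≤ t → ∀ (i : Fin 3) (φ : W120 Ω),
    ∫ x in (Ω : Set Space), (∑ j, m.cc x i j * accel (R j) t x) * toL2 φ x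
      = - (∫ x in (Ω : Set Space), ∑ j,
            ((∑ k, ∑ l, m.B x k l j i * strain (fun r => u r t) k l x)
              - m.b x j i * toL2 (timeDeriv τ t) x
              + (∑ k, ∑ l, m.C x j i k l * grad (R k t) l x)
              + ∑ k, ∑ l, m.Ct x j i k l * grad (timeDeriv (R k) t) l x) * grad φ j x)
        - ∫ x in (Ω : Set Space),
            (∑ j, m.d x i j * grad (timeDeriv τ t) j x) * toL2 φ x

end

end TypeIII

/-! Suppose the solution is at rest from time T on. The argument studies the Laplace transforms of
its velocities over [0, T] and shows that they vanish identically.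

Complex analysis. The transform of a continuous real function on [0, T] is entire, of exponential
type, and bounded on the closed right half-plane. If it is also bounded far out on one ray z = s(-κ
+ i), κ > 0, then by conjugation it is bounded on the mirror ray as well. The two rays cut the left
half-plane into sectors of opening less than π, so Phragmén-Lindelöf bounds it everywhere. Liouville
makes it constant, decay along the integers makes the constant zero, and Stone-Weierstrass gives
back the function. This is `eq_zero_of_finiteLaplace_bounded_on_ray`.

Energy on the ray. Since the solution is at rest at T, integration by parts turns the evolution into
stationary equations at λ = s(-κ + i) whose only data are the initial values. Pair the mechanical
equation with the conjugate of the transformed velocity. Both λ and 1/λ have negative real part, so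
after a change of sign the identity controls s‖v‖² + ‖e(v)‖²/s. In the thermal equation the inertia
would then have the wrong sign, so the real part plus 2κ times the imaginary part is taken: the
inertia becomes κsN, and the dissipation D is perturbed only by 2κ times its antisymmetric part,
harmless for small κ. This controls s‖z‖² + ‖∇z‖².

Couplings. Because the mechanical identity was reversed, the thermoelastic terms add up instead of
cancelling. Integration by parts moves the derivative off the velocity and bounds them by ‖v‖(‖z‖ +
‖∇z‖). The terms in the transformed displacements gain a factor 1/s. Every coupling is thus smaller
than the controlled energy by s^{-1/2} and is absorbed for large s: `exists_resolvent_bound`.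

Conclusion. The velocities vanish in L² on [0, T]. An element of W₀^{1,2} is determined by its L²
value, so u, τ, R are constant in time there, hence zero. -/

section LaplaceTransform

/-! ### Laplace transforms over [0, T] and Phragmén-Lindelöf. -/

open Complex MeasureTheory Set Filter Topology

/-- The exponential carries a horizontal strip of height b - a to a sector. Exponential type becomes
growth exp(|T| e^{|Re w|}) in the strip, which Phragmén-Lindelöf tolerates because 1 < π/(b - a). -/
theorem norm_le_of_norm_le_on_rays {f : ℂ → ℂ} (hf : Differentiable ℂ f) {C C₀ T a b : ℝ}
    (hab : a < b) (hπ : b - a < Real.pi)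
    (hg : ∀ z, ‖f z‖ ≤ C₀ * Real.exp (T * ‖z‖))
    (ha : ∀ x : ℝ, ‖f (exp (x + a * I))‖ ≤ C) (hb : ∀ x : ℝ, ‖f (exp (x + b * I))‖ ≤ C)
    {z : ℂ} (hza : a ≤ z.im) (hzb : z.im ≤ b) : ‖f (exp z)‖ ≤ C := by
  have key : ∀ c : ℝ, (∀ x : ℝ, ‖f (exp (x + c * I))‖ ≤ C) →
      ∀ w : ℂ, w.im = c → ‖f (exp w)‖ ≤ C := by
    intro c hc w hw
    have := hc w.re
    rwa [← hw, re_add_im] at this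
  refine PhragmenLindelof.horizontal_strip (f := fun z => f (exp z)) (a := a) (b := b) (C := C)
    ?_ ?_ (key a ha) (key b hb) hza hzb
  · exact (hf.comp differentiable_exp).diffContOnCl
  · refine ⟨1, by rw [lt_div_iff₀ (by linarith)]; linarith, |T|, ?_⟩
    refine Asymptotics.IsBigO.of_bound |C₀| (Eventually.of_forall fun w => ?_)
    rw [Real.norm_of_nonneg (Real.exp_nonneg _), one_mul]
    refine (hg _).trans ?_
    have h1 : T * ‖exp w‖ ≤ |T| * Real.exp |w.re| := by
      rw [norm_exp]
      exact mul_le_mul (le_abs_self _) (Real.exp_le_exp.2 (le_abs_self _)) (Real.exp_nonneg _)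
        (abs_nonneg _)
    exact mul_le_mul (le_abs_self _) (Real.exp_le_exp.2 h1) (Real.exp_nonneg _) (abs_nonneg _)

/-- The Laplace transform of `g` over `[0, T]`. -/
noncomputable def finiteLaplace (g : ℝ → ℝ) (T : ℝ) (z : ℂ) : ℂ :=
  ∫ t in (0 : ℝ)..T, exp (-z * t) * g t

variable {g : ℝ → ℝ} {T : ℝ}

theorem intervalIntegrable_cexp_mul (hT : 0 ≤ T) (hg : ContinuousOn g (Icc 0 T)) (z : ℂ) :
    IntervalIntegrable (fun t : ℝ => exp (-z * t) * g t) volume 0 T := by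
  apply ContinuousOn.intervalIntegrable
  rw [uIcc_of_le hT]
  exact (Continuous.continuousOn (by fun_prop)).mul (continuous_ofReal.comp_continuousOn hg)

theorem differentiable_finiteLaplace (hT : 0 ≤ T) (hg : ContinuousOn g (Icc 0 T)) :
    Differentiable ℂ (finiteLaplace g T) := by
  intro z
  have hgi : IntervalIntegrable g volume 0 T :=
    ContinuousOn.intervalIntegrable (by rwa [uIcc_of_le hT])
  have hc : ∀ w : ℂ, ContinuousOn (fun t : ℝ => -t * exp (-w * t) * (g t : ℂ)) (uIcc 0 T) := by
    intro w
    rw [uIcc_of_le hT]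
    exact (Continuous.continuousOn (by fun_prop)).mul (continuous_ofReal.comp_continuousOn hg)
  refine (intervalIntegral.hasDerivAt_integral_of_dominated_loc_of_deriv_le
    (F := fun (w : ℂ) (t : ℝ) => exp (-w * t) * (g t : ℂ))
    (F' := fun (w : ℂ) (t : ℝ) => -t * exp (-w * t) * (g t : ℂ))
    (bound := fun t => T * Real.exp ((‖z‖ + 1) * T) * |g t|)
    (Metric.ball_mem_nhds z one_pos) ?_ ?_ ?_ ?_ ?_ ?_).2.differentiableAt
  · refine Eventually.of_forall fun w => ?_
    have := (intervalIntegrable_cexp_mul hT hg w).aestronglyMeasurable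
    rwa [uIoc_of_le hT]
  · exact intervalIntegrable_cexp_mul hT hg z
  · have := ((hc z).intervalIntegrable (μ := volume)).aestronglyMeasurable
    rwa [uIoc_of_le hT]
  · refine Eventually.of_forall fun t ht w hw => ?_
    rw [uIoc_of_le hT] at ht
    have hw' : ‖w‖ ≤ ‖z‖ + 1 := by
      have h1 : ‖w - z‖ < 1 := by simpa [dist_eq_norm] using hw
      have h2 := norm_add_le (w - z) z
      rw [sub_add_cancel] at h2
      linarith
    rw [norm_mul, norm_mul, norm_neg, norm_real, norm_real, Real.norm_eq_abs, Real.norm_eq_abs,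
      abs_of_pos ht.1, norm_exp]
    refine mul_le_mul_of_nonneg_right ?_ (abs_nonneg _)
    refine mul_le_mul ht.2 (Real.exp_le_exp.2 ?_) (Real.exp_nonneg _) hT
    have h3 : (-w * (t : ℂ)).re ≤ ‖w‖ * t := by
      refine (re_le_norm _).trans ?_
      rw [norm_mul, norm_neg, norm_real, Real.norm_of_nonneg ht.1.le]
    exact h3.trans (mul_le_mul hw' ht.2 ht.1.le (by positivity))
  · exact hgi.abs.const_mul _
  · refine Eventually.of_forall fun t _ w _ => ?_
    have h1 : HasDerivAt (fun w : ℂ => -w * (t : ℂ)) (-t) w := by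
      simpa using (hasDerivAt_id w).neg.mul_const (t : ℂ)
    have h2 := h1.cexp.mul_const (g t : ℂ)
    rwa [mul_comm (exp _)] at h2

theorem norm_finiteLaplace_le (hT : 0 ≤ T) (hg : ContinuousOn g (Icc 0 T)) (z : ℂ) :
    ‖finiteLaplace g T z‖ ≤ (∫ t in (0 : ℝ)..T, |g t|) * Real.exp (T * ‖z‖) := by
  have hgi : IntervalIntegrable g volume 0 T :=
    ContinuousOn.intervalIntegrable (by rwa [uIcc_of_le hT])
  rw [← intervalIntegral.integral_mul_const]
  refine intervalIntegral.norm_integral_le_of_norm_le hT (ae_of_all _ fun t ht => ?_)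
    (hgi.abs.mul_const _)
  rw [norm_mul, norm_real, Real.norm_eq_abs, norm_exp, mul_comm]
  refine mul_le_mul_of_nonneg_left (Real.exp_le_exp.2 ((re_le_norm _).trans ?_)) (abs_nonneg _)
  rw [norm_mul, norm_neg, norm_real, Real.norm_of_nonneg ht.1.le, mul_comm]
  exact mul_le_mul_of_nonneg_right ht.2 (norm_nonneg _)

theorem norm_finiteLaplace_le_of_re_nonneg (hT : 0 ≤ T) (hg : ContinuousOn g (Icc 0 T)) {z : ℂ}
    (hz : 0 ≤ z.re) : ‖finiteLaplace g T z‖ ≤ ∫ t in (0 : ℝ)..T, |g t| := by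
  have hgi : IntervalIntegrable g volume 0 T :=
    ContinuousOn.intervalIntegrable (by rwa [uIcc_of_le hT])
  refine intervalIntegral.norm_integral_le_of_norm_le hT (ae_of_all _ fun t ht => ?_) hgi.abs
  rw [norm_mul, norm_real, Real.norm_eq_abs, norm_exp]
  refine mul_le_of_le_one_left (abs_nonneg _) (Real.exp_le_one_iff.2 ?_)
  simp only [neg_mul, neg_re, re_mul_ofReal]
  nlinarith [ht.1]

theorem finiteLaplace_conj (hT : 0 ≤ T) (hg : ContinuousOn g (Icc 0 T)) (z : ℂ) :
    finiteLaplace g T (starRingEnd ℂ z) = starRingEnd ℂ (finiteLaplace g T z) := by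
  unfold finiteLaplace
  refine Eq.trans ?_ ((Complex.conjCLE : ℂ →L[ℝ] ℂ).intervalIntegral_comp_comm (μ := volume)
    (intervalIntegrable_cexp_mul hT hg z))
  congr 1
  ext t
  simp [← exp_conj]

theorem finiteLaplace_ofReal (x : ℝ) :
    finiteLaplace g T x = ((∫ t in (0 : ℝ)..T, Real.exp (-x * t) * g t : ℝ) : ℂ) := by
  rw [finiteLaplace, ← intervalIntegral.integral_ofReal]
  congr 1
  ext t
  push_cast
  rfl

/-- Serves to identify the constant that Liouville's theorem produces. -/
theorem tendsto_finiteLaplace_nat (hT : 0 ≤ T) (hg : ContinuousOn g (Icc 0 T)) :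
    Tendsto (fun n : ℕ => finiteLaplace g T (n : ℂ)) atTop (𝓝 0) := by
  have hgi : IntervalIntegrable g volume 0 T :=
    ContinuousOn.intervalIntegrable (by rwa [uIcc_of_le hT])
  have h0 : (∫ t in (0 : ℝ)..T, (0 : ℂ)) = 0 := by simp
  rw [← h0]
  refine intervalIntegral.tendsto_integral_filter_of_dominated_convergence (fun t => |g t|)
    ?_ ?_ hgi.abs ?_
  · refine Eventually.of_forall fun n => ?_
    have := (intervalIntegrable_cexp_mul hT hg n).aestronglyMeasurable
    rwa [uIoc_of_le hT]
  · refine Eventually.of_forall fun n => ae_of_all _ fun t ht => ?_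
    rw [uIoc_of_le hT] at ht
    rw [norm_mul, norm_real, Real.norm_eq_abs, norm_exp]
    refine mul_le_of_le_one_left (abs_nonneg _) (Real.exp_le_one_iff.2 ?_)
    simp only [neg_mul, neg_re, re_mul_ofReal, natCast_re]
    have : 0 ≤ (n : ℝ) * t := mul_nonneg n.cast_nonneg ht.1.le
    linarith
  · refine ae_of_all _ fun t ht => ?_
    rw [uIoc_of_le hT] at ht
    have h1 : Tendsto (fun n : ℕ => exp (-(n : ℂ) * t)) atTop (𝓝 0) := by
      rw [tendsto_zero_iff_norm_tendsto_zero]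
      have h2 : ∀ n : ℕ, ‖exp (-(n : ℂ) * t)‖ = Real.exp (-((n : ℝ) * t)) := by
        intro n
        rw [norm_exp]
        simp
      simp only [h2]
      exact Real.tendsto_exp_neg_atTop_nhds_zero.comp
        (tendsto_natCast_atTop_atTop.atTop_mul_const ht.1)
    simpa using h1.mul_const (g t : ℂ)

/-- A continuous function on `[0, T]` that is orthogonal to `e^{-nt}` for all `n` vanishes. -/
theorem eq_zero_of_integral_exp_neg_nat_mul (hT : 0 < T) (hg : ContinuousOn g (Icc 0 T))
    (h : ∀ n : ℕ, ∫ t in (0 : ℝ)..T, Real.exp (-(n : ℝ) * t) * g t = 0) :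
    ∀ t ∈ Icc 0 T, g t = 0 := by
  -- A single injective function separates points, so polynomials in e^{-t} are dense; integration
  -- against g kills all its powers, the power 0 included.
  let e : C(Icc (0 : ℝ) T, ℝ) := ⟨fun t => Real.exp (-t), by fun_prop⟩
  let A : Subalgebra ℝ C(Icc (0 : ℝ) T, ℝ) := Algebra.adjoin ℝ {e}
  have hA : A.topologicalClosure = ⊤ := by
    refine ContinuousMap.subalgebra_topologicalClosure_eq_top_of_separatesPoints A ?_
    intro x y hxy
    refine ⟨e, ⟨e, Algebra.self_mem_adjoin_singleton ℝ e, rfl⟩, fun hh => hxy ?_⟩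
    have : Real.exp (-(x : ℝ)) = Real.exp (-(y : ℝ)) := hh
    exact Subtype.ext (neg_injective (Real.exp_injective this))
  have hproj : ∀ f : C(Icc (0 : ℝ) T, ℝ),
      IntervalIntegrable (fun t => IccExtend hT.le f t * g t) volume 0 T := by
    intro f
    apply ContinuousOn.intervalIntegrable
    rw [uIcc_of_le hT.le]
    exact (f.continuous.Icc_extend').continuousOn.mul hg
  let Φ : C(Icc (0 : ℝ) T, ℝ) → ℝ := fun f => ∫ t in (0 : ℝ)..T, IccExtend hT.le f t * g t
  have hΦadd : ∀ f₁ f₂, Φ (f₁ + f₂) = Φ f₁ + Φ f₂ := by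
    intro f₁ f₂
    simp only [Φ]
    rw [← intervalIntegral.integral_add (hproj _) (hproj _)]
    congr 1
    ext t
    simp [IccExtend, add_mul]
  have hΦsmul : ∀ (c : ℝ) f, Φ (c • f) = c * Φ f := by
    intro c f
    simp only [Φ]
    rw [← intervalIntegral.integral_const_mul]
    congr 1
    ext t
    simp [IccExtend, mul_assoc]
  have hgi : IntervalIntegrable g volume 0 T :=
    ContinuousOn.intervalIntegrable (by rwa [uIcc_of_le hT.le])
  have hΦb : ∀ f, ‖Φ f‖ ≤ (∫ t in (0 : ℝ)..T, |g t|) * ‖f‖ := by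
    intro f
    rw [← intervalIntegral.integral_mul_const]
    refine intervalIntegral.norm_integral_le_of_norm_le hT.le (ae_of_all _ fun t _ => ?_)
      (hgi.abs.mul_const _)
    rw [norm_mul, mul_comm, Real.norm_eq_abs (g t)]
    exact mul_le_mul_of_nonneg_left (f.norm_coe_le_norm _) (abs_nonneg _)
  let L : C(Icc (0 : ℝ) T, ℝ) →L[ℝ] ℝ :=
    LinearMap.mkContinuous ⟨⟨Φ, hΦadd⟩, by simpa using hΦsmul⟩ _ hΦb
  have hpow : ∀ n : ℕ, L (e ^ n) = 0 := by
    intro n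
    change Φ (e ^ n) = 0
    refine Eq.trans ?_ (h n)
    refine intervalIntegral.integral_congr fun t ht => ?_
    rw [uIcc_of_le hT.le] at ht
    simp only [IccExtend_of_mem hT.le _ ht]
    simp only [ContinuousMap.coe_pow, Pi.pow_apply, e, ContinuousMap.coe_mk]
    rw [← Real.exp_nat_mul]
    ring_nf
  have hAL : ∀ f ∈ A, L f = 0 := by
    intro f hf
    obtain ⟨p, rfl⟩ := (Algebra.adjoin_mem_exists_aeval ℝ e hf)
    rw [Polynomial.aeval_eq_sum_range, map_sum]
    exact Finset.sum_eq_zero fun n _ => by rw [map_smul, hpow, smul_zero]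
  have hL : ∀ f, L f = 0 := by
    have hcl : closure (A : Set C(Icc (0 : ℝ) T, ℝ)) ⊆ {f | L f = 0} :=
      closure_minimal hAL (isClosed_eq L.continuous continuous_const)
    intro f
    apply hcl
    rw [← Subalgebra.topologicalClosure_coe, hA]
    trivial
  have hsq : ∫ t in (0 : ℝ)..T, g t * g t = 0 := by
    refine Eq.trans ?_ (hL ⟨(Icc (0 : ℝ) T).domRestrict g, hg.domRestrict⟩)
    refine intervalIntegral.integral_congr fun t ht => ?_
    rw [uIcc_of_le hT.le] at ht
    simp only [ContinuousMap.coe_mk]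
    rw [IccExtend_of_mem hT.le _ ht]
    rfl
  by_contra! hne
  obtain ⟨t, ht, hgt⟩ := hne
  have hpos := intervalIntegral.integral_pos hT (hg.mul hg)
    (fun s _ => mul_self_nonneg (g s)) ⟨t, ht, mul_self_pos.2 hgt⟩
  exact hpos.ne' hsq

/-- If the Laplace transform of a continuous function on `[0, T]` is bounded far out on a ray
in the left half-plane off the real axis, the function vanishes. -/
theorem eq_zero_of_finiteLaplace_bounded_on_ray (hT : 0 < T) (hg : ContinuousOn g (Icc 0 T))
    {k C s₀ : ℝ} (hk : 0 < k)
    (h : ∀ s : ℝ, s₀ ≤ s → ‖finiteLaplace g T (s * (-k + I))‖ ≤ C) :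
    ∀ t ∈ Icc 0 T, g t = 0 := by
  set f := finiteLaplace g T with hf
  have hd : Differentiable ℂ f := differentiable_finiteLaplace hT.le hg
  set M := ∫ t in (0 : ℝ)..T, |g t| with hM
  set w : ℂ := -k + I with hw
  have hM0 : 0 ≤ M := intervalIntegral.integral_nonneg hT.le fun _ _ => abs_nonneg _
  have hw0 : w ≠ 0 := by
    intro h0
    have := congrArg im h0
    simp [hw] at this
  set γ := arg w with hγ
  have hγ1 : Real.pi / 2 < γ := by
    by_contra hcon
    have h1 : |γ| ≤ Real.pi / 2 := by
      rw [abs_of_nonneg]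
      · linarith
      · rw [hγ, arg_nonneg_iff]; simp [hw]
    rw [hγ, abs_arg_le_pi_div_two_iff] at h1
    simp [hw] at h1
    linarith
  have hγ2 : γ < Real.pi := by
    refine lt_of_le_of_ne (arg_le_pi _) fun h0 => ?_
    rw [arg_eq_pi_iff] at h0
    simp [hw] at h0
  -- The three entries serve the ray beyond s₀, the closed right half-plane, and the initial piece
  -- of the ray, where only the exponential type is available.
  set D := max C (max M (M * Real.exp (T * (|s₀| * ‖w‖)))) with hD
  have hray : ∀ s : ℝ, 0 ≤ s → ‖f (s * w)‖ ≤ D := by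
    intro s hs
    by_cases hs₀ : s₀ ≤ s
    · exact (h s hs₀).trans (le_max_left _ _)
    · refine le_trans ?_ ((le_max_right _ _).trans (le_max_right _ _))
      refine (norm_finiteLaplace_le hT.le hg _).trans ?_
      gcongr
      rw [norm_mul, norm_real, Real.norm_of_nonneg hs]
      gcongr
      exact (not_le.1 hs₀).le.trans (le_abs_self _)
  have hre : ∀ z : ℂ, 0 ≤ z.re → ‖f z‖ ≤ D := fun z hz =>
    (norm_finiteLaplace_le_of_re_nonneg hT.le hg hz).trans
      ((le_max_left _ _).trans (le_max_right _ _))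
  have hconj : ∀ z : ℂ, ‖f (starRingEnd ℂ z)‖ = ‖f z‖ := by
    intro z
    rw [hf, finiteLaplace_conj hT.le hg, norm_conj]
  have hrayexp : ∀ x : ℝ, ‖f (exp (x + γ * I))‖ ≤ D := by
    intro x
    have h1 : exp (x + γ * I) = ((Real.exp x / ‖w‖ : ℝ) : ℂ) * w := by
      rw [exp_add]
      have h2 : (‖w‖ : ℂ) ≠ 0 := by simpa using hw0
      have h3 : w = ‖w‖ * exp (γ * I) := (norm_mul_exp_arg_mul_I w).symm
      push_cast
      rw [div_mul_eq_mul_div, eq_div_iff h2, mul_assoc, mul_comm (exp _) (‖w‖ : ℂ), ← h3]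
    rw [h1]
    exact hray _ (by positivity)
  have hgrow : ∀ z, ‖f z‖ ≤ M * Real.exp (T * ‖z‖) := norm_finiteLaplace_le hT.le hg
  have hupper : ∀ z : ℂ, 0 ≤ z.im → ‖f z‖ ≤ D := by
    intro z hz
    by_cases hz0 : 0 ≤ z.re
    · exact hre z hz0
    have hzne : z ≠ 0 := fun h0 => hz0 (by simp [h0])
    rw [← exp_log hzne]
    have hlog : (log z).im = arg z := log_im z
    have hz1 : Real.pi / 2 < arg z := by
      by_contra hcon
      have h1 : |arg z| ≤ Real.pi / 2 := by
        rw [abs_of_nonneg (arg_nonneg_iff.2 hz)]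
        linarith
      rw [abs_arg_le_pi_div_two_iff] at h1
      exact hz0 h1
    by_cases hzγ : arg z ≤ γ
    · refine norm_le_of_norm_le_on_rays hd (a := Real.pi / 2) (b := γ) hγ1 (by linarith) hgrow
        (fun x => ?_) hrayexp (by rw [hlog]; exact hz1.le) (by rwa [hlog])
      apply hre
      rw [exp_re]
      simp
    -- The sector around the negative real axis, between the ray and its mirror image: its opening
    -- 2π - 2γ is below π because γ > π/2.
    · refine norm_le_of_norm_le_on_rays hd (a := γ) (b := 2 * Real.pi - γ) (by linarith)
        (by linarith) hgrow hrayexp (fun x => ?_) (by rw [hlog]; exact (not_le.1 hzγ).le)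
        (by rw [hlog]; linarith [arg_le_pi z])
      have h1 : exp (x + ((2 * Real.pi - γ : ℝ) : ℂ) * I)
          = starRingEnd ℂ (exp (x + γ * I)) := by
        rw [← exp_conj]
        have h2 : (x : ℂ) + ((2 * Real.pi - γ : ℝ) : ℂ) * I
            = (starRingEnd ℂ) (x + γ * I) + 2 * Real.pi * I := by
          simp only [map_add, map_mul, conj_ofReal, conj_I]
          push_cast
          ring
        rw [h2, exp_add, exp_two_pi_mul_I, mul_one]
      rw [h1, hconj]
      exact hrayexp x
  have hall : ∀ z : ℂ, ‖f z‖ ≤ D := by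
    intro z
    rcases le_total 0 z.im with hz | hz
    · exact hupper z hz
    · rw [← hconj]
      exact hupper _ (by simpa using hz)
  have hconst : ∀ z w : ℂ, f z = f w := hd.apply_eq_apply_of_bounded
    (isBounded_iff_forall_norm_le.2 ⟨D, by rintro _ ⟨z, rfl⟩; exact hall z⟩)
  have hzero : ∀ z, f z = 0 := by
    intro z
    have h1 : Tendsto (fun n : ℕ => f (n : ℂ)) atTop (𝓝 (f z)) := by
      simp only [hconst _ z]
      exact tendsto_const_nhds
    exact tendsto_nhds_unique h1 (tendsto_finiteLaplace_nat hT.le hg)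
  refine eq_zero_of_integral_exp_neg_nat_mul hT hg fun n => ?_
  have h1 := finiteLaplace_ofReal (g := g) (T := T) n
  rw [← hf, hzero] at h1
  exact_mod_cast h1.symm

end LaplaceTransform

/-! ### The abstract damped system: absorption and energy identities. -/

section AbstractSystem

open MeasureTheory Set Filter Topology

/-- Absorption of the coupling terms in the resolvent estimate for large frequency `s`. -/
theorem exists_forall_le_one_of_absorb {c C : ℝ} (hc : 0 < c) (hC : 0 ≤ C) :
    ∃ s₀ : ℝ, 1 ≤ s₀ ∧ ∀ s, s₀ ≤ s → ∀ x y p g : ℝ, 0 ≤ x → 0 ≤ y → 0 ≤ p → 0 ≤ g →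
      c * (s * x ^ 2 + y ^ 2 / s + s * p ^ 2 + g ^ 2) ≤
        C * (x + y / s + p + g / s + x * p + x * g + y * g / s + g ^ 2 / s + p * g) →
      x ≤ 1 ∧ p ≤ 1 := by
  -- Twice the factor 9 of `e3`, plus one: then c q F ≤ 9 C (F + 1) forces F ≤ 1.
  obtain ⟨M, hM1, hM⟩ : ∃ M : ℝ, 1 ≤ M ∧ 18 * C + 1 ≤ c * M :=
    ⟨max 1 ((18 * C + 1) / c), le_max_left _ _, by
      have := le_max_right 1 ((18 * C + 1) / c)
      rw [div_le_iff₀ hc] at this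
      linarith⟩
  refine ⟨M ^ 2, by nlinarith, fun s hs x y p g hx hy hp hg h => ?_⟩
  -- In the variables √s x, y/√s, √s p, g the left side is c times a plain sum of squares F, and
  -- every term on the right carries at least one factor 1/√s.
  obtain ⟨q, hq, rfl⟩ : ∃ q : ℝ, M ≤ q ∧ q ^ 2 = s :=
    ⟨√s, Real.le_sqrt_of_sq_le hs, Real.sq_sqrt (by nlinarith)⟩
  have hq1 : 1 ≤ q := hM1.trans hq
  have hq0 : 0 < q := by linarith
  obtain ⟨b, rfl⟩ : ∃ b, y = q * b := ⟨y / q, by field_simp⟩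
  have hb : 0 ≤ b := by
    by_contra hb
    nlinarith
  set a := q * x with ha
  set d := q * p with hd
  have ha0 : 0 ≤ a := by positivity
  have hd0 : 0 ≤ d := by positivity
  set F := a ^ 2 + b ^ 2 + d ^ 2 + g ^ 2 with hF
  have e1 : q ^ 2 * x ^ 2 + (q * b) ^ 2 / q ^ 2 + q ^ 2 * p ^ 2 + g ^ 2 = F := by
    rw [hF, ha, hd]
    field_simp
  rw [e1] at h
  have e2 : q * (x + q * b / q ^ 2 + p + g / q ^ 2 + x * p + x * g + q * b * g / q ^ 2
      + g ^ 2 / q ^ 2 + p * g)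
      = a + b + d + g / q + a * d / q + a * g + b * g + g ^ 2 / q + d * g := by
    rw [ha, hd]
    field_simp
  have l1 : g / q ≤ g := div_le_self hg hq1
  have l2 : a * d / q ≤ a * d := div_le_self (by positivity) hq1
  have l3 : g ^ 2 / q ≤ g ^ 2 := div_le_self (by positivity) hq1
  have e3 : a + b + d + g / q + a * d / q + a * g + b * g + g ^ 2 / q + d * g
      ≤ 9 * (F + 1) := by
    have m : ∀ u v : ℝ, 2 * (u * v) ≤ u ^ 2 + v ^ 2 := fun u v => by
      linarith [two_mul_le_add_sq u v]
    have m1 := m a 1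
    have m2 := m b 1
    have m3 := m d 1
    have m4 := m g 1
    have m5 := m a d
    have m6 := m a g
    have m7 := m b g
    have m8 := m d g
    have p1 := sq_nonneg a
    have p2 := sq_nonneg b
    have p3 := sq_nonneg d
    have p4 := sq_nonneg g
    rw [hF]
    linarith
  have hF0 : 0 ≤ F := by positivity
  clear_value a d F
  have h1 : c * q * F ≤ C * (9 * (F + 1)) := by
    have e4 := mul_le_mul_of_nonneg_left (e2.le.trans e3) hC
    have e5 := mul_le_mul_of_nonneg_left h hq0.le
    calc c * q * F = q * (c * F) := by ring
      _ ≤ _ := e5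
      _ = _ := by ring
      _ ≤ _ := e4
  have h2 : (18 * C + 1) * F ≤ c * q * F :=
    mul_le_mul_of_nonneg_right (hM.trans (mul_le_mul_of_nonneg_left hq hc.le)) hF0
  have hF1 : F ≤ 1 := by
    by_contra! hcon
    have h3 : 0 ≤ C * (F - 1) := mul_nonneg hC (by linarith)
    linarith
  have hxa : x ≤ a := ha ▸ le_mul_of_one_le_left hx hq1
  have hpd : p ≤ d := hd ▸ le_mul_of_one_le_left hp hq1
  have ha2 : a ^ 2 ≤ 1 ^ 2 := by
    linarith [sq_nonneg b, sq_nonneg d, sq_nonneg g]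
  have hd2 : d ^ 2 ≤ 1 ^ 2 := by
    linarith [sq_nonneg b, sq_nonneg a, sq_nonneg g]
  exact ⟨hxa.trans (abs_le_of_sq_le_sq' ha2 one_pos.le).2, hpd.trans (abs_le_of_sq_le_sq' hd2 one_pos.le).2⟩

variable {U Z H₀ H₁ K₀ K₁ : Type*}
  [NormedAddCommGroup U] [NormedSpace ℝ U] [NormedAddCommGroup Z] [NormedSpace ℝ Z]
  [NormedAddCommGroup H₀] [NormedSpace ℝ H₀] [NormedAddCommGroup H₁] [NormedSpace ℝ H₁]
  [NormedAddCommGroup K₀] [NormedSpace ℝ K₀] [NormedAddCommGroup K₁] [NormedSpace ℝ K₁]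

theorem abs_apply_apply_le {E F : Type*} [NormedAddCommGroup E] [NormedSpace ℝ E]
    [NormedAddCommGroup F] [NormedSpace ℝ F] {f : E →L[ℝ] F →L[ℝ] ℝ} {M : ℝ} (hM : ‖f‖ ≤ M)
    {x : E} {y : F} {a b : ℝ} (hx : ‖x‖ ≤ a) (hy : ‖y‖ ≤ b) : |f x y| ≤ M * (a * b) := by
  refine (f.le_opNorm₂ x y).trans ?_
  rw [← mul_assoc]
  have h0 := norm_nonneg f
  have h1 := norm_nonneg x
  have h2 := norm_nonneg y
  have h3 : 0 ≤ a := h1.trans hx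
  exact mul_le_mul (mul_le_mul hM hx h1 (h0.trans hM)) hy h2 (mul_nonneg (h0.trans hM) h3)

/-- Forms of a linear system in which an undamped second-order component, with displacements in
`U`, is coupled to a strongly damped second-order component, with displacements in `Z`. The maps
`T₀`, `P₀` give the values and `T₁`, `P₁` the strains of the two components. -/
structure DampedSystem (U Z H₀ H₁ K₀ K₁ : Type*)
    [NormedAddCommGroup U] [NormedSpace ℝ U] [NormedAddCommGroup Z] [NormedSpace ℝ Z]
    [NormedAddCommGroup H₀] [NormedSpace ℝ H₀] [NormedAddCommGroup H₁] [NormedSpace ℝ H₁]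
    [NormedAddCommGroup K₀] [NormedSpace ℝ K₀] [NormedAddCommGroup K₁] [NormedSpace ℝ K₁] where
  T₀ : U →L[ℝ] H₀
  T₁ : U →L[ℝ] H₁
  P₀ : Z →L[ℝ] K₀
  P₁ : Z →L[ℝ] K₁
  /-- inertia of the undamped component -/
  ρ : H₀ →L[ℝ] H₀ →L[ℝ] ℝ
  /-- stiffness of the undamped component -/
  A : H₁ →L[ℝ] H₁ →L[ℝ] ℝ
  /-- inertia of the damped component -/
  N : K₀ →L[ℝ] K₀ →L[ℝ] ℝ
  /-- damping -/
  D : K₁ →L[ℝ] K₁ →L[ℝ] ℝ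
  /-- stiffness of the damped component -/
  S : K₁ →L[ℝ] K₁ →L[ℝ] ℝ
  -- Thermoelastic coupling, entering the two equations with opposite signs. `J₁` and `J₂` act
  -- inside the damped component; `B₁` and `B₂` couple its strains with those of the undamped one.
  Q : Z →L[ℝ] U →L[ℝ] ℝ
  J₁ : K₀ →L[ℝ] K₁ →L[ℝ] ℝ
  J₂ : K₁ →L[ℝ] K₀ →L[ℝ] ℝ
  B₁ : K₁ →L[ℝ] H₁ →L[ℝ] ℝ
  B₂ : H₁ →L[ℝ] K₁ →L[ℝ] ℝ
  ρ_symm : ∀ v w, ρ v w = ρ w v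
  A_symm : ∀ v w, A v w = A w v
  N_symm : ∀ v w, N v w = N w v
  ρ_coercive : IsCoercive ρ
  N_coercive : IsCoercive N
  D_coercive : IsCoercive D
  -- Required on the range of `T₁` only, since in the application it comes from an integral
  -- inequality for displacement fields, not from a pointwise one.
  A_coercive : ∃ c, 0 < c ∧ ∀ v : U, c * ‖T₁ v‖ * ‖T₁ v‖ ≤ A (T₁ v) (T₁ v)
  -- The strain `T₁ v` must not appear: its square is controlled only with weight 1/s, so a bound by
  -- ‖T₁ v‖ ‖P₀ z‖ would gain no power of s over the energies.
  Q_bound : ∃ C, ∀ z v, |Q z v| ≤ C * (‖T₀ v‖ * (‖P₀ z‖ + ‖P₁ z‖))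

namespace DampedSystem

variable (𝒮 : DampedSystem U Z H₀ H₁ K₀ K₁)

/-- The force of the system in the state `(u, y, z)` acting on a virtual displacement of the
undamped component. -/
noncomputable def force : U × Z × Z →L[ℝ] U →L[ℝ] ℝ :=
  -𝒮.A.bilinearComp (𝒮.T₁ ∘L .fst ℝ U (Z × Z)) 𝒮.T₁
    + 𝒮.Q ∘L .snd ℝ Z Z ∘L .snd ℝ U (Z × Z)
    - 𝒮.B₁.bilinearComp (𝒮.P₁ ∘L .fst ℝ Z Z ∘L .snd ℝ U (Z × Z)) 𝒮.T₁

/-- The force of the system in the state `(u, v, y, z)` acting on a virtual displacement of the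
damped component. -/
noncomputable def flux : U × U × Z × Z →L[ℝ] Z →L[ℝ] ℝ :=
  -𝒮.D.bilinearComp (𝒮.P₁ ∘L .snd ℝ Z Z ∘L .snd ℝ U (Z × Z) ∘L .snd ℝ U (U × Z × Z)) 𝒮.P₁
    - 𝒮.S.bilinearComp (𝒮.P₁ ∘L .fst ℝ Z Z ∘L .snd ℝ U (Z × Z) ∘L .snd ℝ U (U × Z × Z)) 𝒮.P₁
    - 𝒮.Q.flip ∘L .fst ℝ U (Z × Z) ∘L .snd ℝ U (U × Z × Z)
    - 𝒮.J₁.bilinearComp (𝒮.P₀ ∘L .snd ℝ Z Z ∘L .snd ℝ U (Z × Z) ∘L .snd ℝ U (U × Z × Z)) 𝒮.P₁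
    - 𝒮.J₂.bilinearComp (𝒮.P₁ ∘L .snd ℝ Z Z ∘L .snd ℝ U (Z × Z) ∘L .snd ℝ U (U × Z × Z)) 𝒮.P₀
    - 𝒮.B₂.bilinearComp (𝒮.T₁ ∘L .fst ℝ U (U × Z × Z)) 𝒮.P₁

theorem force_apply (u : U) (y z : Z) (w : U) : 𝒮.force (u, y, z) w =
    -𝒮.A (𝒮.T₁ u) (𝒮.T₁ w) + 𝒮.Q z w - 𝒮.B₁ (𝒮.P₁ y) (𝒮.T₁ w) := rfl

theorem flux_apply (u v : U) (y z ζ : Z) : 𝒮.flux (u, v, y, z) ζ =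
    -𝒮.D (𝒮.P₁ z) (𝒮.P₁ ζ) - 𝒮.S (𝒮.P₁ y) (𝒮.P₁ ζ) - 𝒮.Q ζ v
    - 𝒮.J₁ (𝒮.P₀ z) (𝒮.P₁ ζ) - 𝒮.J₂ (𝒮.P₁ z) (𝒮.P₀ ζ) - 𝒮.B₂ (𝒮.T₁ u) (𝒮.P₁ ζ) := rfl

/-- The real and imaginary parts of the Laplace transform, at `s (-κ + i)`, of a solution with
initial data `u₀, v₀, y₀, z₀`. -/
structure Resolvent (κ s : ℝ) (u₀ v₀ u₁ u₂ v₁ v₂ : U) (y₀ z₀ y₁ y₂ z₁ z₂ : Z) : Prop where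
  velocity_v₁ : v₁ = -u₀ + (-κ * s) • u₁ - s • u₂
  velocity_v₂ : v₂ = (-κ * s) • u₂ + s • u₁
  velocity_z₁ : z₁ = -y₀ + (-κ * s) • y₁ - s • y₂
  velocity_z₂ : z₂ = (-κ * s) • y₂ + s • y₁
  force₁ : ∀ w, 𝒮.force (u₁, y₁, z₁) w = -𝒮.ρ (𝒮.T₀ v₀) (𝒮.T₀ w)
    + (-κ * s) * 𝒮.ρ (𝒮.T₀ v₁) (𝒮.T₀ w) - s * 𝒮.ρ (𝒮.T₀ v₂) (𝒮.T₀ w)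
  force₂ : ∀ w, 𝒮.force (u₂, y₂, z₂) w =
    (-κ * s) * 𝒮.ρ (𝒮.T₀ v₂) (𝒮.T₀ w) + s * 𝒮.ρ (𝒮.T₀ v₁) (𝒮.T₀ w)
  flux₁ : ∀ w, 𝒮.flux (u₁, v₁, y₁, z₁) w = -𝒮.N (𝒮.P₀ z₀) (𝒮.P₀ w)
    + (-κ * s) * 𝒮.N (𝒮.P₀ z₁) (𝒮.P₀ w) - s * 𝒮.N (𝒮.P₀ z₂) (𝒮.P₀ w)
  flux₂ : ∀ w, 𝒮.flux (u₂, v₂, y₂, z₂) w =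
    (-κ * s) * 𝒮.N (𝒮.P₀ z₂) (𝒮.P₀ w) + s * 𝒮.N (𝒮.P₀ z₁) (𝒮.P₀ w)

/-- Division by λ = s(-κ + i), in real and imaginary parts: 1/λ = (-κ - i)/(s(1 + κ²)). -/
theorem eq_smul_of_transform {E : Type*} [NormedAddCommGroup E] [NormedSpace ℝ E] {κ s : ℝ}
    (hs : 0 < s) {u₀ u₁ u₂ v₁ v₂ : E} (h₁ : v₁ = -u₀ + (-κ * s) • u₁ - s • u₂)
    (h₂ : v₂ = (-κ * s) • u₂ + s • u₁) :
    u₁ = (s * (1 + κ ^ 2))⁻¹ • ((-κ) • (v₁ + u₀) + v₂) ∧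
      u₂ = (s * (1 + κ ^ 2))⁻¹ • ((-κ) • v₂ - (v₁ + u₀)) := by
  have h0 : s * (1 + κ ^ 2) ≠ 0 := by positivity
  constructor
  · rw [eq_inv_smul_iff₀ h0, h₁, h₂]
    module
  · rw [eq_inv_smul_iff₀ h0, h₁, h₂]
    module

theorem norm_le_of_transform {E : Type*} [NormedAddCommGroup E] [NormedSpace ℝ E] {κ s : ℝ}
    (hκ : 0 < κ) (hκ1 : κ ≤ 1) (hs : 0 < s) {u₀ u₁ u₂ v₁ v₂ : E}
    (h₁ : v₁ = -u₀ + (-κ * s) • u₁ - s • u₂) (h₂ : v₂ = (-κ * s) • u₂ + s • u₁) :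
    ‖u₁‖ ≤ (‖v₁‖ + ‖v₂‖ + ‖u₀‖) / s ∧ ‖u₂‖ ≤ (‖v₁‖ + ‖v₂‖ + ‖u₀‖) / s := by
  obtain ⟨e₁, e₂⟩ := eq_smul_of_transform hs h₁ h₂
  have h3 : (s * (1 + κ ^ 2))⁻¹ ≤ s⁻¹ := by
    apply inv_anti₀ hs
    nlinarith [sq_nonneg κ]
  have h4 := norm_add_le v₁ u₀
  have hn : ∀ x : E, ‖(-κ) • x‖ ≤ ‖x‖ := by
    intro x
    rw [norm_smul, norm_neg, Real.norm_of_nonneg hκ.le]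
    exact mul_le_of_le_one_left (norm_nonneg _) hκ1
  have h5 : 0 < s * (1 + κ ^ 2) := by positivity
  constructor
  · rw [e₁, norm_smul, norm_inv, Real.norm_of_nonneg h5.le, div_eq_inv_mul]
    refine mul_le_mul h3 ?_ (norm_nonneg _) (by positivity)
    have := norm_add_le ((-κ) • (v₁ + u₀)) v₂
    linarith [hn (v₁ + u₀)]
  · rw [e₂, norm_smul, norm_inv, Real.norm_of_nonneg h5.le, div_eq_inv_mul]
    refine mul_le_mul h3 ?_ (norm_nonneg _) (by positivity)
    have := norm_sub_le ((-κ) • v₂) (v₁ + u₀)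
    linarith [hn v₂]

variable {𝒮}

/-- Minus the real part of the force equation paired with the conjugate velocity, with u = (v +
u₀)/λ substituted. The real parts of λ and 1/λ are both negative, so inertia and stiffness appear
with the same sign; the mixed terms cancel by symmetry of `ρ` and `A`. -/
theorem Resolvent.energy_undamped {κ s : ℝ} (hs : 0 < s)
    {u₀ v₀ u₁ u₂ v₁ v₂ : U} {y₀ z₀ y₁ y₂ z₁ z₂ : Z}
    (h : 𝒮.Resolvent κ s u₀ v₀ u₁ u₂ v₁ v₂ y₀ z₀ y₁ y₂ z₁ z₂) :
    κ * s * (𝒮.ρ (𝒮.T₀ v₁) (𝒮.T₀ v₁) + 𝒮.ρ (𝒮.T₀ v₂) (𝒮.T₀ v₂))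
      + κ * (s * (1 + κ ^ 2))⁻¹ *
        (𝒮.A (𝒮.T₁ v₁) (𝒮.T₁ v₁) + 𝒮.A (𝒮.T₁ v₂) (𝒮.T₁ v₂))
    = -𝒮.ρ (𝒮.T₀ v₀) (𝒮.T₀ v₁)
      - (s * (1 + κ ^ 2))⁻¹ *
        (κ * 𝒮.A (𝒮.T₁ u₀) (𝒮.T₁ v₁) + 𝒮.A (𝒮.T₁ u₀) (𝒮.T₁ v₂))
      - 𝒮.Q z₁ v₁ - 𝒮.Q z₂ v₂
      + 𝒮.B₁ (𝒮.P₁ y₁) (𝒮.T₁ v₁) + 𝒮.B₁ (𝒮.P₁ y₂) (𝒮.T₁ v₂) := by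
  obtain ⟨e₁, e₂⟩ := eq_smul_of_transform hs h.velocity_v₁ h.velocity_v₂
  have r := h.force₁ v₁
  have i := h.force₂ v₂
  rw [force_apply] at r i
  have a₁ : 𝒮.A (𝒮.T₁ u₁) (𝒮.T₁ v₁) = (s * (1 + κ ^ 2))⁻¹ *
      (-κ * (𝒮.A (𝒮.T₁ v₁) (𝒮.T₁ v₁) + 𝒮.A (𝒮.T₁ u₀) (𝒮.T₁ v₁))
        + 𝒮.A (𝒮.T₁ v₂) (𝒮.T₁ v₁)) := by
    conv_lhs => rw [e₁]
    simp only [map_add, map_smul, add_apply, smul_apply, smul_eq_mul]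
  have a₂ : 𝒮.A (𝒮.T₁ u₂) (𝒮.T₁ v₂) = (s * (1 + κ ^ 2))⁻¹ *
      (-κ * 𝒮.A (𝒮.T₁ v₂) (𝒮.T₁ v₂)
        - (𝒮.A (𝒮.T₁ v₁) (𝒮.T₁ v₂) + 𝒮.A (𝒮.T₁ u₀) (𝒮.T₁ v₂))) := by
    conv_lhs => rw [e₂]
    simp only [map_add, map_sub, map_smul, add_apply, sub_apply, smul_apply, smul_eq_mul]
  rw [a₁] at r
  rw [a₂] at i
  have s₁ := 𝒮.A_symm (𝒮.T₁ v₁) (𝒮.T₁ v₂)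
  have s₂ := 𝒮.ρ_symm (𝒮.T₀ v₁) (𝒮.T₀ v₂)
  rw [s₁] at i
  rw [s₂] at i
  linear_combination r + i

/-- Real part plus 2κ times the imaginary part of the flux equation paired with the conjugate of z.
The inertia contributes -κs + 2κs = κs. As `D` need not be symmetric, its antisymmetric part
survives with the factor 2κ. -/
theorem Resolvent.energy_damped {κ s : ℝ}
    {u₀ v₀ u₁ u₂ v₁ v₂ : U} {y₀ z₀ y₁ y₂ z₁ z₂ : Z}
    (h : 𝒮.Resolvent κ s u₀ v₀ u₁ u₂ v₁ v₂ y₀ z₀ y₁ y₂ z₁ z₂) :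
    κ * s * (𝒮.N (𝒮.P₀ z₁) (𝒮.P₀ z₁) + 𝒮.N (𝒮.P₀ z₂) (𝒮.P₀ z₂))
      + (𝒮.D (𝒮.P₁ z₁) (𝒮.P₁ z₁) + 𝒮.D (𝒮.P₁ z₂) (𝒮.P₁ z₂))
      + 2 * κ * (𝒮.D (𝒮.P₁ z₂) (𝒮.P₁ z₁) - 𝒮.D (𝒮.P₁ z₁) (𝒮.P₁ z₂))
    = 𝒮.N (𝒮.P₀ z₀) (𝒮.P₀ z₁) - 2 * κ * 𝒮.N (𝒮.P₀ z₀) (𝒮.P₀ z₂)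
      - (𝒮.S (𝒮.P₁ y₁) (𝒮.P₁ z₁) + 𝒮.S (𝒮.P₁ y₂) (𝒮.P₁ z₂))
      - 2 * κ * (𝒮.S (𝒮.P₁ y₂) (𝒮.P₁ z₁) - 𝒮.S (𝒮.P₁ y₁) (𝒮.P₁ z₂))
      - (𝒮.Q z₁ v₁ + 𝒮.Q z₂ v₂) - 2 * κ * (𝒮.Q z₁ v₂ - 𝒮.Q z₂ v₁)
      - (𝒮.J₁ (𝒮.P₀ z₁) (𝒮.P₁ z₁) + 𝒮.J₁ (𝒮.P₀ z₂) (𝒮.P₁ z₂))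
      - 2 * κ * (𝒮.J₁ (𝒮.P₀ z₂) (𝒮.P₁ z₁) - 𝒮.J₁ (𝒮.P₀ z₁) (𝒮.P₁ z₂))
      - (𝒮.J₂ (𝒮.P₁ z₁) (𝒮.P₀ z₁) + 𝒮.J₂ (𝒮.P₁ z₂) (𝒮.P₀ z₂))
      - 2 * κ * (𝒮.J₂ (𝒮.P₁ z₂) (𝒮.P₀ z₁) - 𝒮.J₂ (𝒮.P₁ z₁) (𝒮.P₀ z₂))
      - (𝒮.B₂ (𝒮.T₁ u₁) (𝒮.P₁ z₁) + 𝒮.B₂ (𝒮.T₁ u₂) (𝒮.P₁ z₂))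
      - 2 * κ * (𝒮.B₂ (𝒮.T₁ u₂) (𝒮.P₁ z₁) - 𝒮.B₂ (𝒮.T₁ u₁) (𝒮.P₁ z₂)) := by
  have r₁ := h.flux₁ z₁
  have i₂ := h.flux₂ z₂
  have i₁ := h.flux₂ z₁
  have r₂ := h.flux₁ z₂
  rw [flux_apply] at r₁ r₂ i₁ i₂
  have s₂ := 𝒮.N_symm (𝒮.P₀ z₁) (𝒮.P₀ z₂)
  rw [s₂] at i₂ r₂
  linear_combination -r₁ - i₂ - 2 * κ * (i₁ - r₂)

end DampedSystem

end AbstractSystem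

/-! ### The resolvent bound on a ray in the left half-plane. -/

section AbstractSystemUniqueness

open MeasureTheory Set Filter Topology

variable {U Z H₀ H₁ K₀ K₁ : Type*}
  [NormedAddCommGroup U] [NormedSpace ℝ U] [NormedAddCommGroup Z] [NormedSpace ℝ Z]
  [NormedAddCommGroup H₀] [NormedSpace ℝ H₀] [NormedAddCommGroup H₁] [NormedSpace ℝ H₁]
  [NormedAddCommGroup K₀] [NormedSpace ℝ K₀] [NormedAddCommGroup K₁] [NormedSpace ℝ K₁]

theorem half_mul_sq_add_le_add {c a b A B : ℝ} (hc : 0 ≤ c) (ha : c * a * a ≤ A)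
    (hb : c * b * b ≤ B) : c / 2 * (a + b) ^ 2 ≤ A + B := by
  have := mul_nonneg hc (sq_nonneg (a - b))
  linarith

namespace DampedSystem

theorem norm_map_le_of_transform {E F : Type*} [NormedAddCommGroup E] [NormedSpace ℝ E]
    [NormedAddCommGroup F] [NormedSpace ℝ F] (L : E →L[ℝ] F) {κ s K : ℝ} (hκ : 0 < κ)
    (hκ1 : κ ≤ 1) (hs : 0 < s) {u₀ u₁ u₂ v₁ v₂ : E}
    (h₁ : v₁ = -u₀ + (-κ * s) • u₁ - s • u₂) (h₂ : v₂ = (-κ * s) • u₂ + s • u₁)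
    (hu₀ : ‖L u₀‖ ≤ K) :
    ‖L u₁‖ ≤ (‖L v₁‖ + ‖L v₂‖ + K) * s⁻¹ ∧ ‖L u₂‖ ≤ (‖L v₁‖ + ‖L v₂‖ + K) * s⁻¹ := by
  have := norm_le_of_transform (κ := κ) (s := s) hκ hκ1 hs (u₀ := L u₀) (u₁ := L u₁)
    (u₂ := L u₂) (v₁ := L v₁) (v₂ := L v₂) (by rw [h₁]; simp) (by rw [h₂]; simp)
  rw [← div_eq_mul_inv]
  exact ⟨this.1.trans (by gcongr), this.2.trans (by gcongr)⟩

variable (𝒮 : DampedSystem U Z H₀ H₁ K₀ K₁)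

set_option maxHeartbeats 4000000 in
/-- Resolvent estimate along a ray in the left half-plane: the transforms of the velocities
stay bounded in the norms of the values. -/
theorem exists_resolvent_bound : ∃ κ : ℝ, 0 < κ ∧ ∀ (u₀ v₀ : U) (y₀ z₀ : Z),
    ∃ s₀ : ℝ, ∀ s, s₀ ≤ s → ∀ (u₁ u₂ v₁ v₂ : U) (y₁ y₂ z₁ z₂ : Z),
      𝒮.Resolvent κ s u₀ v₀ u₁ u₂ v₁ v₂ y₀ z₀ y₁ y₂ z₁ z₂ →
      ‖𝒮.T₀ v₁‖ + ‖𝒮.T₀ v₂‖ ≤ 1 ∧ ‖𝒮.P₀ z₁‖ + ‖𝒮.P₀ z₂‖ ≤ 1 := by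
  obtain ⟨cρ, hcρ, hρ⟩ := 𝒮.ρ_coercive
  obtain ⟨cN, hcN, hN⟩ := 𝒮.N_coercive
  obtain ⟨cD, hcD, hD⟩ := 𝒮.D_coercive
  obtain ⟨cA, hcA, hA⟩ := 𝒮.A_coercive
  obtain ⟨CQ, hQ⟩ := 𝒮.Q_bound
  -- The slope of the ray is small enough for half the coercivity of `D` to absorb the antisymmetric
  -- term 2κ(D(z₂, z₁) - D(z₁, z₂)).
  obtain ⟨κ, hκ, hκ1, hκD⟩ : ∃ κ : ℝ, 0 < κ ∧ κ ≤ 1 ∧ 4 * κ * ‖𝒮.D‖ ≤ cD := by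
    have h0 : 0 < 4 * (‖𝒮.D‖ + 1) := by positivity
    refine ⟨min 1 (cD / (4 * (‖𝒮.D‖ + 1))), lt_min one_pos (by positivity), min_le_left _ _, ?_⟩
    have h1 := min_le_right 1 (cD / (4 * (‖𝒮.D‖ + 1)))
    rw [le_div_iff₀ h0] at h1
    have h2 : 0 < min 1 (cD / (4 * (‖𝒮.D‖ + 1))) := lt_min one_pos (by positivity)
    linarith
  refine ⟨κ, hκ, fun u₀ v₀ y₀ z₀ => ?_⟩
  obtain ⟨c, hc, hc1, hc2, hc3, hc4⟩ : ∃ c, 0 < c ∧ c ≤ cρ ∧ c ≤ cN ∧ c ≤ cD ∧ c ≤ cA :=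
    ⟨min (min cρ cN) (min cD cA), by simp [*], by simp, by simp, by simp, by simp⟩
  -- `K` also dominates the initial data, so the threshold s₀ depends on them; κ was fixed
  -- beforehand and does not.
  obtain ⟨K, hK1, kρ, kA, kN, kS, kJ₁, kJ₂, kB₁, kB₂, kQ, ku, kv, ky, kz⟩ : ∃ K : ℝ, 1 ≤ K ∧
      ‖𝒮.ρ‖ ≤ K ∧ ‖𝒮.A‖ ≤ K ∧ ‖𝒮.N‖ ≤ K ∧ ‖𝒮.S‖ ≤ K ∧ ‖𝒮.J₁‖ ≤ K ∧ ‖𝒮.J₂‖ ≤ K ∧ ‖𝒮.B₁‖ ≤ K ∧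
      ‖𝒮.B₂‖ ≤ K ∧ CQ ≤ K ∧ ‖𝒮.T₁ u₀‖ ≤ K ∧ ‖𝒮.T₀ v₀‖ ≤ K ∧ ‖𝒮.P₁ y₀‖ ≤ K ∧ ‖𝒮.P₀ z₀‖ ≤ K := by
    refine ⟨1 + ‖𝒮.ρ‖ + ‖𝒮.A‖ + ‖𝒮.N‖ + ‖𝒮.S‖ + ‖𝒮.J₁‖ + ‖𝒮.J₂‖ + ‖𝒮.B₁‖ + ‖𝒮.B₂‖ + |CQ|
      + ‖𝒮.T₁ u₀‖ + ‖𝒮.T₀ v₀‖ + ‖𝒮.P₁ y₀‖ + ‖𝒮.P₀ z₀‖, ?_⟩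
    have := le_abs_self CQ
    have := abs_nonneg CQ
    have := norm_nonneg 𝒮.ρ
    have := norm_nonneg 𝒮.A
    have := norm_nonneg 𝒮.N
    have := norm_nonneg 𝒮.S
    have := norm_nonneg 𝒮.J₁
    have := norm_nonneg 𝒮.J₂
    have := norm_nonneg 𝒮.B₁
    have := norm_nonneg 𝒮.B₂
    have := norm_nonneg (𝒮.T₁ u₀)
    have := norm_nonneg (𝒮.T₀ v₀)
    have := norm_nonneg (𝒮.P₁ y₀)
    have := norm_nonneg (𝒮.P₀ z₀)
    refine ⟨?_, ?_, ?_, ?_, ?_, ?_, ?_, ?_, ?_, ?_, ?_, ?_, ?_, ?_⟩ <;> linarith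
  obtain ⟨s₀, hs₀, habs⟩ := exists_forall_le_one_of_absorb (c := κ * c / 4) (C := 20 * K ^ 2)
    (by positivity) (by positivity)
  refine ⟨s₀, fun s hs u₁ u₂ v₁ v₂ y₁ y₂ z₁ z₂ h => ?_⟩
  have hs1 : 1 ≤ s := hs₀.trans hs
  have hs0 : 0 < s := by linarith
  have hK0 : 0 ≤ K := by linarith
  have E₁ := h.energy_undamped hs0
  have E₂ := h.energy_damped
  have hμ0 : 0 < (s * (1 + κ ^ 2))⁻¹ := by positivity
  have hμ1 : (s * (1 + κ ^ 2))⁻¹ ≤ s⁻¹ := inv_anti₀ hs0 (by nlinarith only [hs0, mul_nonneg hs0.le (sq_nonneg κ)])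
  have hμ2 : s⁻¹ / 2 ≤ (s * (1 + κ ^ 2))⁻¹ := by
    rw [div_eq_mul_inv, ← mul_inv]
    have hκ2 : κ ^ 2 ≤ 1 := pow_le_one₀ hκ.le hκ1
    exact inv_anti₀ (by positivity) (mul_le_mul_of_nonneg_left (by linarith only [hκ2]) hs0.le)
  set μ := (s * (1 + κ ^ 2))⁻¹
  have hx₁ := norm_nonneg (𝒮.T₀ v₁)
  have hx₂ := norm_nonneg (𝒮.T₀ v₂)
  have hy₁ := norm_nonneg (𝒮.T₁ v₁)
  have hy₂ := norm_nonneg (𝒮.T₁ v₂)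
  have hp₁ := norm_nonneg (𝒮.P₀ z₁)
  have hp₂ := norm_nonneg (𝒮.P₀ z₂)
  have hg₁ := norm_nonneg (𝒮.P₁ z₁)
  have hg₂ := norm_nonneg (𝒮.P₁ z₂)
  -- coercivity
  have Cρ := half_mul_sq_add_le_add hcρ.le (hρ (𝒮.T₀ v₁)) (hρ (𝒮.T₀ v₂))
  have CN := half_mul_sq_add_le_add hcN.le (hN (𝒮.P₀ z₁)) (hN (𝒮.P₀ z₂))
  have CA := half_mul_sq_add_le_add hcA.le (hA v₁) (hA v₂)
  -- Only cD / 2 is spent here; the other half is kept for the cross term `hDcross`.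
  have CD := half_mul_sq_add_le_add (a := ‖𝒮.P₁ z₁‖) (b := ‖𝒮.P₁ z₂‖)
    (A := 𝒮.D (𝒮.P₁ z₁) (𝒮.P₁ z₁) - cD / 2 * ‖𝒮.P₁ z₁‖ * ‖𝒮.P₁ z₁‖)
    (B := 𝒮.D (𝒮.P₁ z₂) (𝒮.P₁ z₂) - cD / 2 * ‖𝒮.P₁ z₂‖ * ‖𝒮.P₁ z₂‖) (c := cD / 2) (by positivity)
    (by linarith only [hD (𝒮.P₁ z₁)]) (by linarith only [hD (𝒮.P₁ z₂)])
  have D₁₂ := abs_le.1 (abs_apply_apply_le (le_refl ‖𝒮.D‖) (le_refl ‖𝒮.P₁ z₁‖) (le_refl ‖𝒮.P₁ z₂‖))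
  have D₂₁ := abs_le.1 (abs_apply_apply_le (le_refl ‖𝒮.D‖) (le_refl ‖𝒮.P₁ z₂‖) (le_refl ‖𝒮.P₁ z₁‖))
  have hDcross : -(cD * (‖𝒮.P₁ z₁‖ * ‖𝒮.P₁ z₂‖)) ≤
      2 * κ * (𝒮.D (𝒮.P₁ z₂) (𝒮.P₁ z₁) - 𝒮.D (𝒮.P₁ z₁) (𝒮.P₁ z₂)) := by
    have h1 : -(2 * ‖𝒮.D‖ * (‖𝒮.P₁ z₁‖ * ‖𝒮.P₁ z₂‖)) ≤
        𝒮.D (𝒮.P₁ z₂) (𝒮.P₁ z₁) - 𝒮.D (𝒮.P₁ z₁) (𝒮.P₁ z₂) := by linarith only [D₁₂.2, D₂₁.1]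
    have h2 := mul_le_mul_of_nonneg_left h1 (by positivity : 0 ≤ 2 * κ)
    have h3 := mul_le_mul_of_nonneg_right hκD (mul_nonneg hg₁ hg₂)
    linarith only [h2, h3]
  have hDlow : cD / 4 * (‖𝒮.P₁ z₁‖ + ‖𝒮.P₁ z₂‖) ^ 2 ≤
      𝒮.D (𝒮.P₁ z₁) (𝒮.P₁ z₁) + 𝒮.D (𝒮.P₁ z₂) (𝒮.P₁ z₂)
        + 2 * κ * (𝒮.D (𝒮.P₁ z₂) (𝒮.P₁ z₁) - 𝒮.D (𝒮.P₁ z₁) (𝒮.P₁ z₂)) := by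
    have := mul_nonneg hcD.le (sq_nonneg (‖𝒮.P₁ z₁‖ - ‖𝒮.P₁ z₂‖))
    linarith only [this, CD, hDcross]
  -- the displacements in terms of the velocities
  obtain ⟨bu₁, bu₂⟩ := norm_map_le_of_transform 𝒮.T₁ hκ hκ1 hs0 h.velocity_v₁ h.velocity_v₂ ku
  obtain ⟨by₁, by₂⟩ := norm_map_le_of_transform 𝒮.P₁ hκ hκ1 hs0 h.velocity_z₁ h.velocity_z₂ ky
  set x := ‖𝒮.T₀ v₁‖ + ‖𝒮.T₀ v₂‖ with hx
  set y := ‖𝒮.T₁ v₁‖ + ‖𝒮.T₁ v₂‖ with hy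
  set p := ‖𝒮.P₀ z₁‖ + ‖𝒮.P₀ z₂‖ with hp
  set g := ‖𝒮.P₁ z₁‖ + ‖𝒮.P₁ z₂‖ with hg
  have lx₁ : ‖𝒮.T₀ v₁‖ ≤ x := by linarith only [hx, hx₂]
  have lx₂ : ‖𝒮.T₀ v₂‖ ≤ x := by linarith only [hx, hx₁]
  have ly₁ : ‖𝒮.T₁ v₁‖ ≤ y := by linarith only [hy, hy₂]
  have ly₂ : ‖𝒮.T₁ v₂‖ ≤ y := by linarith only [hy, hy₁]
  have lp₁ : ‖𝒮.P₀ z₁‖ ≤ p := by linarith only [hp, hp₂]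
  have lp₂ : ‖𝒮.P₀ z₂‖ ≤ p := by linarith only [hp, hp₁]
  have lg₁ : ‖𝒮.P₁ z₁‖ ≤ g := by linarith only [hg, hg₂]
  have lg₂ : ‖𝒮.P₁ z₂‖ ≤ g := by linarith only [hg, hg₁]
  have hx0 : 0 ≤ x := by linarith only [hx, hx₁, hx₂]
  have hy0 : 0 ≤ y := by linarith only [hy, hy₁, hy₂]
  have hp0 : 0 ≤ p := by linarith only [hp, hp₁, hp₂]
  have hg0 : 0 ≤ g := by linarith only [hg, hg₁, hg₂]
  have hκt : ∀ {t b : ℝ}, |t| ≤ b → |κ * t| ≤ b := by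
    intro t b ht
    rw [abs_mul, abs_of_pos hκ]
    exact (mul_le_of_le_one_left (abs_nonneg _) hκ1).trans ht
  have hσ0 : 0 < s⁻¹ := by positivity
  set σ := s⁻¹ with hσ
  have bQ : ∀ z v, ‖𝒮.T₀ v‖ ≤ x → ‖𝒮.P₀ z‖ ≤ p → ‖𝒮.P₁ z‖ ≤ g →
      |𝒮.Q z v| ≤ K * (x * (p + g)) := by
    intro z v h1 h2 h3
    refine (hQ z v).trans (mul_le_mul kQ ?_ (by positivity) hK0)
    exact mul_le_mul h1 (add_le_add h2 h3) (by positivity) hx0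
  -- the right-hand side of the first energy identity
  have t₁ := abs_le.1 (abs_apply_apply_le kρ kv lx₁)
  have t₂ : |μ * (κ * 𝒮.A (𝒮.T₁ u₀) (𝒮.T₁ v₁) + 𝒮.A (𝒮.T₁ u₀) (𝒮.T₁ v₂))|
      ≤ σ * (2 * (K * (K * y))) := by
    rw [abs_mul, abs_of_pos hμ0]
    refine mul_le_mul hμ1 ((abs_add_le _ _).trans ?_) (abs_nonneg _) hσ0.le
    linarith only [hκt (abs_apply_apply_le kA ku ly₁), abs_apply_apply_le kA ku ly₂]
  have t₂ := abs_le.1 t₂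
  have q₁₁ := abs_le.1 (bQ z₁ v₁ lx₁ lp₁ lg₁)
  have q₂₂ := abs_le.1 (bQ z₂ v₂ lx₂ lp₂ lg₂)
  have b₁₁ := abs_le.1 (abs_apply_apply_le kB₁ by₁ ly₁)
  have b₂₂ := abs_le.1 (abs_apply_apply_le kB₁ by₂ ly₂)
  have R₁ : κ * s * (𝒮.ρ (𝒮.T₀ v₁) (𝒮.T₀ v₁) + 𝒮.ρ (𝒮.T₀ v₂) (𝒮.T₀ v₂))
      + κ * μ * (𝒮.A (𝒮.T₁ v₁) (𝒮.T₁ v₁) + 𝒮.A (𝒮.T₁ v₂) (𝒮.T₁ v₂))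
      ≤ K * (K * x) + σ * (2 * (K * (K * y))) + 2 * (K * (x * (p + g)))
        + 2 * (K * ((g + K) * σ * y)) := by
    rw [E₁]
    linarith only [t₁.1, t₂.1, q₁₁.1, q₂₂.1, b₁₁.2, b₂₂.2]
  -- the right-hand side of the second energy identity
  have n₁ := abs_le.1 (abs_apply_apply_le kN kz lp₁)
  have n₂ := abs_le.1 (hκt (abs_apply_apply_le kN kz lp₂))
  have s₁₁ := abs_le.1 (abs_apply_apply_le kS by₁ lg₁)
  have s₂₂ := abs_le.1 (abs_apply_apply_le kS by₂ lg₂)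
  have s₂₁ := abs_le.1 (hκt (abs_apply_apply_le kS by₂ lg₁))
  have s₁₂ := abs_le.1 (hκt (abs_apply_apply_le kS by₁ lg₂))
  have q₁₂ := abs_le.1 (hκt (bQ z₁ v₂ lx₂ lp₁ lg₁))
  have q₂₁ := abs_le.1 (hκt (bQ z₂ v₁ lx₁ lp₂ lg₂))
  have j₁₁ := abs_le.1 (abs_apply_apply_le kJ₁ lp₁ lg₁)
  have j₂₂ := abs_le.1 (abs_apply_apply_le kJ₁ lp₂ lg₂)
  have j₂₁ := abs_le.1 (hκt (abs_apply_apply_le kJ₁ lp₂ lg₁))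
  have j₁₂ := abs_le.1 (hκt (abs_apply_apply_le kJ₁ lp₁ lg₂))
  have i₁₁ := abs_le.1 (abs_apply_apply_le kJ₂ lg₁ lp₁)
  have i₂₂ := abs_le.1 (abs_apply_apply_le kJ₂ lg₂ lp₂)
  have i₂₁ := abs_le.1 (hκt (abs_apply_apply_le kJ₂ lg₂ lp₁))
  have i₁₂ := abs_le.1 (hκt (abs_apply_apply_le kJ₂ lg₁ lp₂))
  have d₁₁ := abs_le.1 (abs_apply_apply_le kB₂ bu₁ lg₁)
  have d₂₂ := abs_le.1 (abs_apply_apply_le kB₂ bu₂ lg₂)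
  have d₂₁ := abs_le.1 (hκt (abs_apply_apply_le kB₂ bu₂ lg₁))
  have d₁₂ := abs_le.1 (hκt (abs_apply_apply_le kB₂ bu₁ lg₂))
  have R₂ : κ * s * (𝒮.N (𝒮.P₀ z₁) (𝒮.P₀ z₁) + 𝒮.N (𝒮.P₀ z₂) (𝒮.P₀ z₂))
      + (𝒮.D (𝒮.P₁ z₁) (𝒮.P₁ z₁) + 𝒮.D (𝒮.P₁ z₂) (𝒮.P₁ z₂))
      + 2 * κ * (𝒮.D (𝒮.P₁ z₂) (𝒮.P₁ z₁) - 𝒮.D (𝒮.P₁ z₁) (𝒮.P₁ z₂))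
      ≤ 3 * (K * (K * p)) + 6 * (K * ((g + K) * σ * g)) + 6 * (K * (x * (p + g)))
        + 6 * (K * (p * g)) + 6 * (K * (g * p)) + 6 * (K * ((y + K) * σ * g)) := by
    rw [E₂]
    linarith only [n₁.2, n₂.1, s₁₁.1, s₂₂.1, s₂₁.1, s₁₂.2, q₁₁.1, q₂₂.1, q₁₂.1, q₂₁.2, j₁₁.1, j₂₂.1,
      j₂₁.1, j₁₂.2, i₁₁.1, i₂₂.1, i₂₁.1, i₁₂.2, d₁₁.1, d₂₂.1, d₂₁.1, d₁₂.2]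
  refine habs s hs x y p g hx0 hy0 hp0 hg0 ?_
  have L₁ : κ * c / 4 * (s * x ^ 2) ≤
      κ * s * (𝒮.ρ (𝒮.T₀ v₁) (𝒮.T₀ v₁) + 𝒮.ρ (𝒮.T₀ v₂) (𝒮.T₀ v₂)) := by
    have h1 := mul_le_mul_of_nonneg_left Cρ (by positivity : 0 ≤ κ * s)
    have h2 : κ * s * x ^ 2 * c ≤ κ * s * x ^ 2 * cρ :=
      mul_le_mul_of_nonneg_left hc1 (by positivity)
    have h3 : 0 ≤ κ * s * x ^ 2 * c := by positivity
    linarith only [h1, h2, h3]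
  have L₂ : κ * c / 4 * (y ^ 2 / s) ≤
      κ * μ * (𝒮.A (𝒮.T₁ v₁) (𝒮.T₁ v₁) + 𝒮.A (𝒮.T₁ v₂) (𝒮.T₁ v₂)) := by
    have h1 := mul_le_mul_of_nonneg_left CA (by positivity : 0 ≤ κ * μ)
    have h2 : κ * μ * y ^ 2 * c ≤ κ * μ * y ^ 2 * cA :=
      mul_le_mul_of_nonneg_left hc4 (by positivity)
    have h3 : κ * c * y ^ 2 * (σ / 2) ≤ κ * c * y ^ 2 * μ :=
      mul_le_mul_of_nonneg_left hμ2 (by positivity)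
    rw [div_eq_mul_inv (y ^ 2) s, ← hσ]
    linarith only [h1, h2, h3]
  have L₃ : κ * c / 4 * (s * p ^ 2) ≤
      κ * s * (𝒮.N (𝒮.P₀ z₁) (𝒮.P₀ z₁) + 𝒮.N (𝒮.P₀ z₂) (𝒮.P₀ z₂)) := by
    have h1 := mul_le_mul_of_nonneg_left CN (by positivity : 0 ≤ κ * s)
    have h2 : κ * s * p ^ 2 * c ≤ κ * s * p ^ 2 * cN :=
      mul_le_mul_of_nonneg_left hc2 (by positivity)
    have h3 : 0 ≤ κ * s * p ^ 2 * c := by positivity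
    linarith only [h1, h2, h3]
  have L₄ : κ * c / 4 * g ^ 2 ≤ cD / 4 * g ^ 2 := by
    have h1 : κ * c ≤ cD := (mul_le_of_le_one_left hc.le hκ1).trans hc3
    have h2 := mul_le_mul_of_nonneg_right h1 (sq_nonneg g)
    linarith only [h2]
  have hKK : ∀ t : ℝ, 0 ≤ t → K * t ≤ K ^ 2 * t := fun t ht =>
    mul_le_mul_of_nonneg_right (by nlinarith only [hK1]) ht
  have hK2 : ∀ t : ℝ, 0 ≤ t → 0 ≤ K ^ 2 * t := fun t ht => mul_nonneg (sq_nonneg K) ht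
  -- The two energy identities are simply added; no relative weight is needed, since every coupling
  -- term is of lower order in s.
  have hbound : κ * c / 4 * (s * x ^ 2 + y ^ 2 / s + s * p ^ 2 + g ^ 2) ≤
      K * (K * x) + σ * (2 * (K * (K * y))) + 2 * (K * (x * (p + g)))
        + 2 * (K * ((g + K) * σ * y)) + (3 * (K * (K * p)) + 6 * (K * ((g + K) * σ * g))
        + 6 * (K * (x * (p + g))) + 6 * (K * (p * g)) + 6 * (K * (g * p))
        + 6 * (K * ((y + K) * σ * g))) := by
    linarith only [R₁, R₂, L₁, L₂, L₃, L₄, hDlow]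
  refine hbound.trans ?_
  simp only [div_eq_mul_inv, ← hσ]
  have m1 := hK2 x hx0
  have m2 := hK2 (y * σ) (by positivity)
  have m3 := hK2 p hp0
  have m4 := hK2 (g * σ) (by positivity)
  have m5 := hKK (x * p) (by positivity)
  have m5' := hK2 (x * p) (by positivity)
  have m6 := hKK (x * g) (by positivity)
  have m6' := hK2 (x * g) (by positivity)
  have m7 := hKK (y * g * σ) (by positivity)
  have m7' := hK2 (y * g * σ) (by positivity)
  have m8 := hKK (g ^ 2 * σ) (by positivity)
  have m8' := hK2 (g ^ 2 * σ) (by positivity)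
  have m9 := hKK (p * g) (by positivity)
  have m9' := hK2 (p * g) (by positivity)
  linarith only [m1, m2, m3, m4, m5, m5', m6, m6', m7, m7', m8, m8', m9, m9']

end DampedSystem

end AbstractSystemUniqueness

/-! ### Transforms of vector-valued curves and vanishing of the velocities. -/

section DampedSystemVanishing

open MeasureTheory Set Filter Topology

variable {E F : Type*} [NormedAddCommGroup E] [NormedSpace ℝ E]
  [NormedAddCommGroup F] [NormedSpace ℝ F]

/-- The real part of the Laplace transform over `[0, T]` at the point `s (-κ + i)`. -/
noncomputable def laplaceRe (κ s T : ℝ) (f : ℝ → E) : E :=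
  ∫ t in (0 : ℝ)..T, (Real.exp (κ * s * t) * Real.cos (s * t)) • f t

/-- The imaginary part of the Laplace transform over `[0, T]` at the point `s (-κ + i)`. -/
noncomputable def laplaceIm (κ s T : ℝ) (f : ℝ → E) : E :=
  ∫ t in (0 : ℝ)..T, (-(Real.exp (κ * s * t) * Real.sin (s * t))) • f t

variable {κ s T : ℝ}

theorem intervalIntegrable_smul_of_continuousOn {k : ℝ → ℝ} (hk : Continuous k) (hT : 0 ≤ T)
    {f : ℝ → E} (hf : ContinuousOn f (Ici 0)) :
    IntervalIntegrable (fun t => k t • f t) volume 0 T := by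
  apply ContinuousOn.intervalIntegrable
  rw [uIcc_of_le hT]
  exact hk.continuousOn.smul (hf.mono Icc_subset_Ici_self)

theorem laplaceRe_clm [CompleteSpace E] [CompleteSpace F] (L : E →L[ℝ] F) (hT : 0 ≤ T) {f : ℝ → E}
    (hf : ContinuousOn f (Ici 0)) : laplaceRe κ s T (fun t => L (f t)) = L (laplaceRe κ s T f) := by
  rw [laplaceRe, laplaceRe, ← L.intervalIntegral_comp_comm
    (intervalIntegrable_smul_of_continuousOn (by fun_prop) hT hf)]
  simp

theorem laplaceIm_clm [CompleteSpace E] [CompleteSpace F] (L : E →L[ℝ] F) (hT : 0 ≤ T) {f : ℝ → E}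
    (hf : ContinuousOn f (Ici 0)) : laplaceIm κ s T (fun t => L (f t)) = L (laplaceIm κ s T f) := by
  rw [laplaceIm, laplaceIm, ← L.intervalIntegral_comp_comm
    (intervalIntegrable_smul_of_continuousOn (by fun_prop) hT hf)]
  simp

theorem laplaceRe_prodMk [CompleteSpace E] [CompleteSpace F] (hT : 0 ≤ T) {f : ℝ → E} {g : ℝ → F}
    (hf : ContinuousOn f (Ici 0)) (hg : ContinuousOn g (Ici 0)) :
    laplaceRe κ s T (fun t => (f t, g t)) = (laplaceRe κ s T f, laplaceRe κ s T g) :=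
  Prod.ext (laplaceRe_clm (ContinuousLinearMap.fst ℝ E F) hT (hf.prodMk hg)).symm
    (laplaceRe_clm (ContinuousLinearMap.snd ℝ E F) hT (hf.prodMk hg)).symm

theorem laplaceIm_prodMk [CompleteSpace E] [CompleteSpace F] (hT : 0 ≤ T) {f : ℝ → E} {g : ℝ → F}
    (hf : ContinuousOn f (Ici 0)) (hg : ContinuousOn g (Ici 0)) :
    laplaceIm κ s T (fun t => (f t, g t)) = (laplaceIm κ s T f, laplaceIm κ s T g) :=
  Prod.ext (laplaceIm_clm (ContinuousLinearMap.fst ℝ E F) hT (hf.prodMk hg)).symm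
    (laplaceIm_clm (ContinuousLinearMap.snd ℝ E F) hT (hf.prodMk hg)).symm

/-- Rest at time T enters here: it removes the boundary term at T, which the growing kernel e^{κst}
would make exponentially large in s. -/
theorem integral_smul_deriv_eq [CompleteSpace E] {k k' : ℝ → ℝ} (hk : ∀ t, HasDerivAt k (k' t) t)
    (hk' : Continuous k') (hT : 0 ≤ T) {f f' : ℝ → E}
    (hf : ∀ t, 0 ≤ t → HasDerivWithinAt f (f' t) (Ici 0) t) (hf' : ContinuousOn f' (Ici 0))
    (hfT : f T = 0) :
    ∫ t in (0 : ℝ)..T, k t • f' t = -(k 0 • f 0) - ∫ t in (0 : ℝ)..T, k' t • f t := by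
  have hkc : Continuous k := continuous_iff_continuousAt.2 fun t => (hk t).continuousAt
  have hfc : ContinuousOn f (Ici 0) := fun t ht => (hf t ht).continuousWithinAt
  have i₁ := intervalIntegrable_smul_of_continuousOn hkc hT hf'
  have i₂ := intervalIntegrable_smul_of_continuousOn hk' hT hfc
  have h := intervalIntegral.integral_eq_sub_of_hasDerivAt_of_le hT
    (f := fun t => k t • f t) (f' := fun t => k t • f' t + k' t • f t)
    (hkc.continuousOn.smul (hfc.mono Icc_subset_Ici_self))
    (fun t ht => (hk t).smul ((hf t ht.1.le).hasDerivAt (Ici_mem_nhds ht.1))) (i₁.add i₂)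
  rw [intervalIntegral.integral_add i₁ i₂, hfT, smul_zero, zero_sub] at h
  rw [← h, add_sub_cancel_right]

theorem integral_add_smul_smul {k l : ℝ → ℝ} {f : ℝ → E} (a b : ℝ)
    (hk : IntervalIntegrable (fun t => k t • f t) volume 0 T)
    (hl : IntervalIntegrable (fun t => l t • f t) volume 0 T) :
    ∫ t in (0 : ℝ)..T, (a * k t + b * l t) • f t
      = a • (∫ t in (0 : ℝ)..T, k t • f t) + b • ∫ t in (0 : ℝ)..T, l t • f t := by
  rw [← intervalIntegral.integral_smul, ← intervalIntegral.integral_smul]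
  refine Eq.trans ?_ (intervalIntegral.integral_add (hk.smul a) (hl.smul b))
  congr 1
  ext t
  simp only [smul_smul, add_smul]

theorem laplaceRe_deriv [CompleteSpace E] (hT : 0 ≤ T) {f f' : ℝ → E}
    (hf : ∀ t, 0 ≤ t → HasDerivWithinAt f (f' t) (Ici 0) t) (hf' : ContinuousOn f' (Ici 0))
    (hfT : f T = 0) : laplaceRe κ s T f' =
      -f 0 + (-κ * s) • laplaceRe κ s T f - s • laplaceIm κ s T f := by
  have hfc : ContinuousOn f (Ici 0) := fun t ht => (hf t ht).continuousWithinAt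
  have hk : ∀ t, HasDerivAt (fun t => Real.exp (κ * s * t) * Real.cos (s * t))
      (κ * s * (Real.exp (κ * s * t) * Real.cos (s * t))
        + s * (-(Real.exp (κ * s * t) * Real.sin (s * t)))) t := by
    intro t
    have h1 := ((hasDerivAt_id t).const_mul (κ * s)).exp
    have h2 := ((hasDerivAt_id t).const_mul s).cos
    convert! h1.mul h2 using 1
    simp only [id]
    ring
  rw [laplaceRe, integral_smul_deriv_eq hk (by fun_prop) hT hf hf' hfT]
  have h1 := integral_add_smul_smul (κ * s) s
    (intervalIntegrable_smul_of_continuousOn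
      (k := fun t => Real.exp (κ * s * t) * Real.cos (s * t)) (by fun_prop) hT hfc)
    (intervalIntegrable_smul_of_continuousOn
      (k := fun t => -(Real.exp (κ * s * t) * Real.sin (s * t))) (by fun_prop) hT hfc)
  rw [h1, ← laplaceRe, ← laplaceIm]
  simp only [mul_zero, Real.exp_zero, Real.cos_zero, mul_one]
  module

theorem laplaceIm_deriv [CompleteSpace E] (hT : 0 ≤ T) {f f' : ℝ → E}
    (hf : ∀ t, 0 ≤ t → HasDerivWithinAt f (f' t) (Ici 0) t) (hf' : ContinuousOn f' (Ici 0))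
    (hfT : f T = 0) : laplaceIm κ s T f' =
      (-κ * s) • laplaceIm κ s T f + s • laplaceRe κ s T f := by
  have hfc : ContinuousOn f (Ici 0) := fun t ht => (hf t ht).continuousWithinAt
  have hk : ∀ t, HasDerivAt (fun t => -(Real.exp (κ * s * t) * Real.sin (s * t)))
      (κ * s * (-(Real.exp (κ * s * t) * Real.sin (s * t)))
        + (-s) * (Real.exp (κ * s * t) * Real.cos (s * t))) t := by
    intro t
    have h1 := ((hasDerivAt_id t).const_mul (κ * s)).exp
    have h2 := ((hasDerivAt_id t).const_mul s).sin
    convert! (h1.mul h2).neg using 1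
    simp only [id]
    ring
  rw [laplaceIm, integral_smul_deriv_eq hk (by fun_prop) hT hf hf' hfT]
  have h1 := integral_add_smul_smul (κ * s) (-s)
    (intervalIntegrable_smul_of_continuousOn
      (k := fun t => -(Real.exp (κ * s * t) * Real.sin (s * t))) (by fun_prop) hT hfc)
    (intervalIntegrable_smul_of_continuousOn
      (k := fun t => Real.exp (κ * s * t) * Real.cos (s * t)) (by fun_prop) hT hfc)
  rw [h1, ← laplaceRe, ← laplaceIm]
  simp only [mul_zero, Real.exp_zero, Real.sin_zero, neg_zero]
  module

theorem finiteLaplace_eq_laplaceRe_add {g : ℝ → ℝ} (hT : 0 ≤ T) (hg : ContinuousOn g (Ici 0)) :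
    finiteLaplace g T (s * (-κ + Complex.I)) = laplaceRe κ s T g + laplaceIm κ s T g * Complex.I := by
  have i₁ := intervalIntegrable_smul_of_continuousOn
    (k := fun t => Real.exp (κ * s * t) * Real.cos (s * t)) (by fun_prop) hT hg
  have i₂ := intervalIntegrable_smul_of_continuousOn
    (k := fun t => -(Real.exp (κ * s * t) * Real.sin (s * t))) (by fun_prop) hT hg
  have j₁ : IntervalIntegrable (fun t => (((Real.exp (κ * s * t) * Real.cos (s * t)) • g t : ℝ) : ℂ))
      volume 0 T := ⟨i₁.1.ofReal, i₁.2.ofReal⟩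
  have j₂ : IntervalIntegrable
      (fun t => (((-(Real.exp (κ * s * t) * Real.sin (s * t))) • g t : ℝ) : ℂ)) volume 0 T :=
    ⟨i₂.1.ofReal, i₂.2.ofReal⟩
  rw [finiteLaplace, laplaceRe, laplaceIm, ← intervalIntegral.integral_ofReal,
    ← intervalIntegral.integral_ofReal, ← intervalIntegral.integral_mul_const,
    ← intervalIntegral.integral_add j₁ (j₂.mul_const _)]
  refine intervalIntegral.integral_congr fun t _ => ?_
  have h1 : -((s : ℂ) * (-κ + Complex.I)) * t
      = ((κ * s * t : ℝ) : ℂ) + ((-(s * t) : ℝ) : ℂ) * Complex.I := by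
    push_cast
    ring
  simp only [smul_eq_mul]
  rw [h1, Complex.exp_add, Complex.exp_mul_I, ← Complex.ofReal_exp, ← Complex.ofReal_cos,
    ← Complex.ofReal_sin, Real.cos_neg, Real.sin_neg]
  push_cast
  ring

variable {U Z H₀ H₁ K₀ K₁ : Type*}
  [NormedAddCommGroup U] [NormedSpace ℝ U] [NormedAddCommGroup Z] [NormedSpace ℝ Z]
  [NormedAddCommGroup H₀] [NormedSpace ℝ H₀] [NormedAddCommGroup H₁] [NormedSpace ℝ H₁]
  [NormedAddCommGroup K₀] [NormedSpace ℝ K₀] [NormedAddCommGroup K₁] [NormedSpace ℝ K₁]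

namespace DampedSystem

variable (𝒮 : DampedSystem U Z H₀ H₁ K₀ K₁)

/-- Continuous functionals on `F` separate points and commute with the integral, which reduces the
claim to the scalar case. -/
theorem eq_zero_of_laplace_bounded [CompleteSpace E] (L : E →L[ℝ] F) (hT : 0 < T) (hκ : 0 < κ)
    {v : ℝ → E} (hv : ContinuousOn v (Ici 0)) {s₀ : ℝ}
    (h : ∀ s, s₀ ≤ s → ‖L (laplaceRe κ s T v)‖ + ‖L (laplaceIm κ s T v)‖ ≤ 1) :
    ∀ t ∈ Icc 0 T, L (v t) = 0 := by
  intro t ht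
  refine SeparatingDual.eq_zero_of_forall_dual_eq_zero (R := ℝ) fun ℓ => ?_
  have hg : ContinuousOn (fun t => (ℓ ∘L L) (v t)) (Ici 0) := (ℓ ∘L L).continuous.comp_continuousOn hv
  refine eq_zero_of_finiteLaplace_bounded_on_ray (g := fun t => (ℓ ∘L L) (v t)) hT
    (hg.mono Icc_subset_Ici_self) (k := κ) (C := ‖ℓ‖) (s₀ := s₀) hκ (fun s hs => ?_) t ht
  rw [finiteLaplace_eq_laplaceRe_add hT.le hg, laplaceRe_clm _ hT.le hv, laplaceIm_clm _ hT.le hv]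
  refine (norm_add_le _ _).trans ?_
  rw [norm_mul, Complex.norm_I, mul_one, Complex.norm_real, Complex.norm_real]
  have h1 := ℓ.le_opNorm (L (laplaceRe κ s T v))
  have h2 := ℓ.le_opNorm (L (laplaceIm κ s T v))
  have h3 := mul_le_mul_of_nonneg_left (h s hs) (norm_nonneg ℓ)
  simp only [ContinuousLinearMap.comp_apply]
  linarith

/-- A solution of a damped system that is at rest at time `T` has vanished on all of `[0, T]`. -/
theorem eq_zero_of_terminal_eq_zero [CompleteSpace U] [CompleteSpace Z] (hT : 0 < T)
    {u v : ℝ → U} {y z : ℝ → Z}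
    (hu : ∀ t, 0 ≤ t → HasDerivWithinAt u (v t) (Ici 0) t)
    (hy : ∀ t, 0 ≤ t → HasDerivWithinAt y (z t) (Ici 0) t)
    (hv : ContinuousOn v (Ici 0)) (hz : ContinuousOn z (Ici 0))
    (huT : u T = 0) (hvT : v T = 0) (hyT : y T = 0) (hzT : z T = 0)
    (hforce : ∀ w t, 0 ≤ t → HasDerivWithinAt (fun t => 𝒮.ρ (𝒮.T₀ (v t)) (𝒮.T₀ w))
      (𝒮.force (u t, y t, z t) w) (Ici 0) t)
    (hflux : ∀ w t, 0 ≤ t → HasDerivWithinAt (fun t => 𝒮.N (𝒮.P₀ (z t)) (𝒮.P₀ w))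
      (𝒮.flux (u t, v t, y t, z t) w) (Ici 0) t) :
    ∀ t ∈ Icc 0 T, 𝒮.T₀ (v t) = 0 ∧ 𝒮.P₀ (z t) = 0 := by
  obtain ⟨κ, hκ, h⟩ := 𝒮.exists_resolvent_bound
  obtain ⟨s₀, hs₀⟩ := h (u 0) (v 0) (y 0) (z 0)
  have huc : ContinuousOn u (Ici 0) := fun t ht => (hu t ht).continuousWithinAt
  have hyc : ContinuousOn y (Ici 0) := fun t ht => (hy t ht).continuousWithinAt
  have hyz := hyc.prodMk hz
  have huyz := huc.prodMk hyz
  have hvyz := hv.prodMk hyz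
  have huvyz := huc.prodMk hvyz
  have hT0 := hT.le
  have key : ∀ s, s₀ ≤ s → ‖𝒮.T₀ (laplaceRe κ s T v)‖ + ‖𝒮.T₀ (laplaceIm κ s T v)‖ ≤ 1 ∧
      ‖𝒮.P₀ (laplaceRe κ s T z)‖ + ‖𝒮.P₀ (laplaceIm κ s T z)‖ ≤ 1 := by
    intro s hs
    refine hs₀ s hs (laplaceRe κ s T u) (laplaceIm κ s T u) _ _ (laplaceRe κ s T y)
      (laplaceIm κ s T y) _ _ ⟨laplaceRe_deriv hT0 hu hv huT, laplaceIm_deriv hT0 hu hv huT,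
        laplaceRe_deriv hT0 hy hz hyT, laplaceIm_deriv hT0 hy hz hyT,
        fun w => ?_, fun w => ?_, fun w => ?_, fun w => ?_⟩
    -- For a fixed test element w only the scalar momentum is differentiated; the transform then
    -- passes through the bounded forms to the curves themselves.
    · have hc := (𝒮.force.flip w).continuous.comp_continuousOn huyz
      have e := laplaceRe_deriv (κ := κ) (s := s) hT0 (hforce w) hc (by simp [hvT])
      have r₁ := laplaceRe_clm (κ := κ) (s := s) ((𝒮.ρ.flip (𝒮.T₀ w)) ∘L 𝒮.T₀) hT0 hv
      have r₂ := laplaceIm_clm (κ := κ) (s := s) ((𝒮.ρ.flip (𝒮.T₀ w)) ∘L 𝒮.T₀) hT0 hv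
      have r₃ := laplaceRe_clm (κ := κ) (s := s) (𝒮.force.flip w) hT0 huyz
      rw [laplaceRe_prodMk hT0 huc hyz, laplaceRe_prodMk hT0 hyc hz] at r₃
      simp only [ContinuousLinearMap.comp_apply, ContinuousLinearMap.flip_apply] at r₁ r₂ r₃
      rw [r₁, r₂, r₃] at e
      exact e
    · have hc := (𝒮.force.flip w).continuous.comp_continuousOn huyz
      have e := laplaceIm_deriv (κ := κ) (s := s) hT0 (hforce w) hc (by simp [hvT])
      have r₁ := laplaceRe_clm (κ := κ) (s := s) ((𝒮.ρ.flip (𝒮.T₀ w)) ∘L 𝒮.T₀) hT0 hv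
      have r₂ := laplaceIm_clm (κ := κ) (s := s) ((𝒮.ρ.flip (𝒮.T₀ w)) ∘L 𝒮.T₀) hT0 hv
      have r₃ := laplaceIm_clm (κ := κ) (s := s) (𝒮.force.flip w) hT0 huyz
      rw [laplaceIm_prodMk hT0 huc hyz, laplaceIm_prodMk hT0 hyc hz] at r₃
      simp only [ContinuousLinearMap.comp_apply, ContinuousLinearMap.flip_apply] at r₁ r₂ r₃
      rw [r₁, r₂, r₃] at e
      exact e
    · have hc := (𝒮.flux.flip w).continuous.comp_continuousOn huvyz
      have e := laplaceRe_deriv (κ := κ) (s := s) hT0 (hflux w) hc (by simp [hzT])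
      have r₁ := laplaceRe_clm (κ := κ) (s := s) ((𝒮.N.flip (𝒮.P₀ w)) ∘L 𝒮.P₀) hT0 hz
      have r₂ := laplaceIm_clm (κ := κ) (s := s) ((𝒮.N.flip (𝒮.P₀ w)) ∘L 𝒮.P₀) hT0 hz
      have r₃ := laplaceRe_clm (κ := κ) (s := s) (𝒮.flux.flip w) hT0 huvyz
      rw [laplaceRe_prodMk hT0 huc hvyz, laplaceRe_prodMk hT0 hv hyz,
        laplaceRe_prodMk hT0 hyc hz] at r₃
      simp only [ContinuousLinearMap.comp_apply, ContinuousLinearMap.flip_apply] at r₁ r₂ r₃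
      rw [r₁, r₂, r₃] at e
      exact e
    · have hc := (𝒮.flux.flip w).continuous.comp_continuousOn huvyz
      have e := laplaceIm_deriv (κ := κ) (s := s) hT0 (hflux w) hc (by simp [hzT])
      have r₁ := laplaceRe_clm (κ := κ) (s := s) ((𝒮.N.flip (𝒮.P₀ w)) ∘L 𝒮.P₀) hT0 hz
      have r₂ := laplaceIm_clm (κ := κ) (s := s) ((𝒮.N.flip (𝒮.P₀ w)) ∘L 𝒮.P₀) hT0 hz
      have r₃ := laplaceIm_clm (κ := κ) (s := s) (𝒮.flux.flip w) hT0 huvyz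
      rw [laplaceIm_prodMk hT0 huc hvyz, laplaceIm_prodMk hT0 hv hyz,
        laplaceIm_prodMk hT0 hyc hz] at r₃
      simp only [ContinuousLinearMap.comp_apply, ContinuousLinearMap.flip_apply] at r₁ r₂ r₃
      rw [r₁, r₂, r₃] at e
      exact e
  exact fun t ht => ⟨eq_zero_of_laplace_bounded 𝒮.T₀ hT hκ hv (fun s hs => (key s hs).1) t ht,
    eq_zero_of_laplace_bounded 𝒮.P₀ hT hκ hz (fun s hs => (key s hs).2) t ht⟩

end DampedSystem

end DampedSystemVanishing

/-! ### Bilinear forms on L² with bounded weights. -/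

section WeightedPairing

open MeasureTheory Set Filter Topology
open scoped ENNReal

variable {α : Type*} [MeasurableSpace α] (μ : Measure α)

/-- The bilinear form `(f, g) ↦ ∫ a f g` on `L²`, for a bounded weight `a`. -/
noncomputable def weightedPairing (a : α → ℝ) : Lp ℝ 2 μ →L[ℝ] Lp ℝ 2 μ →L[ℝ] ℝ :=
  open Classical in
  if h : MemLp a ∞ μ then
    ((ContinuousLinearMap.mul ℝ ℝ).lpPairing μ 2 2) ∘L
      ((ContinuousLinearMap.mul ℝ ℝ).holderL μ ∞ 2 2 (h.toLp a))
  else 0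

variable {μ}

theorem weightedPairing_apply {a : α → ℝ} (h : MemLp a ∞ μ) (f g : Lp ℝ 2 μ) :
    weightedPairing μ a f g = ∫ x, a x * f x * g x ∂μ := by
  rw [weightedPairing, dif_pos h, ContinuousLinearMap.comp_apply,
    ContinuousLinearMap.lpPairing_eq_integral]
  refine integral_congr_ae ?_
  have h1 := (ContinuousLinearMap.mul ℝ ℝ).coeFn_holder (r := 2) (h.toLp a) f
  filter_upwards [h1, h.coeFn_toLp] with x hx hx'
  simp only [ContinuousLinearMap.mul_apply']
  change ((ContinuousLinearMap.mul ℝ ℝ).holder 2 (h.toLp a) f) x * g x = _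
  rw [hx, hx']
  rfl

theorem MeasureTheory.MemLp.bounded_mul {a f : α → ℝ} (h : MemLp a ∞ μ) (hf : MemLp f 2 μ) :
    MemLp (fun x => a x * f x) 2 μ :=
  hf.mul h

theorem integrable_weight_mul_mul {a : α → ℝ} (h : MemLp a ∞ μ) (f g : Lp ℝ 2 μ) :
    Integrable (fun x => a x * f x * g x) μ :=
  (h.bounded_mul (Lp.memLp f)).integrable_mul (Lp.memLp g)

variable {ι κ : Type*} [Fintype ι] [Fintype κ]

/-- The bilinear form `(f, g) ↦ ∫ ∑ i, ∑ k, a i k * f i * g k` on families of `L²` functions. -/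
noncomputable def formPairing (a : ι → κ → α → ℝ) :
    (ι → Lp ℝ 2 μ) →L[ℝ] (κ → Lp ℝ 2 μ) →L[ℝ] ℝ :=
  ∑ i, ∑ k, (weightedPairing μ (a i k)).bilinearComp (.proj i) (.proj k)

theorem formPairing_eq_sum (a : ι → κ → α → ℝ) (f : ι → Lp ℝ 2 μ) (g : κ → Lp ℝ 2 μ) :
    formPairing a f g = ∑ i, ∑ k, weightedPairing μ (a i k) (f i) (g k) := by
  simp [formPairing, sum_apply]

theorem integrable_formPairing {a : ι → κ → α → ℝ} (h : ∀ i k, MemLp (a i k) ∞ μ)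
    (f : ι → Lp ℝ 2 μ) (g : κ → Lp ℝ 2 μ) :
    Integrable (fun x => ∑ i, ∑ k, a i k x * f i x * g k x) μ :=
  integrable_finsetSum _ fun i _ => integrable_finsetSum _ fun k _ =>
    integrable_weight_mul_mul (h i k) (f i) (g k)

theorem formPairing_apply {a : ι → κ → α → ℝ} (h : ∀ i k, MemLp (a i k) ∞ μ)
    (f : ι → Lp ℝ 2 μ) (g : κ → Lp ℝ 2 μ) :
    formPairing a f g = ∫ x, ∑ i, ∑ k, a i k x * f i x * g k x ∂μ := by
  rw [formPairing_eq_sum, integral_finsetSum _ fun i _ => integrable_finsetSum _ fun k _ =>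
    integrable_weight_mul_mul (h i k) (f i) (g k)]
  refine Finset.sum_congr rfl fun i _ => ?_
  rw [integral_finsetSum _ fun k _ => integrable_weight_mul_mul (h i k) (f i) (g k)]
  exact Finset.sum_congr rfl fun k _ => weightedPairing_apply (h i k) _ _

theorem formPairing_symm {a : ι → ι → α → ℝ} (h : ∀ i k, MemLp (a i k) ∞ μ)
    (hs : ∀ᵐ x ∂μ, ∀ i k, a i k x = a k i x) (f g : ι → Lp ℝ 2 μ) :
    formPairing a f g = formPairing a g f := by
  rw [formPairing_apply h, formPairing_apply h]
  refine integral_congr_ae ?_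
  filter_upwards [hs] with x hx
  rw [Finset.sum_comm]
  refine Finset.sum_congr rfl fun i _ => Finset.sum_congr rfl fun k _ => ?_
  rw [hx k i]
  ring

theorem norm_Lp_two_sq (f : Lp ℝ 2 μ) : ‖f‖ * ‖f‖ = ∫ x, f x * f x ∂μ := by
  rw [← real_inner_self_eq_norm_mul_norm, L2.inner_def]
  rfl

theorem integrable_mul_self (f : Lp ℝ 2 μ) : Integrable (fun x => f x * f x) μ :=
  (Lp.memLp f).integrable_mul (Lp.memLp f)

/-- Families carry the sup norm, which is at most the Euclidean one; pointwise coercivity constants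
therefore pass to the forms unchanged. -/
theorem norm_mul_norm_le_integral_sum (f : ι → Lp ℝ 2 μ) :
    ‖f‖ * ‖f‖ ≤ ∫ x, ∑ i, f i x * f i x ∂μ := by
  have h0 : 0 ≤ ∫ x, ∑ i, f i x * f i x ∂μ :=
    integral_nonneg fun x => Finset.sum_nonneg fun i _ => mul_self_nonneg _
  have h1 : ‖f‖ ≤ √(∫ x, ∑ i, f i x * f i x ∂μ) := by
    refine (pi_norm_le_iff_of_nonneg (Real.sqrt_nonneg _)).2 fun i => Real.le_sqrt_of_sq_le ?_
    rw [sq, norm_Lp_two_sq]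
    refine integral_mono (integrable_mul_self _)
      (integrable_finsetSum _ fun i _ => integrable_mul_self _) fun x => ?_
    exact Finset.single_le_sum (f := fun i => f i x * f i x)
      (fun i _ => mul_self_nonneg _) (Finset.mem_univ i)
  exact (mul_self_le_mul_self (norm_nonneg _) h1).trans (Real.mul_self_sqrt h0).le

theorem isCoercive_formPairing {a : ι → ι → α → ℝ} (h : ∀ i k, MemLp (a i k) ∞ μ) {c : ℝ}
    (hc : 0 < c)
    (hpos : ∀ᵐ x ∂μ, ∀ ξ : ι → ℝ, c * ∑ i, ξ i * ξ i ≤ ∑ i, ∑ k, a i k x * ξ i * ξ k) :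
    IsCoercive (formPairing (μ := μ) a) := by
  refine ⟨c, hc, fun f => ?_⟩
  rw [formPairing_apply h, mul_assoc]
  refine (mul_le_mul_of_nonneg_left (norm_mul_norm_le_integral_sum f) hc.le).trans ?_
  rw [← integral_const_mul]
  refine integral_mono_ae ((integrable_finsetSum _ fun i _ => integrable_mul_self _).const_mul c)
    (integrable_formPairing h f f) ?_
  filter_upwards [hpos] with x hx
  exact hx fun i => f i x

end WeightedPairing

/-! ### Uniform positivity of quadratic forms over compact sets. -/

section UniformPositivity

open Set Filter Topology

/-- A continuous family of positive definite quadratic forms over a compact set is uniformly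
positive definite. -/
theorem IsCompact.exists_forall_mul_norm_sq_le {X E : Type*} [TopologicalSpace X]
    [NormedAddCommGroup E] [NormedSpace ℝ E] [FiniteDimensional ℝ E] {s : Set X} (hs : IsCompact s)
    {q : X → E → ℝ} (hq : ContinuousOn (fun p : X × E => q p.1 p.2) (s ×ˢ univ))
    (hsmul : ∀ x (r : ℝ) ξ, q x (r • ξ) = r ^ 2 * q x ξ)
    (hpos : ∀ x ∈ s, ∀ ξ, ξ ≠ 0 → 0 < q x ξ) :
    ∃ c, 0 < c ∧ ∀ x ∈ s, ∀ ξ, c * ‖ξ‖ ^ 2 ≤ q x ξ := by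
  have hcomp : IsCompact (s ×ˢ Metric.sphere (0 : E) 1) := hs.prod (isCompact_sphere 0 1)
  obtain ⟨c, hc, hle⟩ : ∃ c, 0 < c ∧ ∀ p ∈ s ×ˢ Metric.sphere (0 : E) 1, c ≤ q p.1 p.2 := by
    -- The product is empty when s is empty or E is trivial; otherwise the minimum over s times the
    -- unit sphere is positive, and homogeneity does the rest.
    rcases (s ×ˢ Metric.sphere (0 : E) 1).eq_empty_or_nonempty with he | hne
    · exact ⟨1, one_pos, fun p hp => by simp [he] at hp⟩
    · obtain ⟨p, hp, hmin⟩ := hcomp.exists_isMinOn hne (hq.mono (prod_mono_right (subset_univ _)))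
      refine ⟨q p.1 p.2, hpos _ hp.1 _ fun h0 => ?_, fun p' hp' => hmin hp'⟩
      have := hp.2
      rw [h0] at this
      simp at this
  refine ⟨c, hc, fun x hx ξ => ?_⟩
  rcases eq_or_ne ξ 0 with rfl | hξ
  · have := hsmul x 0 0
    simp only [zero_smul] at this
    rw [this]
    simp
  · have hn : ‖ξ‖ ≠ 0 := norm_ne_zero_iff.2 hξ
    have h1 := hle (x, ‖ξ‖⁻¹ • ξ) ⟨hx, by simp [norm_smul, hn]⟩
    have h2 : q x ξ = ‖ξ‖ ^ 2 * q x (‖ξ‖⁻¹ • ξ) := by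
      rw [← hsmul, smul_smul, mul_inv_cancel₀ hn, one_smul]
    rw [h2, mul_comm]
    exact mul_le_mul_of_nonneg_left h1 (sq_nonneg _)

/-- Uniform positive definiteness, over a compact set, of a matrix with continuous entries. -/
theorem IsCompact.exists_forall_mul_sum_le {X ι : Type*} [TopologicalSpace X] [Fintype ι]
    {s : Set X} (hs : IsCompact s) {a : ι → ι → X → ℝ} (ha : ∀ i k, ContinuousOn (a i k) s)
    (hpos : ∀ x ∈ s, ∀ ξ : ι → ℝ, ξ ≠ 0 → 0 < ∑ i, ∑ k, a i k x * ξ i * ξ k) :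
    ∃ c, 0 < c ∧ ∀ x ∈ s, ∀ ξ : ι → ℝ,
      c * ∑ i, ξ i * ξ i ≤ ∑ i, ∑ k, a i k x * ξ i * ξ k := by
  have hq : ContinuousOn (fun p : X × (ι → ℝ) => ∑ i, ∑ k, a i k p.1 * p.2 i * p.2 k)
      (s ×ˢ univ) := by
    refine continuousOn_finsetSum _ fun i _ => continuousOn_finsetSum _ fun k _ => ?_
    have h1 : ContinuousOn (fun p : X × (ι → ℝ) => a i k p.1) (s ×ˢ univ) :=
      (ha i k).comp continuousOn_fst fun p hp => hp.1
    exact (h1.mul (by fun_prop)).mul (by fun_prop)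
  obtain ⟨c, hc, h⟩ := hs.exists_forall_mul_norm_sq_le
    (q := fun x (ξ : ι → ℝ) => ∑ i, ∑ k, a i k x * ξ i * ξ k) hq (fun x r ξ => by
      simp only [Finset.mul_sum, Pi.smul_apply, smul_eq_mul]
      exact Finset.sum_congr rfl fun i _ => Finset.sum_congr rfl fun k _ => by ring) hpos
  -- The cardinality compares the Euclidean with the sup norm; the added one keeps the denominator
  -- positive for an empty index set.
  refine ⟨c / (Fintype.card ι + 1), by positivity, fun x hx ξ => le_trans ?_ (h x hx ξ)⟩
  have h1 : ∑ i, ξ i * ξ i ≤ (Fintype.card ι + 1) * ‖ξ‖ ^ 2 := by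
    have h2 : ∑ i, ξ i * ξ i ≤ ∑ _i : ι, ‖ξ‖ ^ 2 := by
      refine Finset.sum_le_sum fun i _ => ?_
      have := norm_le_pi_norm ξ i
      rw [← sq, ← sq_abs]
      exact pow_le_pow_left₀ (abs_nonneg _) this 2
    simp only [Finset.sum_const, Finset.card_univ, nsmul_eq_mul] at h2
    linarith [sq_nonneg ‖ξ‖]
  rw [div_mul_eq_mul_div, div_le_iff₀ (by positivity), mul_assoc, mul_comm (‖ξ‖ ^ 2)]
  exact mul_le_mul_of_nonneg_left h1 hc.le

end UniformPositivity

/-! ### W₀^{1,2}: weighted integration by parts and injectivity into L². -/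

namespace TypeIII

open MeasureTheory Set Filter Topology TopologicalSpace
open scoped Distributions ENNReal ContDiff

variable {Ω : Opens Space}

instance : CompleteSpace (W120 Ω) :=
  (Submodule.isClosed_topologicalClosure (testGraph Ω)).completeSpace_coe

/-- The inclusion `W₀^{1,2}(Ω) → L²(Ω)` as a continuous linear map. -/
noncomputable def toL2L (Ω : Opens Space) : W120 Ω →L[ℝ] L2 Ω :=
  .fst ℝ _ _ ∘L (W120 Ω).subtypeL

/-- The weak partial derivative as a continuous linear map. -/
noncomputable def gradL (Ω : Opens Space) (j : Fin 3) : W120 Ω →L[ℝ] L2 Ω :=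
  .proj j ∘L .snd ℝ (L2 Ω) (Fin 3 → L2 Ω) ∘L (W120 Ω).subtypeL

theorem memLp_top_of_continuousOn (hΩ : Bornology.IsBounded (Ω : Set Space)) {a : Space → ℝ}
    (ha : ContinuousOn a (closure Ω)) : MemLp a ∞ (volume.restrict (Ω : Set Space)) := by
  obtain ⟨C, hC⟩ := hΩ.isCompact_closure.exists_bound_of_continuousOn ha
  refine memLp_top_of_bound ((ha.mono subset_closure).aestronglyMeasurable Ω.isOpen.measurableSet)
    C ((ae_restrict_mem Ω.isOpen.measurableSet).mono fun x hx => hC x (subset_closure hx))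

/-- The boundary is arbitrary, so derivatives at boundary points need not be unique. Near each point
of the closure some derivative field relative to the closure is still locally bounded; on Ω it
agrees with `fderiv`, and compactness makes the bound global. -/
theorem exists_fderiv_bound (hΩ : Bornology.IsBounded (Ω : Set Space)) {a : Space → ℝ}
    (ha : ContDiffOn ℝ 1 a (closure Ω)) : ∃ C, ∀ x ∈ Ω, ‖fderiv ℝ a x‖ ≤ C := by
  have hnear : ∀ x ∈ closure (Ω : Set Space), ∃ t ∈ 𝓝[closure (Ω : Set Space)] x,
      ∃ C, ∀ y ∈ t ∩ Ω, ‖fderiv ℝ a y‖ ≤ C := by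
    intro x hx
    obtain ⟨u, hu, -, -, a', ha', hc⟩ :=
      (contDiffWithinAt_succ_iff_hasFDerivWithinAt' (n := 0) (by simp)).1 (by simpa using ha x hx)
    rw [insert_eq_of_mem hx] at hu
    have hb := hc.continuousWithinAt.norm.eventually_lt_const (lt_add_one ‖a' x‖)
    refine ⟨_, inter_mem hu hb, ‖a' x‖ + 1, fun y hy => ?_⟩
    have h1 : HasFDerivAt a (a' y) y := (ha' y hy.1.1).hasFDerivAt
      (mem_of_superset (Ω.isOpen.mem_nhds hy.2) subset_closure)
    rw [h1.fderiv]
    exact le_of_lt hy.1.2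
  obtain ⟨C, hC⟩ := hΩ.isCompact_closure.induction_on
    (p := fun t => ∃ C, ∀ y ∈ t ∩ (Ω : Set Space), ‖fderiv ℝ a y‖ ≤ C)
    ⟨0, by simp⟩ (fun s t hst ⟨C, hC⟩ => ⟨C, fun y hy => hC y ⟨hst hy.1, hy.2⟩⟩)
    (fun s t ⟨C, hC⟩ ⟨C', hC'⟩ => ⟨max C C', by
      rintro y ⟨hy | hy, hyΩ⟩
      · exact (hC y ⟨hy, hyΩ⟩).trans (le_max_left _ _)
      · exact (hC' y ⟨hy, hyΩ⟩).trans (le_max_right _ _)⟩) hnear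
  exact ⟨C, fun x hx => hC x ⟨subset_closure hx, hx⟩⟩

theorem integral_mul_fderiv_eq_neg_of_tsupport_subset {a : Space → ℝ} (ha : ContDiffOn ℝ 1 a Ω) {χ : Space → ℝ}
    (hχ : ContDiff ℝ 1 χ) (hχc : HasCompactSupport χ) (hχΩ : tsupport χ ⊆ Ω) (v : Space) :
    ∫ x, a x * fderiv ℝ χ x v = -∫ x, fderiv ℝ a x v * χ x := by
  have hda : ContinuousOn (fderiv ℝ a) Ω :=
    ha.continuousOn_fderiv_of_isOpen Ω.isOpen le_rfl
  have hdχ : Continuous fun x => fderiv ℝ χ x v :=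
    (hχ.continuous_fderiv one_ne_zero).clm_apply continuous_const
  have hsupp : tsupport (fun x => fderiv ℝ χ x v) ⊆ tsupport χ :=
    (tsupport_fderiv_apply_subset ℝ v)
  have key : ∀ {b c : Space → ℝ}, ContinuousOn b Ω → Continuous c → tsupport c ⊆ tsupport χ →
      Integrable fun x => b x * c x := by
    intro b c hb hc hcs
    have hs : tsupport (fun x => b x * c x) ⊆ tsupport c := tsupport_mul_subset_right
    refine Continuous.integrable_of_hasCompactSupport ?_
      (hχc.mono' ((subset_tsupport _).trans (hs.trans hcs)))
    exact (hb.mul hc.continuousOn).continuous_of_tsupport_subset Ω.isOpen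
      (hs.trans (hcs.trans hχΩ))
  refine integral_mul_fderiv_eq_neg_fderiv_mul_of_integrable ?_ ?_ ?_ ?_ ?_
  · exact key (hda.clm_apply continuousOn_const) hχ.continuous subset_rfl
  · exact key ha.continuousOn hdχ hsupp
  · exact key ha.continuousOn hχ.continuous subset_rfl
  · exact fun x hx => (ha.contDiffAt (Ω.isOpen.mem_nhds (hχΩ hx))).differentiableAt one_ne_zero
  · exact fun x _ => hχ.differentiable one_ne_zero x

theorem memLp_of_continuous_of_hasCompactSupport {χ : Space → ℝ} (hχ : Continuous χ)
    (hχc : HasCompactSupport χ) : MemLp χ 2 (volume.restrict (Ω : Set Space)) :=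
  (hχ.memLp_of_hasCompactSupport hχc).restrict _

theorem exists_mem_testGraph (φ : 𝓓(Ω, ℝ)) : ∃ f : W120 Ω,
    (toL2 f : Space → ℝ) =ᵐ[volume.restrict (Ω : Set Space)] φ := by
  have hφ : ContDiff ℝ 1 φ := φ.contDiff.of_le (by simp)
  have h0 : MemLp φ 2 (volume.restrict (Ω : Set Space)) :=
    memLp_of_continuous_of_hasCompactSupport φ.continuous φ.hasCompactSupport
  have h1 : ∀ j, MemLp (partialDeriv j φ) 2 (volume.restrict (Ω : Set Space)) := fun j =>
    memLp_of_continuous_of_hasCompactSupport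
      ((hφ.continuous_fderiv one_ne_zero).clm_apply continuous_const)
      (φ.hasCompactSupport.fderiv_apply ℝ _)
  exact ⟨⟨(h0.toLp, fun j => (h1 j).toLp), Submodule.le_topologicalClosure _
    ⟨φ, h0.coeFn_toLp, fun j => (h1 j).coeFn_toLp⟩⟩, h0.coeFn_toLp⟩

theorem abs_weightedPairing_le {a : Space → ℝ} {C : ℝ}
    (ha : AEStronglyMeasurable a (volume.restrict (Ω : Set Space)))
    (hC : ∀ x ∈ Ω, |a x| ≤ C) (f g : L2 Ω) :
    |∫ x in (Ω : Set Space), a x * f x * g x| ≤ C * (‖f‖ * ‖g‖) := by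
  have hatop : MemLp a ∞ (volume.restrict (Ω : Set Space)) := memLp_top_of_bound ha C
    ((ae_restrict_mem Ω.isOpen.measurableSet).mono fun x hx => hC x hx)
  set af := (hatop.bounded_mul (Lp.memLp f)).toLp with haf
  have h1 : ∫ x in (Ω : Set Space), a x * f x * g x = inner ℝ g af := by
    rw [L2.inner_def]
    refine integral_congr_ae ?_
    filter_upwards [(hatop.bounded_mul (Lp.memLp f)).coeFn_toLp] with x hx
    rw [haf, hx]
    rfl
  have h2 : ‖af‖ ≤ C * ‖f‖ := by
    refine Lp.norm_le_mul_norm_of_ae_le_mul ?_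
    filter_upwards [(hatop.bounded_mul (Lp.memLp f)).coeFn_toLp,
      ae_restrict_mem Ω.isOpen.measurableSet] with x hx hxΩ
    rw [haf, hx, norm_mul]
    exact mul_le_mul_of_nonneg_right (hC x hxΩ) (norm_nonneg _)
  rw [h1]
  refine (abs_real_inner_le_norm _ _).trans ?_
  rw [← mul_assoc, mul_comm]
  exact mul_le_mul_of_nonneg_right h2 (norm_nonneg _)

/-- For test functions the sum equals -∫ a_{,j} f g, which involves only L² norms. Both uses need
just the inequality: the thermal coupling bound, and with a = 1 the fact that f determines its weak
gradient. -/
theorem abs_weightedPairing_grad_add_le (hΩ : Bornology.IsBounded (Ω : Set Space)) {a : Space → ℝ}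
    (ha : ContDiffOn ℝ 1 a (closure Ω)) : ∃ C, 0 ≤ C ∧ ∀ (f g : W120 Ω) (j : Fin 3),
    |weightedPairing (volume.restrict (Ω : Set Space)) a (grad f j) (toL2 g)
      + weightedPairing (volume.restrict (Ω : Set Space)) a (toL2 f) (grad g j)|
      ≤ C * (‖toL2 f‖ * ‖toL2 g‖) := by
  obtain ⟨C, hC⟩ := exists_fderiv_bound hΩ ha
  have haΩ : ContDiffOn ℝ 1 a Ω := ha.mono subset_closure
  have hatop := memLp_top_of_continuousOn hΩ ha.continuousOn
  set P := weightedPairing (volume.restrict (Ω : Set Space)) a with hP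
  refine ⟨|C|, abs_nonneg C, ?_⟩
  have htest : ∀ p ∈ testGraph Ω, ∀ q ∈ testGraph Ω, ∀ j : Fin 3,
      |P (p.2 j) q.1 + P p.1 (q.2 j)| ≤ |C| * (‖p.1‖ * ‖q.1‖) := by
    rintro p ⟨φ, hφ, hφ'⟩ q ⟨ψ, hψ, hψ'⟩ j
    set e : Space := EuclideanSpace.single j 1
    have dφ : Differentiable ℝ φ := φ.contDiff.differentiable (by simp)
    have dψ : Differentiable ℝ ψ := ψ.contDiff.differentiable (by simp)
    have hχ : ContDiff ℝ 1 fun x => φ x * ψ x :=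
      (φ.contDiff.of_le (by simp)).mul (ψ.contDiff.of_le (by simp))
    have hs : tsupport (fun x => φ x * ψ x) ⊆ Ω :=
      tsupport_mul_subset_left.trans φ.tsupport_subset
    have hparts := integral_mul_fderiv_eq_neg_of_tsupport_subset haΩ hχ
      φ.hasCompactSupport.mul_right hs e
    have hout : ∀ x, x ∉ (Ω : Set Space) → φ x * ψ x = 0 := fun x hx =>
      image_eq_zero_of_notMem_tsupport (f := fun x => φ x * ψ x) fun h => hx (hs h)
    have hout' : ∀ x, x ∉ (Ω : Set Space) → fderiv ℝ (fun x => φ x * ψ x) x e = 0 := fun x hx =>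
      image_eq_zero_of_notMem_tsupport (f := fun x => fderiv ℝ (fun x => φ x * ψ x) x e)
        fun h => hx (hs (tsupport_fderiv_apply_subset ℝ e h))
    rw [← setIntegral_eq_integral_of_forall_compl_eq_zero (s := Ω) (μ := volume)
        (f := fun x => a x * fderiv ℝ (fun x => φ x * ψ x) x e)
        (fun x hx => by rw [hout' x hx, mul_zero]),
      ← setIntegral_eq_integral_of_forall_compl_eq_zero (s := Ω) (μ := volume)
        (f := fun x => fderiv ℝ a x e * (φ x * ψ x))
        (fun x hx => by rw [hout x hx, mul_zero])] at hparts
    have e1 : P (p.2 j) q.1 + P p.1 (q.2 j)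
        = ∫ x in (Ω : Set Space), a x * fderiv ℝ (fun x => φ x * ψ x) x e := by
      rw [hP, weightedPairing_apply hatop, weightedPairing_apply hatop,
        ← integral_add (integrable_weight_mul_mul hatop _ _) (integrable_weight_mul_mul hatop _ _)]
      refine integral_congr_ae ?_
      filter_upwards [hφ, hφ' j, hψ, hψ' j] with x h1 h2 h3 h4
      rw [h1, h2, h3, h4, fderiv_fun_mul (dφ x) (dψ x)]
      simp only [partialDeriv, add_apply, smul_apply, smul_eq_mul]
      ring
    have e2 : ∫ x in (Ω : Set Space), fderiv ℝ a x e * (φ x * ψ x)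
        = ∫ x in (Ω : Set Space), fderiv ℝ a x e * p.1 x * q.1 x := by
      refine integral_congr_ae ?_
      filter_upwards [hφ, hψ] with x h1 h3
      rw [h1, h3]
      ring
    rw [e1, hparts, abs_neg, e2]
    refine abs_weightedPairing_le ?_ (fun x hx => ?_) _ _
    · exact ((haΩ.continuousOn_fderiv_of_isOpen Ω.isOpen le_rfl).clm_apply
        continuousOn_const).aestronglyMeasurable Ω.isOpen.measurableSet
    · refine ((fderiv ℝ a x).le_opNorm e).trans ?_
      have : ‖e‖ = 1 := by simp [e]
      rw [this, mul_one]
      exact (hC x hx).trans (le_abs_self _)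
  intro f g j
  -- Both sides are continuous in the pairs (f, ∇f), (g, ∇g), so the estimate passes from test
  -- functions to their closure.
  have hclosed : IsClosed {r : (L2 Ω × (Fin 3 → L2 Ω)) × (L2 Ω × (Fin 3 → L2 Ω)) |
      |P (r.1.2 j) r.2.1 + P r.1.1 (r.2.2 j)| ≤ |C| * (‖r.1.1‖ * ‖r.2.1‖)} := by
    refine isClosed_le (Continuous.abs (Continuous.add ?_ ?_)) (by fun_prop)
    · exact P.isBoundedBilinearMap.continuous.comp
        (f := fun r : (L2 Ω × (Fin 3 → L2 Ω)) × (L2 Ω × (Fin 3 → L2 Ω)) => (r.1.2 j, r.2.1))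
        (by fun_prop)
    · exact P.isBoundedBilinearMap.continuous.comp
        (f := fun r : (L2 Ω × (Fin 3 → L2 Ω)) × (L2 Ω × (Fin 3 → L2 Ω)) => (r.1.1, r.2.2 j))
        (by fun_prop)
  have hmem : (f.1, g.1) ∈ closure ((testGraph Ω : Set _) ×ˢ (testGraph Ω : Set _)) := by
    rw [closure_prod_eq]
    exact ⟨f.2, g.2⟩
  exact closure_minimal (fun r hr => htest r.1 hr.1 r.2 hr.2 j) hclosed hmem

/-- With a = 1 and f = 0 in L², integration by parts makes each stored derivative orthogonal to all
smooth compactly supported functions in Ω, hence zero. -/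
theorem eq_zero_of_toL2_eq_zero (hΩ : Bornology.IsBounded (Ω : Set Space)) {f : W120 Ω}
    (hf : toL2 f = 0) : f = 0 := by
  have hone : MemLp (fun _ : Space => (1 : ℝ)) ∞ (volume.restrict (Ω : Set Space)) :=
    memLp_top_of_continuousOn hΩ continuousOn_const
  obtain ⟨C, -, hC⟩ := abs_weightedPairing_grad_add_le hΩ
    (a := fun _ => 1) contDiffOn_const
  have : IsFiniteMeasure (volume.restrict (Ω : Set Space)) :=
    ⟨by simpa using hΩ.measure_lt_top⟩
  have hgrad : ∀ j, grad f j = 0 := by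
    intro j
    have hint : IntegrableOn (grad f j) (Ω : Set Space) :=
      (Lp.memLp (grad f j)).integrable (by norm_num)
    rw [Lp.eq_zero_iff_ae_eq_zero]
    refine (ae_restrict_iff' Ω.isOpen.measurableSet).2 ?_
    refine Ω.isOpen.ae_eq_zero_of_integral_contDiff_smul_eq_zero hint.locallyIntegrableOn
      fun χ hχ hχc hχΩ => ?_
    obtain ⟨g, hg⟩ := exists_mem_testGraph (Ω := Ω) ⟨χ, hχ, hχc, hχΩ⟩
    have h1 := hC f g j
    rw [hf, norm_zero, zero_mul, mul_zero, map_zero, zero_apply, add_zero,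
      weightedPairing_apply hone] at h1
    have h2 := abs_nonpos_iff.1 h1
    rw [← setIntegral_eq_integral_of_forall_compl_eq_zero (s := Ω) (fun x hx => by
      rw [image_eq_zero_of_notMem_tsupport fun h => hx (hχΩ h), zero_smul]), ← h2]
    refine integral_congr_ae ?_
    filter_upwards [hg] with x hx
    rw [hx, smul_eq_mul, one_mul, mul_comm]
    rfl
  exact Subtype.ext (Prod.ext hf (funext hgrad))

end TypeIII

/-! ### The type III system as an abstract damped system. -/

namespace TypeIII

open MeasureTheory Set Filter Topology TopologicalSpace
open scoped Distributions ENNReal ContDiff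

variable {Ω : Opens Space}

/-- The values of a displacement field. -/
noncomputable def valueU (Ω : Opens Space) : (Fin 3 → W120 Ω) →L[ℝ] (Fin 3 → L2 Ω) :=
  .pi fun i => toL2L Ω ∘L .proj i

/-- The linear strain as a continuous linear map. -/
noncomputable def strainL (Ω : Opens Space) :
    (Fin 3 → W120 Ω) →L[ℝ] (Fin 3 × Fin 3 → L2 Ω) :=
  .pi fun p => (2⁻¹ : ℝ) • (gradL Ω p.2 ∘L .proj p.1 + gradL Ω p.1 ∘L .proj p.2)

/-- The values of a temperature and a microtemperature field. -/
noncomputable def valueZ (Ω : Opens Space) :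
    W120 Ω × (Fin 3 → W120 Ω) →L[ℝ] (Unit ⊕ Fin 3 → L2 Ω) :=
  .pi (Sum.elim (fun _ => toL2L Ω ∘L .fst ℝ (W120 Ω) (Fin 3 → W120 Ω))
    fun i => toL2L Ω ∘L .proj i ∘L .snd ℝ (W120 Ω) (Fin 3 → W120 Ω))

/-- The gradients of a temperature and a microtemperature field. -/
noncomputable def gradZ (Ω : Opens Space) :
    W120 Ω × (Fin 3 → W120 Ω) →L[ℝ] (Fin 3 ⊕ Fin 3 × Fin 3 → L2 Ω) :=
  .pi (Sum.elim (fun i => gradL Ω i ∘L .fst ℝ (W120 Ω) (Fin 3 → W120 Ω))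
    fun p => gradL Ω p.2 ∘L .proj p.1 ∘L .snd ℝ (W120 Ω) (Fin 3 → W120 Ω))

/-- The value of the temperature field. -/
noncomputable def temperature (Ω : Opens Space) :
    W120 Ω × (Fin 3 → W120 Ω) →L[ℝ] (Unit → L2 Ω) :=
  .pi fun _ => toL2L Ω ∘L .fst ℝ (W120 Ω) (Fin 3 → W120 Ω)

theorem valueU_apply (u : Fin 3 → W120 Ω) (i : Fin 3) : valueU Ω u i = toL2 (u i) := rfl

theorem temperature_apply (z : W120 Ω × (Fin 3 → W120 Ω)) (i : Unit) :
    temperature Ω z i = toL2 z.1 := rfl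

theorem valueZ_inl (z : W120 Ω × (Fin 3 → W120 Ω)) (i : Unit) :
    valueZ Ω z (.inl i) = toL2 z.1 := rfl

theorem valueZ_inr (z : W120 Ω × (Fin 3 → W120 Ω)) (i : Fin 3) :
    valueZ Ω z (.inr i) = toL2 (z.2 i) := rfl

theorem gradZ_inl (z : W120 Ω × (Fin 3 → W120 Ω)) (i : Fin 3) :
    gradZ Ω z (.inl i) = grad z.1 i := rfl

theorem gradZ_inr (z : W120 Ω × (Fin 3 → W120 Ω)) (p : Fin 3 × Fin 3) :
    gradZ Ω z (.inr p) = grad (z.2 p.1) p.2 := rfl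

theorem strainL_apply (u : Fin 3 → W120 Ω) (p : Fin 3 × Fin 3) :
    strainL Ω u p = (2⁻¹ : ℝ) • (grad (u p.1) p.2 + grad (u p.2) p.1) := rfl

theorem coeFn_strainL (u : Fin 3 → W120 Ω) :
    ∀ᵐ x ∂volume.restrict (Ω : Set Space), ∀ p : Fin 3 × Fin 3,
      strainL Ω u p x = strain u p.1 p.2 x := by
  refine ae_all_iff.2 fun p => ?_
  rw [strainL_apply]
  filter_upwards [Lp.coeFn_smul (2⁻¹ : ℝ) (grad (u p.1) p.2 + grad (u p.2) p.1),
    Lp.coeFn_add (grad (u p.1) p.2) (grad (u p.2) p.1)] with x h1 h2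
  rw [h1, Pi.smul_apply, h2, Pi.add_apply, strain, smul_eq_mul, inv_mul_eq_div]

namespace Coefficients

-- A gradient index (i, j) means derivative j of component i. In the weights below the first index
-- belongs to the test field and the second to the state, and the `flip`s in `dampedSystem` put the
-- state first; `thermalStress` serves both equations, with strain first and temperature second.
variable (m : Coefficients)

/-- Inertia of the displacement. -/
def inertiaU (i j : Fin 3) (x : Space) : ℝ := if i = j then m.ρ x else 0

/-- Elastic stiffness. -/
def elasticity (p q : Fin 3 × Fin 3) (x : Space) : ℝ := m.A x p.2 p.1 q.1 q.2

/-- Inertia of temperature and microtemperatures. -/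
def inertiaZ : Unit ⊕ Fin 3 → Unit ⊕ Fin 3 → Space → ℝ
  | .inl _, .inl _ => m.c
  | .inr i, .inr j => fun x => m.cc x i j
  | _, _ => 0

/-- Dissipation of the gradients of temperature and microtemperatures. -/
def dissipation : Fin 3 ⊕ Fin 3 × Fin 3 → Fin 3 ⊕ Fin 3 × Fin 3 → Space → ℝ
  | .inl i, .inl j => fun x => m.Kt x i j
  | .inr p, .inr q => fun x => m.Ct x p.2 p.1 q.1 q.2
  | _, _ => 0

/-- Conduction, the conservative counterpart of `dissipation`. -/
def conduction : Fin 3 ⊕ Fin 3 × Fin 3 → Fin 3 ⊕ Fin 3 × Fin 3 → Space → ℝ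
  | .inl i, .inl j => fun x => m.K x i j
  | .inr p, .inr q => fun x => m.C x p.2 p.1 q.1 q.2
  | _, _ => 0

/-- Thermal stress. -/
def thermalStress (p : Fin 3 × Fin 3) (_ : Unit) (x : Space) : ℝ := m.a x p.2 p.1

/-- Coupling of test gradients with the values of temperature and microtemperatures. -/
def gradCoupling : Fin 3 ⊕ Fin 3 × Fin 3 → Unit ⊕ Fin 3 → Space → ℝ
  | .inl i, .inr j => fun x => -m.d x i j
  | .inr p, .inl _ => fun x => -m.b x p.2 p.1
  | _, _ => 0

/-- Coupling of test values with the gradients of temperature and microtemperatures. -/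
def valueCoupling : Unit ⊕ Fin 3 → Fin 3 ⊕ Fin 3 × Fin 3 → Space → ℝ
  | .inl _, .inr q => fun x => m.b x q.1 q.2
  | .inr i, .inl j => fun x => m.d x i j
  | _, _ => 0

/-- Coupling of test strains with the microtemperature gradients. -/
def strainCoupling : Fin 3 × Fin 3 → Fin 3 ⊕ Fin 3 × Fin 3 → Space → ℝ
  | p, .inr q => fun x => m.B x p.2 p.1 q.2 q.1
  | _, _ => 0

/-- Coupling of test microtemperature gradients with the strain. -/
def microCoupling : Fin 3 ⊕ Fin 3 × Fin 3 → Fin 3 × Fin 3 → Space → ℝ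
  | .inr p, q => fun x => m.B x q.1 q.2 p.2 p.1
  | _, _ => 0

variable {m}

theorem contDiffOn_entry₂ {a : Space → Fin 3 → Fin 3 → ℝ} {s : Set Space}
    (h : ContDiffOn ℝ 1 a s) (i j : Fin 3) : ContDiffOn ℝ 1 (fun x => a x i j) s :=
  contDiffOn_pi.1 (contDiffOn_pi.1 h i) j

theorem contDiffOn_entry₄ {a : Space → Fin 3 → Fin 3 → Fin 3 → Fin 3 → ℝ} {s : Set Space}
    (h : ContDiffOn ℝ 1 a s) (i j k l : Fin 3) : ContDiffOn ℝ 1 (fun x => a x i j k l) s :=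
  contDiffOn_entry₂ (contDiffOn_pi.1 (contDiffOn_pi.1 h i) j) k l

namespace Regular

theorem continuousOn_inertiaU (h : m.Regular Ω) (i j : Fin 3) :
    ContinuousOn (m.inertiaU i j) (closure Ω) := by
  unfold inertiaU
  split_ifs
  exacts [h.ρ.continuousOn, continuousOn_const]

theorem continuousOn_elasticity (h : m.Regular Ω) (p q : Fin 3 × Fin 3) :
    ContinuousOn (m.elasticity p q) (closure Ω) :=
  (contDiffOn_entry₄ h.A _ _ _ _).continuousOn

theorem continuousOn_inertiaZ (h : m.Regular Ω) : ∀ i j,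
    ContinuousOn (m.inertiaZ i j) (closure Ω)
  | .inl _, .inl _ => h.c.continuousOn
  | .inr _, .inr _ => (contDiffOn_entry₂ h.cc _ _).continuousOn
  | .inl _, .inr _ => continuousOn_const
  | .inr _, .inl _ => continuousOn_const

theorem continuousOn_dissipation (h : m.Regular Ω) : ∀ i j,
    ContinuousOn (m.dissipation i j) (closure Ω)
  | .inl _, .inl _ => (contDiffOn_entry₂ h.Kt _ _).continuousOn
  | .inr _, .inr _ => (contDiffOn_entry₄ h.Ct _ _ _ _).continuousOn
  | .inl _, .inr _ => continuousOn_const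
  | .inr _, .inl _ => continuousOn_const

theorem continuousOn_conduction (h : m.Regular Ω) : ∀ i j,
    ContinuousOn (m.conduction i j) (closure Ω)
  | .inl _, .inl _ => (contDiffOn_entry₂ h.K _ _).continuousOn
  | .inr _, .inr _ => (contDiffOn_entry₄ h.C _ _ _ _).continuousOn
  | .inl _, .inr _ => continuousOn_const
  | .inr _, .inl _ => continuousOn_const

theorem continuousOn_thermalStress (h : m.Regular Ω) (p : Fin 3 × Fin 3) (i : Unit) :
    ContinuousOn (m.thermalStress p i) (closure Ω) :=
  (contDiffOn_entry₂ h.a _ _).continuousOn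

theorem continuousOn_gradCoupling (h : m.Regular Ω) : ∀ i j,
    ContinuousOn (m.gradCoupling i j) (closure Ω)
  | .inl _, .inr _ => (contDiffOn_entry₂ h.d _ _).continuousOn.neg
  | .inr _, .inl _ => (contDiffOn_entry₂ h.b _ _).continuousOn.neg
  | .inl _, .inl _ => continuousOn_const
  | .inr _, .inr _ => continuousOn_const

theorem continuousOn_valueCoupling (h : m.Regular Ω) : ∀ i j,
    ContinuousOn (m.valueCoupling i j) (closure Ω)
  | .inl _, .inr _ => (contDiffOn_entry₂ h.b _ _).continuousOn
  | .inr _, .inl _ => (contDiffOn_entry₂ h.d _ _).continuousOn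
  | .inl _, .inl _ => continuousOn_const
  | .inr _, .inr _ => continuousOn_const

theorem continuousOn_strainCoupling (h : m.Regular Ω) : ∀ i j,
    ContinuousOn (m.strainCoupling i j) (closure Ω)
  | _, .inr _ => (contDiffOn_entry₄ h.B _ _ _ _).continuousOn
  | _, .inl _ => continuousOn_const

theorem continuousOn_microCoupling (h : m.Regular Ω) : ∀ i j,
    ContinuousOn (m.microCoupling i j) (closure Ω)
  | .inr _, _ => (contDiffOn_entry₄ h.B _ _ _ _).continuousOn
  | .inl _, _ => continuousOn_const

end Regular

end Coefficients

theorem _root_.IsCoercive.flip {V : Type*} [NormedAddCommGroup V] [NormedSpace ℝ V]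
    {B : V →L[ℝ] V →L[ℝ] ℝ} (h : IsCoercive B) : IsCoercive B.flip :=
  let ⟨c, hc, hB⟩ := h
  ⟨c, hc, hB⟩

theorem formPairing_symm_of_closure (hΩ : Bornology.IsBounded (Ω : Set Space)) {ι : Type*}
    [Fintype ι] {a : ι → ι → Space → ℝ} (ha : ∀ i k, ContinuousOn (a i k) (closure Ω))
    (hs : ∀ x ∈ closure (Ω : Set Space), ∀ i k, a i k x = a k i x) (f g : ι → L2 Ω) :
    formPairing a f g = formPairing a g f :=
  formPairing_symm (fun i k => memLp_top_of_continuousOn hΩ (ha i k))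
    ((ae_restrict_mem Ω.isOpen.measurableSet).mono fun x hx => hs x (subset_closure hx)) f g

theorem isCoercive_formPairing_of_closure (hΩ : Bornology.IsBounded (Ω : Set Space)) {ι : Type*}
    [Fintype ι] {a : ι → ι → Space → ℝ} (ha : ∀ i k, ContinuousOn (a i k) (closure Ω))
    (hpos : ∀ x ∈ closure (Ω : Set Space), ∀ ξ : ι → ℝ, ξ ≠ 0 →
      0 < ∑ i, ∑ k, a i k x * ξ i * ξ k) :
    IsCoercive (formPairing (μ := volume.restrict (Ω : Set Space)) a) := by
  obtain ⟨c, hc, h⟩ := hΩ.isCompact_closure.exists_forall_mul_sum_le ha hpos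
  exact isCoercive_formPairing (fun i k => memLp_top_of_continuousOn hΩ (ha i k)) hc
    ((ae_restrict_mem Ω.isOpen.measurableSet).mono fun x hx => h x (subset_closure hx))

namespace Coefficients

variable {m : Coefficients}

theorem PositiveInertia.inertiaU_pos (hin : m.PositiveInertia Ω) {x : Space}
    (hx : x ∈ closure (Ω : Set Space)) {ξ : Fin 3 → ℝ} (hξ : ξ ≠ 0) :
    0 < ∑ i, ∑ k, m.inertiaU i k x * ξ i * ξ k := by
  obtain ⟨i, hi⟩ := Function.ne_iff.1 hξ
  simp only [inertiaU, ite_mul, zero_mul, Finset.sum_ite_eq, Finset.mem_univ, if_true]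
  have h0 := hin.ρ x hx
  refine Finset.sum_pos' (fun j _ => ?_) ⟨i, Finset.mem_univ i, ?_⟩
  · rw [mul_assoc]
    exact mul_nonneg h0.le (mul_self_nonneg _)
  · rw [mul_assoc]
    exact mul_pos h0 (mul_self_pos.2 hi)

theorem PositiveInertia.inertiaZ_pos (hin : m.PositiveInertia Ω) {x : Space}
    (hx : x ∈ closure (Ω : Set Space)) {ξ : Unit ⊕ Fin 3 → ℝ} (hξ : ξ ≠ 0) :
    0 < ∑ i, ∑ k, m.inertiaZ i k x * ξ i * ξ k := by
  have e : ∑ i, ∑ k, m.inertiaZ i k x * ξ i * ξ k =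
      m.c x * ξ (.inl ()) * ξ (.inl ()) + ∑ i, ∑ j, m.cc x i j * ξ (.inr i) * ξ (.inr j) := by
    simp [inertiaZ]
  rw [e]
  have h1 : 0 ≤ m.c x * ξ (.inl ()) * ξ (.inl ()) := by
    rw [mul_assoc]
    exact mul_nonneg (hin.c x hx).le (mul_self_nonneg _)
  by_cases h : (fun i => ξ (.inr i)) = (0 : Fin 3 → ℝ)
  · have h2 : ξ (.inl ()) ≠ 0 := by
      refine fun h0 => hξ (funext fun i => ?_)
      rcases i with i | i
      · exact h0
      · exact congrFun h i
    have h3 : ∑ i, ∑ j, m.cc x i j * ξ (.inr i) * ξ (.inr j) = 0 :=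
      Finset.sum_eq_zero fun i _ => Finset.sum_eq_zero fun j _ => by
        rw [show ξ (.inr j) = 0 from congrFun h j, mul_zero]
    rw [h3, add_zero, mul_assoc]
    exact mul_pos (hin.c x hx) (mul_self_pos.2 h2)
  · exact add_pos_of_nonneg_of_pos h1 (hin.cc x hx _ h)

theorem PosDefDissipation.dissipation_pos (hdis : m.PosDefDissipation Ω) {x : Space}
    (hx : x ∈ closure (Ω : Set Space)) {ξ : Fin 3 ⊕ Fin 3 × Fin 3 → ℝ} (hξ : ξ ≠ 0) :
    0 < ∑ i, ∑ k, m.dissipation i k x * ξ i * ξ k := by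
  have h := hdis x hx (fun i => ξ (.inl i)) (fun i j => ξ (.inr (i, j))) (by
    by_contra! hcon
    refine hξ (funext fun i => ?_)
    rcases i with i | ⟨i, j⟩
    · exact congrFun hcon.1 i
    · exact congrFun (congrFun hcon.2 i) j)
  refine h.trans_eq ?_
  simp only [dissipation, Fintype.sum_sum_type, Fintype.sum_prod_type, Pi.zero_apply, zero_mul,
    Finset.sum_const_zero, add_zero, zero_add]
  congr 1
  refine Finset.sum_congr rfl fun i _ => Finset.sum_congr rfl fun j _ =>
    Finset.sum_congr rfl fun k _ => Finset.sum_congr rfl fun l _ => by ring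

/-- The energy inequality at τ = R = 0; the two index orders of `A` agree by its minor symmetry. -/
theorem CoerciveEnergy.elasticity_coercive (hen : m.CoerciveEnergy Ω)
    (hΩ : Bornology.IsBounded (Ω : Set Space)) (hreg : m.Regular Ω) (hsym : m.Symmetric Ω) :
    ∃ c, 0 < c ∧ ∀ v : Fin 3 → W120 Ω, c * ‖strainL Ω v‖ * ‖strainL Ω v‖ ≤
      formPairing m.elasticity (strainL Ω v) (strainL Ω v) := by
  obtain ⟨c, hc, h⟩ := hen
  refine ⟨c, hc, fun v => ?_⟩
  have hzero : ∀ᵐ x ∂volume.restrict (Ω : Set Space),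
      ∀ i, (grad (0 : W120 Ω) i : Space → ℝ) x = 0 :=
    ae_all_iff.2 fun i => Lp.coeFn_zero ℝ 2 _
  rw [formPairing_apply fun i k => memLp_top_of_continuousOn hΩ (hreg.continuousOn_elasticity i k),
    mul_assoc]
  refine (mul_le_mul_of_nonneg_left (norm_mul_norm_le_integral_sum _) hc.le).trans ?_
  refine le_trans (le_of_eq ?_) ((h v 0 0).trans (le_of_eq ?_))
  · congr 1
    refine integral_congr_ae ?_
    filter_upwards [hzero, coeFn_strainL v] with x h0 hs
    simp [hs, h0, Fintype.sum_prod_type]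
  · refine integral_congr_ae ?_
    filter_upwards [hzero, coeFn_strainL v, ae_restrict_mem Ω.isOpen.measurableSet]
      with x h0 hs hx
    simp only [hs, h0, Fintype.sum_prod_type, elasticity, Pi.zero_apply, mul_zero,
      Finset.sum_const_zero, add_zero]
    refine Finset.sum_congr rfl fun i _ => Finset.sum_congr rfl fun j _ =>
      Finset.sum_congr rfl fun k _ => Finset.sum_congr rfl fun l _ => ?_
    rw [(hsym.A x (subset_closure hx) i j k l).1]
    ring

/-- The form `∫ a_{ji} θ e_{ij}(w)`. -/
noncomputable def thermalForm (m : Coefficients) (Ω : Opens Space) :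
    W120 Ω × (Fin 3 → W120 Ω) →L[ℝ] (Fin 3 → W120 Ω) →L[ℝ] ℝ :=
  (formPairing m.thermalStress).flip.bilinearComp (temperature Ω) (strainL Ω)

theorem thermalForm_apply (z : W120 Ω × (Fin 3 → W120 Ω)) (v : Fin 3 → W120 Ω) :
    m.thermalForm Ω z v = formPairing m.thermalStress (strainL Ω v) (temperature Ω z) := rfl

/-- Integration by parts trades ∫ a θ v_{i,j} for -∫ a θ_{,j} v_i plus a term with the derivative of
a, so no derivative of v remains. This is where differentiability of the coefficient a matters. -/
theorem Regular.exists_abs_thermalForm_le (hreg : m.Regular Ω)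
    (hΩ : Bornology.IsBounded (Ω : Set Space)) :
    ∃ C, ∀ (z : W120 Ω × (Fin 3 → W120 Ω)) (v : Fin 3 → W120 Ω),
      |m.thermalForm Ω z v| ≤ C * (‖valueU Ω v‖ * (‖valueZ Ω z‖ + ‖gradZ Ω z‖)) := by
  have hone : ∀ p : Fin 3 × Fin 3, ∃ C, 0 ≤ C ∧ ∀ (z : W120 Ω × (Fin 3 → W120 Ω))
      (v : Fin 3 → W120 Ω) (i j : Fin 3),
      |weightedPairing (volume.restrict (Ω : Set Space)) (m.thermalStress p ()) (grad (v i) j)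
        (toL2 z.1)| ≤ C * (‖valueU Ω v‖ * (‖valueZ Ω z‖ + ‖gradZ Ω z‖)) := by
    intro p
    obtain ⟨C, hC0, hC⟩ := abs_weightedPairing_grad_add_le hΩ
      (a := m.thermalStress p ()) (contDiffOn_entry₂ hreg.a p.2 p.1)
    set P := weightedPairing (volume.restrict (Ω : Set Space)) (m.thermalStress p ())
    refine ⟨C + ‖P‖, by positivity, fun z v i j => ?_⟩
    have h1 := hC (v i) z.1 j
    have hv : ‖toL2 (v i)‖ ≤ ‖valueU Ω v‖ := norm_le_pi_norm (valueU Ω v) i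
    have hz : ‖toL2 z.1‖ ≤ ‖valueZ Ω z‖ := norm_le_pi_norm (valueZ Ω z) (.inl ())
    have hg : ‖grad z.1 j‖ ≤ ‖gradZ Ω z‖ := norm_le_pi_norm (gradZ Ω z) (.inl j)
    have h2 := abs_apply_apply_le (le_refl ‖P‖) hv hg
    have h3 : C * (‖toL2 (v i)‖ * ‖toL2 z.1‖) ≤ C * (‖valueU Ω v‖ * ‖valueZ Ω z‖) := by gcongr
    have h4 := abs_sub (P (grad (v i) j) (toL2 z.1) + P (toL2 (v i)) (grad z.1 j))
      (P (toL2 (v i)) (grad z.1 j))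
    rw [add_sub_cancel_right] at h4
    have h5 : 0 ≤ C * (‖valueU Ω v‖ * ‖gradZ Ω z‖) := by positivity
    have h6 : 0 ≤ ‖P‖ * (‖valueU Ω v‖ * ‖valueZ Ω z‖) := by positivity
    linarith
  choose C hC0 hC using hone
  refine ⟨∑ p, C p, fun z v => ?_⟩
  rw [thermalForm_apply, formPairing_eq_sum, Finset.sum_mul]
  refine (Finset.abs_sum_le_sum_abs _ _).trans (Finset.sum_le_sum fun p _ => ?_)
  rw [Fintype.sum_unique, strainL_apply, map_smul, map_add]
  have h1 := abs_le.1 (hC p z v p.1 p.2)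
  have h2 := abs_le.1 (hC p z v p.2 p.1)
  rw [smul_apply, add_apply, smul_eq_mul, temperature_apply, abs_le]
  constructor <;> linarith [h1.1, h1.2, h2.1, h2.2]

end Coefficients

/-- The type III system as a damped system. -/
noncomputable def dampedSystem (hΩ : Bornology.IsBounded (Ω : Set Space)) (m : Coefficients)
    (hreg : m.Regular Ω) (hsym : m.Symmetric Ω) (hin : m.PositiveInertia Ω)
    (hen : m.CoerciveEnergy Ω) (hdis : m.PosDefDissipation Ω) :
    DampedSystem (Fin 3 → W120 Ω) (W120 Ω × (Fin 3 → W120 Ω)) (Fin 3 → L2 Ω)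
      (Fin 3 × Fin 3 → L2 Ω) (Unit ⊕ Fin 3 → L2 Ω) (Fin 3 ⊕ Fin 3 × Fin 3 → L2 Ω) where
  T₀ := valueU Ω
  T₁ := strainL Ω
  P₀ := valueZ Ω
  P₁ := gradZ Ω
  ρ := (formPairing m.inertiaU).flip
  A := (formPairing m.elasticity).flip
  N := (formPairing m.inertiaZ).flip
  D := (formPairing m.dissipation).flip
  S := (formPairing m.conduction).flip
  Q := m.thermalForm Ω
  J₁ := (formPairing m.gradCoupling).flip
  J₂ := (formPairing m.valueCoupling).flip
  B₁ := (formPairing m.strainCoupling).flip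
  B₂ := (formPairing m.microCoupling).flip
  ρ_symm := fun v w => formPairing_symm_of_closure hΩ hreg.continuousOn_inertiaU
    (fun x _ i k => by simp only [Coefficients.inertiaU, eq_comm]) w v
  A_symm := fun v w => formPairing_symm_of_closure hΩ hreg.continuousOn_elasticity
    (fun x hx p q => by
      have h := hsym.A x hx
      simp only [Coefficients.elasticity]
      rw [(h p.2 p.1 q.1 q.2).1, (h p.1 p.2 q.1 q.2).2, (h q.1 q.2 p.1 p.2).1]) w v
  N_symm := fun v w => formPairing_symm_of_closure hΩ hreg.continuousOn_inertiaZ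
    (fun x hx i j => by
      rcases i with i | i <;> rcases j with j | j
      exacts [rfl, rfl, rfl, hsym.cc x hx i j]) w v
  ρ_coercive := (isCoercive_formPairing_of_closure hΩ hreg.continuousOn_inertiaU
    fun x hx ξ hξ => hin.inertiaU_pos hx hξ).flip
  N_coercive := (isCoercive_formPairing_of_closure hΩ hreg.continuousOn_inertiaZ
    fun x hx ξ hξ => hin.inertiaZ_pos hx hξ).flip
  D_coercive := (isCoercive_formPairing_of_closure hΩ hreg.continuousOn_dissipation
    fun x hx ξ hξ => hdis.dissipation_pos hx hξ).flip
  A_coercive := hen.elasticity_coercive hΩ hreg hsym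
  Q_bound := hreg.exists_abs_thermalForm_le hΩ

end TypeIII

/-! ### Abstract force and flux as the weak right-hand sides. -/

namespace TypeIII

open MeasureTheory Set Filter Topology TopologicalSpace
open scoped Distributions ENNReal ContDiff

variable {Ω : Opens Space}

theorem memLp_entry₂ (hΩ : Bornology.IsBounded (Ω : Set Space)) {a : Space → Fin 3 → Fin 3 → ℝ}
    (h : ContDiffOn ℝ 1 a (closure Ω)) (i j : Fin 3) :
    MemLp (fun x => a x i j) ∞ (volume.restrict (Ω : Set Space)) :=
  memLp_top_of_continuousOn hΩ (Coefficients.contDiffOn_entry₂ h i j).continuousOn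

theorem memLp_entry₄ (hΩ : Bornology.IsBounded (Ω : Set Space))
    {a : Space → Fin 3 → Fin 3 → Fin 3 → Fin 3 → ℝ}
    (h : ContDiffOn ℝ 1 a (closure Ω)) (i j k l : Fin 3) :
    MemLp (fun x => a x i j k l) ∞ (volume.restrict (Ω : Set Space)) :=
  memLp_top_of_continuousOn hΩ (Coefficients.contDiffOn_entry₄ h i j k l).continuousOn

theorem memLp_strain (u : Fin 3 → W120 Ω) (i j : Fin 3) :
    MemLp (strain u i j) 2 (volume.restrict (Ω : Set Space)) := by
  refine (Lp.memLp (strainL Ω u (i, j))).ae_eq ?_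
  filter_upwards [coeFn_strainL u] with x hx
  exact hx (i, j)

namespace Coefficients

variable (m : Coefficients)

/-- The stress `A_{jikl} e_{kl} - a_{ji} θ + B_{jikl} R_{l,k}`. -/
noncomputable def stress (u : Fin 3 → W120 Ω) (θ : W120 Ω) (R : Fin 3 → W120 Ω) (i j : Fin 3)
    (x : Space) : ℝ :=
  (∑ k, ∑ l, m.A x j i k l * strain u k l x) - m.a x j i * toL2 θ x
    + ∑ k, ∑ l, m.B x j i k l * grad (R l) k x

/-- The entropy flux `-d_{ij} M_j + K_{ij} τ_{,j} + K̃_{ij} θ_{,j}`. -/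
noncomputable def entropyFlux (τ θ : W120 Ω) (M : Fin 3 → W120 Ω) (i : Fin 3) (x : Space) : ℝ :=
  ∑ j, (- m.d x i j * toL2 (M j) x + m.K x i j * grad τ j x + m.Kt x i j * grad θ j x)

/-- The flux `B_{klji} e_{kl} - b_{ji} θ + C_{jikl} R_{k,l} + C̃_{jikl} M_{k,l}`. -/
noncomputable def momentFlux (u : Fin 3 → W120 Ω) (θ : W120 Ω) (R M : Fin 3 → W120 Ω) (i j : Fin 3)
    (x : Space) : ℝ :=
  (∑ k, ∑ l, m.B x k l j i * strain u k l x) - m.b x j i * toL2 θ x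
    + (∑ k, ∑ l, m.C x j i k l * grad (R k) l x)
    + ∑ k, ∑ l, m.Ct x j i k l * grad (M k) l x

/-- The mechanical entropy source `a_{ij} e_{ij}(v)`. -/
noncomputable def strainSource (v : Fin 3 → W120 Ω) (x : Space) : ℝ :=
  ∑ i, ∑ j, m.a x i j * strain v i j x

/-- The entropy source `b_{ij} M_{i,j}`. -/
noncomputable def momentSource (M : Fin 3 → W120 Ω) (x : Space) : ℝ :=
  ∑ i, ∑ j, m.b x i j * grad (M i) j x

/-- The source `d_{ij} θ_{,j}`. -/
noncomputable def heatSource (θ : W120 Ω) (i : Fin 3) (x : Space) : ℝ :=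
  ∑ j, m.d x i j * grad θ j x

variable {m}

theorem Regular.memLp_stress (h : m.Regular Ω) (hΩ : Bornology.IsBounded (Ω : Set Space))
    (u : Fin 3 → W120 Ω) (θ : W120 Ω) (R : Fin 3 → W120 Ω) (i j : Fin 3) :
    MemLp (m.stress u θ R i j) 2 (volume.restrict (Ω : Set Space)) :=
  ((memLp_finsetSum _ fun k _ => memLp_finsetSum _ fun l _ =>
    (memLp_entry₄ hΩ h.A j i k l).bounded_mul (memLp_strain u k l)).sub
    ((memLp_entry₂ hΩ h.a j i).bounded_mul (Lp.memLp _))).add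
    (memLp_finsetSum _ fun k _ => memLp_finsetSum _ fun l _ =>
      (memLp_entry₄ hΩ h.B j i k l).bounded_mul (Lp.memLp _))

theorem Regular.memLp_entropyFlux (h : m.Regular Ω) (hΩ : Bornology.IsBounded (Ω : Set Space))
    (τ θ : W120 Ω) (M : Fin 3 → W120 Ω) (i : Fin 3) :
    MemLp (m.entropyFlux τ θ M i) 2 (volume.restrict (Ω : Set Space)) :=
  memLp_finsetSum _ fun j _ =>
    (((memLp_entry₂ hΩ h.d i j).neg.bounded_mul (Lp.memLp _)).add
      ((memLp_entry₂ hΩ h.K i j).bounded_mul (Lp.memLp _))).add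
      ((memLp_entry₂ hΩ h.Kt i j).bounded_mul (Lp.memLp _))

theorem Regular.memLp_momentFlux (h : m.Regular Ω) (hΩ : Bornology.IsBounded (Ω : Set Space))
    (u : Fin 3 → W120 Ω) (θ : W120 Ω) (R M : Fin 3 → W120 Ω) (i j : Fin 3) :
    MemLp (m.momentFlux u θ R M i j) 2 (volume.restrict (Ω : Set Space)) :=
  (((memLp_finsetSum _ fun k _ => memLp_finsetSum _ fun l _ =>
    (memLp_entry₄ hΩ h.B k l j i).bounded_mul (memLp_strain u k l)).sub
    ((memLp_entry₂ hΩ h.b j i).bounded_mul (Lp.memLp _))).add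
    (memLp_finsetSum _ fun k _ => memLp_finsetSum _ fun l _ =>
      (memLp_entry₄ hΩ h.C j i k l).bounded_mul (Lp.memLp _))).add
    (memLp_finsetSum _ fun k _ => memLp_finsetSum _ fun l _ =>
      (memLp_entry₄ hΩ h.Ct j i k l).bounded_mul (Lp.memLp _))

theorem Regular.memLp_strainSource (h : m.Regular Ω) (hΩ : Bornology.IsBounded (Ω : Set Space))
    (v : Fin 3 → W120 Ω) : MemLp (m.strainSource v) 2 (volume.restrict (Ω : Set Space)) :=
  memLp_finsetSum _ fun i _ => memLp_finsetSum _ fun j _ =>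
    (memLp_entry₂ hΩ h.a i j).bounded_mul (memLp_strain v i j)

theorem Regular.memLp_momentSource (h : m.Regular Ω) (hΩ : Bornology.IsBounded (Ω : Set Space))
    (M : Fin 3 → W120 Ω) : MemLp (m.momentSource M) 2 (volume.restrict (Ω : Set Space)) :=
  memLp_finsetSum _ fun i _ => memLp_finsetSum _ fun j _ =>
    (memLp_entry₂ hΩ h.b i j).bounded_mul (Lp.memLp _)

theorem Regular.memLp_heatSource (h : m.Regular Ω) (hΩ : Bornology.IsBounded (Ω : Set Space))
    (θ : W120 Ω) (i : Fin 3) : MemLp (m.heatSource θ i) 2 (volume.restrict (Ω : Set Space)) :=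
  memLp_finsetSum _ fun j _ => (memLp_entry₂ hΩ h.d i j).bounded_mul (Lp.memLp _)

/-- A symmetric stress does the same work on a displacement gradient and on its strain. -/
theorem sum_mul_symm_part {σ g : Fin 3 → Fin 3 → ℝ} (hσ : ∀ i j, σ i j = σ j i) :
    ∑ i, ∑ j, σ i j * ((g i j + g j i) / 2) = ∑ i, ∑ j, σ i j * g i j := by
  have h1 : ∑ i, ∑ j, σ i j * g j i = ∑ i, ∑ j, σ i j * g i j := by
    rw [Finset.sum_comm]
    exact Finset.sum_congr rfl fun i _ => Finset.sum_congr rfl fun j _ => by rw [hσ]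
  have h2 : ∑ i, ∑ j, σ i j * ((g i j + g j i) / 2)
      = (∑ i, ∑ j, σ i j * g i j) / 2 + (∑ i, ∑ j, σ i j * g j i) / 2 := by
    simp only [Finset.sum_div, ← Finset.sum_add_distrib]
    exact Finset.sum_congr rfl fun i _ => Finset.sum_congr rfl fun j _ => by ring
  rw [h2, h1, add_halves]

theorem Symmetric.stress_symm (h : m.Symmetric Ω) {x : Space} (hx : x ∈ closure (Ω : Set Space))
    (u : Fin 3 → W120 Ω) (θ : W120 Ω) (R : Fin 3 → W120 Ω) (i j : Fin 3) :
    m.stress u θ R i j x = m.stress u θ R j i x := by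
  have hA : ∀ k l, m.A x j i k l = m.A x i j k l := fun k l => (h.A x hx j i k l).1
  have hB : ∀ k l, m.B x j i k l = m.B x i j k l := fun k l => (h.B x hx j i k l).1
  simp only [stress, hA, hB, h.a x hx j i]

end Coefficients

variable (hΩ : Bornology.IsBounded (Ω : Set Space)) {m : Coefficients}
    (hreg : m.Regular Ω) (hsym : m.Symmetric Ω) (hin : m.PositiveInertia Ω)
    (hen : m.CoerciveEnergy Ω) (hdis : m.PosDefDissipation Ω)

theorem integrable_mul_L2 {f : Space → ℝ} (hf : MemLp f 2 (volume.restrict (Ω : Set Space)))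
    (g : L2 Ω) : Integrable (fun x => f x * g x) (volume.restrict (Ω : Set Space)) :=
  hf.integrable_mul (Lp.memLp g)

theorem neg_integral_add_sub {α : Type*} [MeasurableSpace α] {μ : Measure α} {f g h : α → ℝ}
    (hf : Integrable f μ) (hg : Integrable g μ) (hh : Integrable h μ) :
    -(∫ x, f x ∂μ) + (∫ x, g x ∂μ) - ∫ x, h x ∂μ = ∫ x, (-f x + g x - h x) ∂μ := by
  have e1 : ∫ x, (-f x + g x - h x) ∂μ = (∫ x, (-f x + g x) ∂μ) - ∫ x, h x ∂μ :=
    integral_sub (hf.neg.add hg) hh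
  have e2 : ∫ x, (-f x + g x) ∂μ = (∫ x, -f x ∂μ) + ∫ x, g x ∂μ := integral_add hf.neg hg
  rw [e1, e2, integral_neg]

theorem neg_integral_sub_sub {α : Type*} [MeasurableSpace α] {μ : Measure α} {f g h : α → ℝ}
    (hf : Integrable f μ) (hg : Integrable g μ) (hh : Integrable h μ) :
    -(∫ x, f x ∂μ) - (∫ x, g x ∂μ) - ∫ x, h x ∂μ = -∫ x, (f x + g x + h x) ∂μ := by
  have e1 : ∫ x, (f x + g x + h x) ∂μ = (∫ x, (f x + g x) ∂μ) + ∫ x, h x ∂μ :=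
    integral_add (hf.add hg) hh
  have e2 : ∫ x, (f x + g x) ∂μ = (∫ x, f x ∂μ) + ∫ x, g x ∂μ := integral_add hf hg
  rw [e1, e2]
  ring

theorem neg_integral_sub_sub_sub_sub_sub {α : Type*} [MeasurableSpace α] {μ : Measure α}
    {f g h p q r : α → ℝ} (hf : Integrable f μ) (hg : Integrable g μ) (hh : Integrable h μ)
    (hp : Integrable p μ) (hq : Integrable q μ) (hr : Integrable r μ) :
    -(∫ x, f x ∂μ) - (∫ x, g x ∂μ) - (∫ x, h x ∂μ) - (∫ x, p x ∂μ) - (∫ x, q x ∂μ) - ∫ x, r x ∂μ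
      = -∫ x, (f x + g x + h x + p x + q x + r x) ∂μ := by
  have e1 : ∫ x, (f x + g x + h x + p x + q x + r x) ∂μ
      = (∫ x, (f x + g x + h x + p x + q x) ∂μ) + ∫ x, r x ∂μ :=
    integral_add ((((hf.add hg).add hh).add hp).add hq) hr
  have e2 : ∫ x, (f x + g x + h x + p x + q x) ∂μ
      = (∫ x, (f x + g x + h x + p x) ∂μ) + ∫ x, q x ∂μ :=
    integral_add (((hf.add hg).add hh).add hp) hq
  have e3 : ∫ x, (f x + g x + h x + p x) ∂μ = (∫ x, (f x + g x + h x) ∂μ) + ∫ x, p x ∂μ :=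
    integral_add ((hf.add hg).add hh) hp
  rw [e1, e2, e3, neg_integral_sub_sub hf hg hh]
  ring

theorem neg_integral_sub_sub_add_sum {α ι : Type*} [Fintype ι] [MeasurableSpace α]
    {μ : Measure α} {p q r : α → ℝ} {f g : ι → α → ℝ} (hp : Integrable p μ) (hq : Integrable q μ)
    (hr : Integrable r μ) (hf : ∀ i, Integrable (f i) μ) (hg : ∀ i, Integrable (g i) μ) :
    -(∫ x, p x ∂μ) - (∫ x, q x ∂μ) - (∫ x, r x ∂μ) + ∑ i, (-(∫ x, f i x ∂μ) - ∫ x, g i x ∂μ)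
      = -∫ x, (p x + q x + r x + (∑ i, f i x + ∑ i, g i x)) ∂μ := by
  have hfs := integrable_finsetSum Finset.univ fun i _ => hf i
  have hgs := integrable_finsetSum Finset.univ fun i _ => hg i
  have e1 : ∫ x, (p x + q x + r x + (∑ i, f i x + ∑ i, g i x)) ∂μ
      = (∫ x, (p x + q x + r x) ∂μ) + ∫ x, (∑ i, f i x + ∑ i, g i x) ∂μ :=
    integral_add ((hp.add hq).add hr) (hfs.add hgs)
  have e2 : ∫ x, (∑ i, f i x + ∑ i, g i x) ∂μ = (∫ x, ∑ i, f i x ∂μ) + ∫ x, ∑ i, g i x ∂μ :=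
    integral_add hfs hgs
  rw [neg_integral_sub_sub hp hq hr, e1, e2, integral_finsetSum _ fun i _ => hf i,
    integral_finsetSum _ fun i _ => hg i, Finset.sum_sub_distrib, Finset.sum_neg_distrib]
  ring

/-- The virtual work of the stress. -/
theorem force_dampedSystem (u w : Fin 3 → W120 Ω) (y z : W120 Ω × (Fin 3 → W120 Ω)) :
    (dampedSystem hΩ m hreg hsym hin hen hdis).force (u, y, z) w
      = ∑ i, -∫ x in (Ω : Set Space), ∑ j, m.stress u z.1 y.2 i j x * grad (w i) j x := by
  have mA := fun p q => memLp_top_of_continuousOn hΩ (hreg.continuousOn_elasticity p q)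
  have mQ := fun p q => memLp_top_of_continuousOn hΩ (hreg.continuousOn_thermalStress p q)
  have mB := fun p q => memLp_top_of_continuousOn hΩ (hreg.continuousOn_strainCoupling p q)
  have iA := integrable_formPairing mA (strainL Ω w) (strainL Ω u)
  have iQ := integrable_formPairing mQ (strainL Ω w) (temperature Ω z)
  have iB := integrable_formPairing mB (strainL Ω w) (gradZ Ω y)
  rw [DampedSystem.force_apply]
  change -formPairing m.elasticity (strainL Ω w) (strainL Ω u)
    + formPairing m.thermalStress (strainL Ω w) (temperature Ω z)
    - formPairing m.strainCoupling (strainL Ω w) (gradZ Ω y) = _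
  rw [formPairing_apply mA, formPairing_apply mQ, formPairing_apply mB,
    neg_integral_add_sub iA iQ iB, Finset.sum_neg_distrib, ← integral_finsetSum _ fun i _ => integrable_finsetSum _ fun j _ =>
      integrable_mul_L2 (hreg.memLp_stress hΩ u z.1 y.2 i j) (grad (w i) j), ← integral_neg]
  refine integral_congr_ae ?_
  filter_upwards [coeFn_strainL u, coeFn_strainL w, ae_restrict_mem Ω.isOpen.measurableSet]
    with x hu hw hx
  -- The weak equation pairs the stress with the full gradient of w, the abstract form with its
  -- strain; symmetry of the stress identifies the two.
  rw [← Coefficients.sum_mul_symm_part (fun i j =>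
    hsym.stress_symm (subset_closure hx) u z.1 y.2 i j)]
  simp only [hu, hw]
  simp only [Fintype.sum_prod_type, Fintype.sum_sum_type, Coefficients.elasticity,
    Coefficients.thermalStress, Coefficients.strainCoupling, Pi.zero_apply, zero_mul,
    Finset.sum_const_zero, zero_add, Fintype.sum_unique, temperature_apply, gradZ_inr]
  simp only [← Finset.sum_neg_distrib, ← Finset.sum_add_distrib, ← Finset.sum_sub_distrib]
  refine Finset.sum_congr rfl fun i _ => Finset.sum_congr rfl fun j _ => ?_
  rw [Coefficients.stress, Finset.sum_comm (f := fun k l => m.B x j i k l * grad (y.2 l) k x)]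
  change _ = -(_ * strain w i j x)
  simp only [Finset.sum_neg_distrib, add_mul, sub_mul, Finset.sum_mul]
  have e1 : ∑ k, ∑ l, m.A x j i k l * strain w i j x * strain u k l x
      = ∑ k, ∑ l, m.A x j i k l * strain u k l x * strain w i j x :=
    Finset.sum_congr rfl fun k _ => Finset.sum_congr rfl fun l _ => by ring
  have e2 : ∑ k, ∑ l, m.B x j i l k * strain w i j x * grad (y.2 k) l x
      = ∑ k, ∑ l, m.B x j i l k * grad (y.2 k) l x * strain w i j x :=
    Finset.sum_congr rfl fun k _ => Finset.sum_congr rfl fun l _ => by ring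
  rw [e1, e2]
  ring

set_option maxHeartbeats 2000000 in
/-- The virtual work of the fluxes and sources of temperature and microtemperatures. -/
theorem flux_dampedSystem (u v : Fin 3 → W120 Ω) (y z ζ : W120 Ω × (Fin 3 → W120 Ω)) :
    (dampedSystem hΩ m hreg hsym hin hen hdis).flux (u, v, y, z) ζ
      = (-(∫ x in (Ω : Set Space), m.strainSource v x * toL2 ζ.1 x)
        - (∫ x in (Ω : Set Space), ∑ i, m.entropyFlux y.1 z.1 z.2 i x * grad ζ.1 i x)
        - ∫ x in (Ω : Set Space), m.momentSource z.2 x * toL2 ζ.1 x)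
      + ∑ i, (-(∫ x in (Ω : Set Space), ∑ j, m.momentFlux u z.1 y.2 z.2 i j x * grad (ζ.2 i) j x)
        - ∫ x in (Ω : Set Space), m.heatSource z.1 i x * toL2 (ζ.2 i) x) := by
  have mD := fun p q => memLp_top_of_continuousOn hΩ (hreg.continuousOn_dissipation p q)
  have mS := fun p q => memLp_top_of_continuousOn hΩ (hreg.continuousOn_conduction p q)
  have mQ := fun p q => memLp_top_of_continuousOn hΩ (hreg.continuousOn_thermalStress p q)
  have mJ := fun p q => memLp_top_of_continuousOn hΩ (hreg.continuousOn_gradCoupling p q)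
  have mV := fun p q => memLp_top_of_continuousOn hΩ (hreg.continuousOn_valueCoupling p q)
  have mB := fun p q => memLp_top_of_continuousOn hΩ (hreg.continuousOn_microCoupling p q)
  have iD := integrable_formPairing mD (gradZ Ω ζ) (gradZ Ω z)
  have iS := integrable_formPairing mS (gradZ Ω ζ) (gradZ Ω y)
  have iQ := integrable_formPairing mQ (strainL Ω v) (temperature Ω ζ)
  have iJ := integrable_formPairing mJ (gradZ Ω ζ) (valueZ Ω z)
  have iV := integrable_formPairing mV (valueZ Ω ζ) (gradZ Ω z)
  have iB := integrable_formPairing mB (gradZ Ω ζ) (strainL Ω u)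
  have jE : Integrable (fun x => m.strainSource v x * toL2 ζ.1 x)
      (volume.restrict (Ω : Set Space)) := integrable_mul_L2 (hreg.memLp_strainSource hΩ v) _
  have jF : Integrable (fun x => ∑ i, m.entropyFlux y.1 z.1 z.2 i x * grad ζ.1 i x)
      (volume.restrict (Ω : Set Space)) := integrable_finsetSum _ fun i _ =>
    integrable_mul_L2 (hreg.memLp_entropyFlux hΩ y.1 z.1 z.2 i) _
  have jM : Integrable (fun x => m.momentSource z.2 x * toL2 ζ.1 x)
      (volume.restrict (Ω : Set Space)) := integrable_mul_L2 (hreg.memLp_momentSource hΩ z.2) _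
  have jG : ∀ i, Integrable (fun x => ∑ j, m.momentFlux u z.1 y.2 z.2 i j x * grad (ζ.2 i) j x)
      (volume.restrict (Ω : Set Space)) := fun i => integrable_finsetSum _ fun j _ =>
    integrable_mul_L2 (hreg.memLp_momentFlux hΩ u z.1 y.2 z.2 i j) _
  have jH : ∀ i, Integrable (fun x => m.heatSource z.1 i x * toL2 (ζ.2 i) x)
      (volume.restrict (Ω : Set Space)) := fun i =>
    integrable_mul_L2 (hreg.memLp_heatSource hΩ z.1 i) _
  rw [DampedSystem.flux_apply]
  change -formPairing m.dissipation (gradZ Ω ζ) (gradZ Ω z)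
    - formPairing m.conduction (gradZ Ω ζ) (gradZ Ω y)
    - formPairing m.thermalStress (strainL Ω v) (temperature Ω ζ)
    - formPairing m.gradCoupling (gradZ Ω ζ) (valueZ Ω z)
    - formPairing m.valueCoupling (valueZ Ω ζ) (gradZ Ω z)
    - formPairing m.microCoupling (gradZ Ω ζ) (strainL Ω u) = _
  rw [formPairing_apply mD, formPairing_apply mS, formPairing_apply mQ, formPairing_apply mJ,
    formPairing_apply mV, formPairing_apply mB]
  rw [neg_integral_sub_sub_sub_sub_sub iD iS iQ iJ iV iB,
    neg_integral_sub_sub_add_sum jE jF jM jG jH]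
  congr 1
  refine integral_congr_ae ?_
  filter_upwards [coeFn_strainL u, coeFn_strainL v, ae_restrict_mem Ω.isOpen.measurableSet]
    with x hu hv hx
  have hE : m.strainSource v x * toL2 ζ.1 x
      = ∑ i, ∑ j, m.a x j i * strain v i j x * toL2 ζ.1 x := by
    simp only [Coefficients.strainSource, Finset.sum_mul]
    exact Finset.sum_congr rfl fun i _ => Finset.sum_congr rfl fun j _ => by
      rw [hsym.a x (subset_closure hx) i j]
  have hM : m.momentSource z.2 x * toL2 ζ.1 x
      = ∑ i, ∑ j, m.b x i j * toL2 ζ.1 x * grad (z.2 i) j x := by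
    simp only [Coefficients.momentSource, Finset.sum_mul]
    exact Finset.sum_congr rfl fun i _ => Finset.sum_congr rfl fun j _ => by ring
  have hF : ∑ i, m.entropyFlux y.1 z.1 z.2 i x * grad ζ.1 i x
      = (∑ i, ∑ j, -m.d x i j * grad ζ.1 i x * toL2 (z.2 j) x)
        + (∑ i, ∑ j, m.K x i j * grad ζ.1 i x * grad y.1 j x)
        + ∑ i, ∑ j, m.Kt x i j * grad ζ.1 i x * grad z.1 j x := by
    simp only [Coefficients.entropyFlux, Finset.sum_mul, ← Finset.sum_add_distrib]
    exact Finset.sum_congr rfl fun i _ => Finset.sum_congr rfl fun j _ => by ring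
  have hH : ∑ i, m.heatSource z.1 i x * toL2 (ζ.2 i) x
      = ∑ i, ∑ j, m.d x i j * toL2 (ζ.2 i) x * grad z.1 j x := by
    simp only [Coefficients.heatSource, Finset.sum_mul]
    exact Finset.sum_congr rfl fun i _ => Finset.sum_congr rfl fun j _ => by ring
  have hG : ∑ i, ∑ j, m.momentFlux u z.1 y.2 z.2 i j x * grad (ζ.2 i) j x
      = (∑ i, ∑ j, ∑ k, ∑ l, m.B x k l j i * grad (ζ.2 i) j x * strain u k l x)
        + (∑ i, ∑ j, -m.b x j i * grad (ζ.2 i) j x * toL2 z.1 x)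
        + (∑ i, ∑ j, ∑ k, ∑ l, m.C x j i k l * grad (ζ.2 i) j x * grad (y.2 k) l x)
        + ∑ i, ∑ j, ∑ k, ∑ l, m.Ct x j i k l * grad (ζ.2 i) j x * grad (z.2 k) l x := by
    simp only [← Finset.sum_add_distrib]
    refine Finset.sum_congr rfl fun i _ => Finset.sum_congr rfl fun j _ => ?_
    have e : ∀ (t : Fin 3 → Fin 3 → ℝ) (s : Fin 3 → Fin 3 → ℝ) (g : ℝ),
        ∑ k, ∑ l, t k l * g * s k l = (∑ k, ∑ l, t k l * s k l) * g := by
      intro t s g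
      simp only [Finset.sum_mul]
      exact Finset.sum_congr rfl fun k _ => Finset.sum_congr rfl fun l _ => by ring
    rw [e (fun k l => m.B x k l j i) (fun k l => strain u k l x),
      e (fun k l => m.C x j i k l) (fun k l => grad (y.2 k) l x),
      e (fun k l => m.Ct x j i k l) (fun k l => grad (z.2 k) l x), Coefficients.momentFlux]
    ring
  rw [hE, hM, hF, hH, hG]
  simp only [hu, hv]
  simp only [Fintype.sum_prod_type, Fintype.sum_sum_type, Coefficients.dissipation,
    Coefficients.conduction, Coefficients.thermalStress, Coefficients.gradCoupling,
    Coefficients.valueCoupling, Coefficients.microCoupling, Pi.zero_apply, zero_mul,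
    Finset.sum_const_zero, zero_add, add_zero, Fintype.sum_unique, temperature_apply, gradZ_inr,
    gradZ_inl, valueZ_inl, valueZ_inr]
  ring

end TypeIII

/-! ### Curves in time and the inertia forms. -/

namespace TypeIII

open MeasureTheory Set Filter Topology TopologicalSpace
open scoped Distributions ENNReal ContDiff

variable {Ω : Opens Space}

namespace TimeRegular

variable {f : ℝ → W120 Ω}

theorem hasDerivWithinAt (h : TimeRegular f) {t : ℝ} (ht : 0 ≤ t) :
    HasDerivWithinAt f (timeDeriv f t) (Ici 0) t :=
  (h.1.differentiableOn one_ne_zero t ht).hasDerivWithinAt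

theorem continuousOn_timeDeriv (h : TimeRegular f) : ContinuousOn (timeDeriv f) (Ici 0) :=
  h.1.continuousOn_derivWithin (uniqueDiffOn_Ici 0) le_rfl

theorem hasDerivWithinAt_toL2_timeDeriv (h : TimeRegular f) {t : ℝ} (ht : 0 ≤ t) :
    HasDerivWithinAt (fun s => toL2 (timeDeriv f s)) (accel f t) (Ici 0) t :=
  (h.2.differentiableOn one_ne_zero t ht).hasDerivWithinAt

/-- The derivative restricts to a right derivative at T, which is computed from the zero curve after
T. -/
theorem timeDeriv_eq_zero (h : TimeRegular f) {T : ℝ} (hT : 0 ≤ T) (hf : ∀ t, T ≤ t → f t = 0) :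
    timeDeriv f T = 0 := by
  have h1 : HasDerivWithinAt f (timeDeriv f T) (Ici T) T :=
    (h.hasDerivWithinAt hT).mono (Ici_subset_Ici.2 hT)
  have h2 : HasDerivWithinAt f 0 (Ici T) T :=
    (hasDerivWithinAt_const T (Ici T) (0 : W120 Ω)).congr (fun t ht => hf t ht) (hf T le_rfl)
  exact (uniqueDiffWithinAt_Ici T).eq_deriv _ h1 h2

/-- Injectivity into L² upgrades the vanishing of the velocity to W₀^{1,2}, so the curve is constant
and takes its terminal value. -/
theorem eq_zero_of_toL2_timeDeriv_eq_zero (h : TimeRegular f)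
    (hΩ : Bornology.IsBounded (Ω : Set Space)) {T : ℝ} (hT : 0 ≤ T) (hfT : f T = 0)
    (hv : ∀ t ∈ Icc 0 T, toL2 (timeDeriv f t) = 0) : ∀ t ∈ Icc 0 T, f t = 0 := by
  have hconst := constant_of_has_deriv_right_zero (f := f) (a := 0) (b := T)
    (h.1.continuousOn.mono Icc_subset_Ici_self) fun t ht => by
      rw [← eq_zero_of_toL2_eq_zero hΩ (hv t (Ico_subset_Icc_self ht))]
      exact (h.hasDerivWithinAt ht.1).mono (Ici_subset_Ici.2 ht.1)
  intro t ht
  rw [hconst t ht, ← hconst T (right_mem_Icc.2 hT), hfT]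

end TimeRegular

theorem formPairing_inertiaU (hΩ : Bornology.IsBounded (Ω : Set Space)) {m : Coefficients}
    (hreg : m.Regular Ω) (w : Fin 3 → W120 Ω) (f : Fin 3 → L2 Ω) :
    formPairing m.inertiaU (valueU Ω w) f
      = ∑ i, ∫ x in (Ω : Set Space), m.ρ x * f i x * toL2 (w i) x := by
  have hm : MemLp m.ρ ∞ (volume.restrict (Ω : Set Space)) :=
    memLp_top_of_continuousOn hΩ hreg.ρ.continuousOn
  rw [formPairing_apply fun i k => memLp_top_of_continuousOn hΩ (hreg.continuousOn_inertiaU i k),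
    ← integral_finsetSum _ fun i _ => integrable_weight_mul_mul hm (f i) (toL2 (w i))]
  congr 1
  ext x
  refine Finset.sum_congr rfl fun i _ => ?_
  simp only [Coefficients.inertiaU, ite_mul, zero_mul, Finset.sum_ite_eq, Finset.mem_univ, if_true,
    valueU_apply]
  ring

theorem formPairing_inertiaZ (hΩ : Bornology.IsBounded (Ω : Set Space)) {m : Coefficients}
    (hreg : m.Regular Ω) (w : W120 Ω × (Fin 3 → W120 Ω)) (f : Unit ⊕ Fin 3 → L2 Ω) :
    formPairing m.inertiaZ (valueZ Ω w) f
      = (∫ x in (Ω : Set Space), m.c x * f (.inl ()) x * toL2 w.1 x)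
        + ∑ i, ∫ x in (Ω : Set Space), (∑ j, m.cc x i j * f (.inr j) x) * toL2 (w.2 i) x := by
  have hm : MemLp m.c ∞ (volume.restrict (Ω : Set Space)) :=
    memLp_top_of_continuousOn hΩ hreg.c.continuousOn
  have hcc : ∀ i, Integrable (fun x => (∑ j, m.cc x i j * f (.inr j) x) * toL2 (w.2 i) x)
      (volume.restrict (Ω : Set Space)) := fun i =>
    integrable_mul_L2 (memLp_finsetSum _ fun j _ =>
      (memLp_entry₂ hΩ hreg.cc i j).bounded_mul (Lp.memLp _)) _
  rw [formPairing_apply fun i k => memLp_top_of_continuousOn hΩ (hreg.continuousOn_inertiaZ i k),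
    ← integral_finsetSum _ fun i _ => hcc i,
    ← integral_add (integrable_weight_mul_mul hm _ _) (integrable_finsetSum _ fun i _ => hcc i)]
  congr 1
  ext x
  simp only [Fintype.sum_sum_type, Fintype.sum_unique, Coefficients.inertiaZ, Pi.zero_apply,
    zero_mul, Finset.sum_const_zero, add_zero, zero_add, valueZ_inr, Finset.sum_mul]
  congr 1
  · change _ * toL2 w.1 x * _ = _
    rw [mul_right_comm]
  · exact Finset.sum_congr rfl fun i _ => Finset.sum_congr rfl fun j _ => by ring

end TypeIII

/-! ### Conclusion. -/

theorem theorem4 (Ω : TopologicalSpace.Opens TypeIII.Space)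
    (hΩ : Bornology.IsBounded (Ω : Set TypeIII.Space))
    (m : TypeIII.Coefficients) (hreg : m.Regular Ω) (hsym : m.Symmetric Ω)
    (hin : m.PositiveInertia Ω) (hen : m.CoerciveEnergy Ω) (hdis : m.PosDefDissipation Ω)
    (u : Fin 3 → ℝ → TypeIII.W120 Ω) (τ : ℝ → TypeIII.W120 Ω) (R : Fin 3 → ℝ → TypeIII.W120 Ω)
    (hsol : TypeIII.IsSolution m Ω u τ R) (t₀ : ℝ) (ht₀ : 0 ≤ t₀)
    (hvan : ∀ t, t₀ ≤ t → (∀ i, u i t = 0) ∧ τ t = 0 ∧ ∀ i, R i t = 0) :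
    ∀ t, 0 ≤ t → (∀ i, u i t = 0) ∧ τ t = 0 ∧ ∀ i, R i t = 0 := by
  open TypeIII Set in
  rcases ht₀.eq_or_lt with rfl | hpos
  · exact hvan
  have hu := hsol.regular_u
  have hτ := hsol.regular_τ
  have hR := hsol.regular_R
  have hvT : ∀ i, timeDeriv (u i) t₀ = 0 := fun i =>
    (hu i).timeDeriv_eq_zero ht₀ fun t ht => (hvan t ht).1 i
  have hθT : timeDeriv τ t₀ = 0 := hτ.timeDeriv_eq_zero ht₀ fun t ht => (hvan t ht).2.1
  have hMT : ∀ i, timeDeriv (R i) t₀ = 0 := fun i =>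
    (hR i).timeDeriv_eq_zero ht₀ fun t ht => (hvan t ht).2.2 i
  have hT := hvan t₀ le_rfl
  have hzero := (dampedSystem hΩ m hreg hsym hin hen hdis).eq_zero_of_terminal_eq_zero hpos
    (u := fun t i => u i t) (v := fun t i => timeDeriv (u i) t)
    (y := fun t => (τ t, fun i => R i t))
    (z := fun t => (timeDeriv τ t, fun i => timeDeriv (R i) t))
    (fun t ht => hasDerivWithinAt_pi.2 fun i => (hu i).hasDerivWithinAt ht)
    (fun t ht => (hτ.hasDerivWithinAt ht).prodMk
      (hasDerivWithinAt_pi.2 fun i => (hR i).hasDerivWithinAt ht))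
    (continuousOn_pi.2 fun i => (hu i).continuousOn_timeDeriv)
    (hτ.continuousOn_timeDeriv.prodMk (continuousOn_pi.2 fun i => (hR i).continuousOn_timeDeriv))
    (funext hT.1) (funext hvT) (Prod.ext hT.2.1 (funext hT.2.2)) (Prod.ext hθT (funext hMT))
    (fun w t ht => by
      rw [force_dampedSystem]
      have h1 : HasDerivWithinAt (fun t => valueU Ω fun i => timeDeriv (u i) t)
          (fun i => accel (u i) t) (Ici 0) t :=
        hasDerivWithinAt_pi.2 fun i => (hu i).hasDerivWithinAt_toL2_timeDeriv ht
      -- The momentum against w is a bounded functional of the velocity in L², so its derivative is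
      -- the same functional of the acceleration, which the weak equation evaluates.
      have h2 := (formPairing m.inertiaU (valueU Ω w)).hasFDerivAt.comp_hasDerivWithinAt t h1
      rw [formPairing_inertiaU hΩ hreg,
        Finset.sum_congr rfl fun i _ => hsol.motion t ht i (w i)] at h2
      exact h2)
    (fun w t ht => by
      rw [flux_dampedSystem]
      have h1 : HasDerivWithinAt
          (fun t => valueZ Ω (timeDeriv τ t, fun i => timeDeriv (R i) t))
          (Sum.elim (fun _ => accel τ t) fun i => accel (R i) t) (Ici 0) t := by
        refine hasDerivWithinAt_pi.2 fun i => ?_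
        rcases i with i | i
        · exact hτ.hasDerivWithinAt_toL2_timeDeriv ht
        · exact (hR i).hasDerivWithinAt_toL2_timeDeriv ht
      have h2 := (formPairing m.inertiaZ (valueZ Ω w)).hasFDerivAt.comp_hasDerivWithinAt t h1
      rw [formPairing_inertiaZ hΩ hreg] at h2
      simp only [Sum.elim_inl, Sum.elim_inr] at h2
      rw [hsol.entropy t ht w.1,
        Finset.sum_congr rfl fun i _ => hsol.entropyMoment t ht i (w.2 i)] at h2
      exact h2)
  intro t ht
  rcases le_total t₀ t with h | h
  · exact hvan t h
  have hmem : t ∈ Icc 0 t₀ := ⟨ht, h⟩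
  exact ⟨fun i => (hu i).eq_zero_of_toL2_timeDeriv_eq_zero hΩ ht₀ (hT.1 i)
      (fun s hs => congrFun (hzero s hs).1 i) t hmem,
    hτ.eq_zero_of_toL2_timeDeriv_eq_zero hΩ ht₀ hT.2.1
      (fun s hs => congrFun (hzero s hs).2 (.inl ())) t hmem,
    fun i => (hR i).eq_zero_of_toL2_timeDeriv_eq_zero hΩ ht₀ (hT.2.2 i)
      (fun s hs => congrFun (hzero s hs).2 (.inr i)) t hmem⟩
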